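/- Let $n\in\mathbb N$ and let $V\in C^2(\mathbb{R}^n)$ be a real-valued function for which there is a real number $s<\frac43$ such that for every multi-index $\alpha$ with $|\alpha|=2$ there is a constant $C_\alpha>0$ with $$|\partial_x^\alpha V(x)|\le C_\alpha\bigl(1+|\partial_xV(x)|^2\bigr)^{s/2}\qquad\text{for all }x\in\mathbb{R}^n .$$ Let $\triangle^{(0)}_{V/2}$ be the Witten Laplacian on $0$-forms, i.e. the closure in the complex Hilbert space $L^2(\mathbb{R}^n)$ of the operator $$-\triangle_x+\tfrac14|\partial_xV(x)|^2-\tfrac12\triangle_xV(x)$$ with domain $C_0^\infty(\mathbb{R}^n)$, and let $P$ be the Fokker–Planck operator, i.e. the closure in the complex Hilbert space $L^2(\mathbb{R}^{2n})$ of the operator $$y\cdot\partial_x-\partial_xV(x)\cdot\partial_y-\triangle_y+\tfrac14|y|^2-\tfrac n2,\qquad (x,y)\in\mathbb{R}^n\times\mathbb{R}^n,$$ with domain $C_0^\infty(\mathbb{R}^{2n})$. If $\triangle^{(0)}_{V/2}$ has compact resolvent, then $P$ has compact resolvent. Here a closed operator $T$ on a Hilbert space is said to have compact resolvent if, for some $z\in\mathbb{C}$,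 the operator $T-z$ is a bijection from the domain of $T$ onto the whole space whose inverse $(T-z)^{-1}$ is a compact operator; compactness for one $z$ in the resolvent set is equivalent to compactness for all of them. -/

import Mathlib

open MeasureTheory TopologicalSpace
open scoped ContDiff Distributions

noncomputable section

namespace FokkerPlanck

/-- `ℝⁿ` with its Euclidean structure and Lebesgue measure. -/
abbrev Rn (n : ℕ) : Type := EuclideanSpace ℝ (Fin n)

/-- The phase space `ℝ²ⁿ`, whose points are pairs `(x, y)` (position, velocity); its `volume` is the
product Lebesgue measure. -/
abbrev R2n (n : ℕ) : Type := Rn n × Rn n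

/-- The complex Hilbert space `L²(X)`. -/
abbrev L2 (X : Type) [MeasureSpace X] : Type := Lp ℂ 2 (volume : Measure X)

/-- The space `C₀^∞(X)` of smooth compactly supported complex-valued functions. -/
abbrev Cc (X : Type) [NormedAddCommGroup X] [NormedSpace ℝ X] : Type := 𝓓((⊤ : Opens X), ℂ)

/-- The `j`-th standard basis vector of `ℝⁿ`. -/
def e {n : ℕ} (j : Fin n) : Rn n := EuclideanSpace.single j 1

/-- The derivative `∂_v f` of `f` in the direction `v`. -/
def pd {X F : Type} [NormedAddCommGroup X] [NormedSpace ℝ X] [NormedAddCommGroup F]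
    [NormedSpace ℝ F] (v : X) (f : X → F) (x : X) : F := fderiv ℝ f x v

/-- `|∂ₓV(x)|²`. -/
def gradSq {n : ℕ} (V : Rn n → ℝ) (x : Rn n) : ℝ := ∑ j, (pd (e j) V x) ^ 2

/-- `ΔₓV(x)`. -/
def lap {n : ℕ} (V : Rn n → ℝ) (x : Rn n) : ℝ := ∑ j, pd (e j) (pd (e j) V) x

/-- The Fokker–Planck differential expression
`P u = y·∂ₓu - ∂ₓV(x)·∂_y u - Δ_y u + (|y|²/4 - n/2) u` at `p = (x, y)`. -/
def fokkerPlanckExpr {n : ℕ} (V : Rn n → ℝ) (u : R2n n → ℂ) (p : R2n n) : ℂ :=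
  (∑ j, ((p.2 j : ℝ) : ℂ) * pd (e j, 0) u p)
    - (∑ j, ((pd (e j) V p.1 : ℝ) : ℂ) * pd (0, e j) u p)
    - (∑ j, pd (0, e j) (pd (0, e j) u) p)
    + ((‖p.2‖ ^ 2 / 4 - (n : ℝ) / 2 : ℝ) : ℂ) * u p

/-- The differential expression of the Witten Laplacian on `0`-forms,
`-Δₓu + (|∂ₓV|²/4 - ΔₓV/2) u`. -/
def wittenExpr {n : ℕ} (V : Rn n → ℝ) (u : Rn n → ℂ) (x : Rn n) : ℂ :=
  -(∑ j, pd (e j) (pd (e j) u) x) + ((gradSq V x / 4 - lap V x / 2 : ℝ) : ℂ) * u x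

section basics

variable {X : Type} [NormedAddCommGroup X] [NormedSpace ℝ X]

theorem pd_contDiff {F : Type} [NormedAddCommGroup F] [NormedSpace ℝ F] {f : X → F} {m k : ℕ∞ω}
    (hf : ContDiff ℝ k f) (hmk : m + 1 ≤ k) (v : X) : ContDiff ℝ m (pd v f) :=
  (hf.fderiv_right hmk).clm_apply contDiff_const

theorem pd_hasCompactSupport {f : X → ℂ} (hf : HasCompactSupport f) (v : X) :
    HasCompactSupport (pd v f) := hf.fderiv_apply ℝ v

theorem pd_add {f g : X → ℂ} (hf : Differentiable ℝ f) (hg : Differentiable ℝ g) (v : X) :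
    pd v (f + g) = pd v f + pd v g := by
  funext x
  simp [pd, fderiv_add (hf x) (hg x)]

theorem pd_smul {f : X → ℂ} (hf : Differentiable ℝ f) (c : ℂ) (v : X) :
    pd v (c • f) = c • pd v f := by
  funext x
  simp [pd, fderiv_const_smul (hf x) c]

theorem pd_smooth {f : X → ℂ} (hf : ContDiff ℝ ∞ f) (v : X) : ContDiff ℝ ∞ (pd v f) :=
  pd_contDiff hf (by simp) v

theorem Cc.smooth (u : Cc X) : ContDiff ℝ ∞ u := u.contDiff

end basics

/-- A linear operator from `C₀^∞(X)` to the continuous compactly supported functions on `X`, given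
by an expression `D` on functions. -/
structure IsTestOperator {X : Type} [NormedAddCommGroup X] [NormedSpace ℝ X]
    (D : (X → ℂ) → X → ℂ) : Prop where
  map_add : ∀ u v : Cc X, D (⇑u + ⇑v) = D u + D v
  map_smul : ∀ (c : ℂ) (u : Cc X), D (c • ⇑u) = c • D u
  continuous : ∀ u : Cc X, Continuous (D u)
  hasCompactSupport : ∀ u : Cc X, HasCompactSupport (D u)

theorem isTestOperator_id {X : Type} [NormedAddCommGroup X] [NormedSpace ℝ X] : IsTestOperator (X := X) (fun u => u) where
  map_add _ _ := rfl
  map_smul _ _ := rfl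
  continuous u := u.continuous
  hasCompactSupport u := u.hasCompactSupport

section operators

variable {X : Type} [NormedAddCommGroup X] [NormedSpace ℝ X] [MeasureSpace X] [BorelSpace X]
  [IsFiniteMeasureOnCompacts (volume : Measure X)]

theorem IsTestOperator.memLp {D : (X → ℂ) → X → ℂ} (hD : IsTestOperator D) (u : Cc X) :
    MemLp (D u) 2 (volume : Measure X) :=
  (hD.continuous u).memLp_of_hasCompactSupport (hD.hasCompactSupport u)

/-- The linear map `C₀^∞(X) → L²(X)`, `u ↦ [D u]`. -/
def IsTestOperator.toL2 {D : (X → ℂ) → X → ℂ} (hD : IsTestOperator D) : Cc X →ₗ[ℂ] L2 X where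
  toFun u := (hD.memLp u).toLp (D u)
  map_add' u v := by
    rw [← MemLp.toLp_add]
    exact MemLp.toLp_congr _ _ (by rw [← hD.map_add]; rfl)
  map_smul' c u := by
    rw [RingHom.id_apply, ← MemLp.toLp_const_smul]
    exact MemLp.toLp_congr _ _ (by rw [← hD.map_smul]; rfl)

/-- The embedding `C₀^∞(X) → L²(X)`. -/
def embed (X : Type) [NormedAddCommGroup X] [NormedSpace ℝ X] [MeasureSpace X] [BorelSpace X]
    [IsFiniteMeasureOnCompacts (volume : Measure X)] :
    Cc X →ₗ[ℂ] L2 X :=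
  (isTestOperator_id (X := X)).toL2

theorem embed_injective [(volume : Measure X).IsOpenPosMeasure] :
    Function.Injective (embed X) := by
  intro u v h
  have h' : (u : X → ℂ) =ᵐ[volume] v := (MemLp.toLp_eq_toLp_iff
    (isTestOperator_id.memLp u) (isTestOperator_id.memLp v)).1 h
  exact DFunLike.coe_injective (u.continuous.ae_eq_iff_eq volume v.continuous |>.1 h')

/-- The unbounded operator on `L²(X)` with domain `C₀^∞(X)` given by `u ↦ D u`. -/
def minimalOperator [(volume : Measure X).IsOpenPosMeasure] {D : (X → ℂ) → X → ℂ}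
    (hD : IsTestOperator D) : L2 X →ₗ.[ℂ] L2 X where
  domain := LinearMap.range (embed X)
  toFun := hD.toL2 ∘ₗ (LinearEquiv.ofInjective (embed X) embed_injective).symm.toLinearMap

theorem minimalOperator_apply [(volume : Measure X).IsOpenPosMeasure] {D : (X → ℂ) → X → ℂ}
    (hD : IsTestOperator D) (u : Cc X) :
    minimalOperator hD ⟨embed X u, LinearMap.mem_range_self _ u⟩ = hD.toL2 u := by
  change hD.toL2 ((LinearEquiv.ofInjective (embed X) embed_injective).symm _) = _
  congr 1
  exact (LinearEquiv.symm_apply_eq _).2 rfl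

end operators

theorem isTestOperator_fokkerPlanckExpr {n : ℕ} {V : Rn n → ℝ} (hV : ContDiff ℝ 2 V) :
    IsTestOperator (fokkerPlanckExpr V) where
  map_add u v := by
    have du := u.smooth.differentiable (by simp)
    have dv := v.smooth.differentiable (by simp)
    have du' := fun w => (pd_smooth u.smooth w).differentiable (by simp)
    have dv' := fun w => (pd_smooth v.smooth w).differentiable (by simp)
    funext p
    simp only [fokkerPlanckExpr, pd_add du dv, pd_add (du' _) (dv' _), Pi.add_apply, mul_add,
      Finset.sum_add_distrib]
    ring
  map_smul c u := by
    have du := u.smooth.differentiable (by simp)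
    have du' := fun w => (pd_smooth u.smooth w).differentiable (by simp)
    funext p
    simp only [fokkerPlanckExpr, pd_smul du, pd_smul (du' _), Pi.smul_apply, smul_eq_mul,
      mul_left_comm _ c, ← Finset.mul_sum]
    ring
  continuous u := by
    have h1 := fun w => (pd_smooth u.smooth w).continuous
    have h2 := fun w => (pd_smooth (pd_smooth u.smooth w) w).continuous
    have h3 := fun w => (pd_contDiff (m := 1) hV (by norm_num) w).continuous
    have h4 := u.continuous
    unfold fokkerPlanckExpr
    fun_prop
  hasCompactSupport u := by
    have h0 := u.hasCompactSupport
    refine HasCompactSupport.intro (K := tsupport u) h0 fun p hp => ?_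
    have k0 : (u : R2n n → ℂ) p = 0 := image_eq_zero_of_notMem_tsupport hp
    have k1 : ∀ w (f : R2n n → ℂ), p ∉ tsupport f → pd w f p = 0 := fun w f hf => by
      have : fderiv ℝ f p = 0 :=
        image_eq_zero_of_notMem_tsupport fun h => hf (tsupport_fderiv_subset ℝ h)
      simp [pd, this]
    have k2 : ∀ w, p ∉ tsupport (pd w u) := fun w h =>
      hp (tsupport_fderiv_apply_subset ℝ w h)
    simp [fokkerPlanckExpr, k0, k1 _ _ hp, k1 _ _ (k2 _)]

theorem isTestOperator_wittenExpr {n : ℕ} {V : Rn n → ℝ} (hV : ContDiff ℝ 2 V) :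
    IsTestOperator (wittenExpr V) where
  map_add u v := by
    have du := u.smooth.differentiable (by simp)
    have dv := v.smooth.differentiable (by simp)
    have du' := fun w => (pd_smooth u.smooth w).differentiable (by simp)
    have dv' := fun w => (pd_smooth v.smooth w).differentiable (by simp)
    funext p
    simp only [wittenExpr, pd_add du dv, pd_add (du' _) (dv' _), Pi.add_apply, mul_add,
      Finset.sum_add_distrib]
    ring
  map_smul c u := by
    have du := u.smooth.differentiable (by simp)
    have du' := fun w => (pd_smooth u.smooth w).differentiable (by simp)
    funext p
    simp only [wittenExpr, pd_smul du, pd_smul (du' _), Pi.smul_apply, smul_eq_mul,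
      mul_left_comm _ c, ← Finset.mul_sum]
    ring
  continuous u := by
    have h2 := fun w => (pd_smooth (pd_smooth u.smooth w) w).continuous
    have h3 := fun w => (pd_contDiff (m := 1) hV (by norm_num) w).continuous
    have h4 := fun w => (pd_contDiff (m := 0) (pd_contDiff (m := 1) hV (by norm_num) w)
      (by norm_num) w).continuous
    have h5 := u.continuous
    unfold wittenExpr gradSq lap
    fun_prop
  hasCompactSupport u := by
    have h0 := u.hasCompactSupport
    refine HasCompactSupport.intro (K := tsupport u) h0 fun p hp => ?_
    have k0 : (u : Rn n → ℂ) p = 0 := image_eq_zero_of_notMem_tsupport hp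
    have k1 : ∀ w (f : Rn n → ℂ), p ∉ tsupport f → pd w f p = 0 := fun w f hf => by
      have : fderiv ℝ f p = 0 :=
        image_eq_zero_of_notMem_tsupport fun h => hf (tsupport_fderiv_subset ℝ h)
      simp [pd, this]
    have k2 : ∀ w, p ∉ tsupport (pd w u) := fun w h =>
      hp (tsupport_fderiv_apply_subset ℝ w h)
    simp [wittenExpr, k0, k1 _ _ (k2 _)]

/-- The Fokker–Planck operator `P` on `L²(ℝ²ⁿ)`: the closure of the differential operator with
domain `C₀^∞(ℝ²ⁿ)`. -/
def fokkerPlanckOperator {n : ℕ} {V : Rn n → ℝ} (hV : ContDiff ℝ 2 V) :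
    L2 (R2n n) →ₗ.[ℂ] L2 (R2n n) :=
  (minimalOperator (isTestOperator_fokkerPlanckExpr hV)).closure

/-- The Witten Laplacian on `0`-forms on `L²(ℝⁿ)`: the closure of the differential operator with
domain `C₀^∞(ℝⁿ)`. -/
def wittenLaplacian {n : ℕ} {V : Rn n → ℝ} (hV : ContDiff ℝ 2 V) :
    L2 (Rn n) →ₗ.[ℂ] L2 (Rn n) :=
  (minimalOperator (isTestOperator_wittenExpr hV)).closure

section resolvent

variable {H : Type} [NormedAddCommGroup H] [NormedSpace ℂ H]

/-- The bounded operator `R` is the resolvent `(T - z)⁻¹`. -/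
def IsResolventAt (T : H →ₗ.[ℂ] H) (z : ℂ) (R : H →L[ℂ] H) : Prop :=
  (∀ u : T.domain, R (T u - z • (u : H)) = u) ∧
    ∀ f : H, ∃ h : R f ∈ T.domain, T ⟨R f, h⟩ - z • R f = f

/-- `T` is a closed operator with non-empty resolvent set and compact resolvent. By the resolvent
identity, compactness at one point of the resolvent set is the same as compactness at every one. -/
def HasCompactResolvent (T : H →ₗ.[ℂ] H) : Prop :=
  T.IsClosed ∧ ∃ (z : ℂ) (R : H →L[ℂ] H), IsResolventAt T z R ∧ IsCompactOperator R

end resolvent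

end FokkerPlanck

end

noncomputable section

namespace FokkerPlanck

section

section abstract_operators

open scoped InnerProductSpace

variable {H : Type} [NormedAddCommGroup H] [InnerProductSpace ℂ H]

/-- A densely defined operator whose numerical range lies in a right half-plane is closable. -/
theorem isClosable_of_re_inner_ge (A : H →ₗ.[ℂ] H) (hd : Dense (A.domain : Set H)) (b : ℝ)
    (hA : ∀ u : A.domain, -b * ‖(u : H)‖ ^ 2 ≤ (⟪(u : H), A u⟫_ℂ).re) : A.IsClosable := by
  refine ⟨A.graph.topologicalClosure.toLinearPMap,
    (Submodule.toLinearPMap_graph_eq _ ?_).symm⟩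
  rintro ⟨x, g⟩ hx hx0
  simp only at hx0
  subst hx0
  have key : ∀ φ : A.domain, 0 ≤ (⟪(φ : H), g⟫_ℂ).re := by
    intro φ
    have h1 : ∀ t : ℝ, 0 ≤ (⟪(t : ℂ) • (φ : H), g + (t : ℂ) • A φ⟫_ℂ).re
        + b * ‖(t : ℂ) • (φ : H)‖ ^ 2 := by
      intro t
      have hcl : IsClosed {p : H × H | 0 ≤ (⟪p.1 + (t : ℂ) • (φ : H), p.2 + (t : ℂ) • A φ⟫_ℂ).re
          + b * ‖p.1 + (t : ℂ) • (φ : H)‖ ^ 2} := by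
        refine isClosed_le continuous_const ?_
        refine Continuous.add (Complex.continuous_re.comp ?_) (by fun_prop)
        exact Continuous.inner (by fun_prop) (by fun_prop)
      have hsub : (A.graph : Set (H × H)) ⊆ {p : H × H | 0 ≤
          (⟪p.1 + (t : ℂ) • (φ : H), p.2 + (t : ℂ) • A φ⟫_ℂ).re
          + b * ‖p.1 + (t : ℂ) • (φ : H)‖ ^ 2} := by
        rintro ⟨a, b⟩ hab
        obtain ⟨u, hu1, hu2⟩ := (LinearPMap.mem_graph_iff A).1 hab
        simp only at hu1 hu2
        subst hu1 hu2
        have := hA (u + (t : ℂ) • φ)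
        rw [LinearPMap.map_add, LinearPMap.map_smul] at this
        simp only [Submodule.coe_add, Submodule.coe_smul] at this
        simp only [Set.mem_ofPred_eq]
        linarith
      have := closure_minimal hsub hcl hx
      simpa using this
    have h2 : ∀ t : ℝ, 0 < t →
        0 ≤ (⟪(φ : H), g⟫_ℂ).re + t * ((⟪(φ : H), A φ⟫_ℂ).re + b * ‖(φ : H)‖ ^ 2) := by
      intro t ht
      have := h1 t
      rw [inner_smul_left, inner_add_right, inner_smul_right, norm_smul] at this
      simp only [Complex.conj_ofReal, Complex.re_ofReal_mul, Complex.add_re, Complex.norm_real,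
        mul_pow, Real.norm_eq_abs, sq_abs] at this
      have h3 : 0 ≤ t * ((⟪(φ : H), g⟫_ℂ).re
          + t * ((⟪(φ : H), A φ⟫_ℂ).re + b * ‖(φ : H)‖ ^ 2)) := by linarith
      exact nonneg_of_mul_nonneg_right h3 ht
    have hlim : Filter.Tendsto (fun t : ℝ => (⟪(φ : H), g⟫_ℂ).re
        + t * ((⟪(φ : H), A φ⟫_ℂ).re + b * ‖(φ : H)‖ ^ 2)) (nhdsWithin 0 (Set.Ioi 0))
        (nhds ((⟪(φ : H), g⟫_ℂ).re)) := by
      have : Continuous (fun t : ℝ => (⟪(φ : H), g⟫_ℂ).re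
        + t * ((⟪(φ : H), A φ⟫_ℂ).re + b * ‖(φ : H)‖ ^ 2)) := by fun_prop
      simpa using (this.tendsto 0).mono_left nhdsWithin_le_nhds
    exact ge_of_tendsto hlim (by filter_upwards [self_mem_nhdsWithin] with t ht using h2 t ht)
  have hall : ∀ φ : H, 0 ≤ (⟪φ, g⟫_ℂ).re := by
    intro φ
    have hcl : IsClosed {φ : H | 0 ≤ (⟪φ, g⟫_ℂ).re} :=
      isClosed_le continuous_const
        (Complex.continuous_re.comp (Continuous.inner continuous_id continuous_const))
    have : closure (A.domain : Set H) ⊆ {φ : H | 0 ≤ (⟪φ, g⟫_ℂ).re} :=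
      closure_minimal (fun φ hφ => key ⟨φ, hφ⟩) hcl
    exact this (hd φ)
  have h := hall (-g)
  rw [inner_neg_left, Complex.neg_re] at h
  have h' : (⟪g, g⟫_ℂ).re = ‖g‖ ^ 2 := by
    rw [inner_self_eq_norm_sq_to_K]; norm_cast
  rw [h'] at h
  have : ‖g‖ = 0 := by nlinarith [norm_nonneg g]
  simpa using this

/-- An operator that is bounded by small multiples of the norm up to finitely many functionals is
compact. -/
theorem isCompactOperator_of_le_finite_sum [CompleteSpace H] (R : H →L[ℂ] H)
    (hR : ∀ ε : ℝ, 0 < ε → ∃ (N : ℕ) (ℓ : Fin N → H →L[ℂ] ℂ), ∀ f : H,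
      ‖R f‖ ^ 2 ≤ ε * ‖f‖ ^ 2 + ∑ i, ‖ℓ i f‖ ^ 2) : IsCompactOperator R := by
  have htb : TotallyBounded (R '' Metric.closedBall 0 1) := by
    rw [Metric.totallyBounded_iff]
    intro ε hε
    obtain ⟨N, ℓ, hℓ⟩ := hR (ε ^ 2 / 8) (by positivity)
    let K : H →L[ℂ] (Fin N → ℂ) := ContinuousLinearMap.pi ℓ
    have hb : Bornology.IsBounded (K '' Metric.closedBall 0 1) := by
      rw [isBounded_iff_forall_norm_le]
      refine ⟨‖K‖, ?_⟩
      rintro _ ⟨f, hf, rfl⟩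
      have hf' : ‖f‖ ≤ 1 := by simpa using hf
      exact (K.le_opNorm f).trans (by nlinarith [norm_nonneg K])
    have htb : TotallyBounded (K '' Metric.closedBall 0 1) :=
      hb.isCompact_closure.totallyBounded.subset subset_closure
    obtain ⟨δ, hδ, hδ'⟩ : ∃ δ : ℝ, 0 < δ ∧ N * δ ^ 2 ≤ ε ^ 2 / 4 := by
      refine ⟨ε / (2 * (N + 1)), by positivity, ?_⟩
      rw [div_pow, mul_pow, ← mul_div_assoc, div_le_div_iff₀ (by positivity) (by positivity)]
      have : (0 : ℝ) ≤ N := N.cast_nonneg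
      nlinarith [sq_nonneg ε, mul_nonneg this (sq_nonneg ε),
        mul_nonneg (mul_nonneg this this) (sq_nonneg ε)]
    obtain ⟨t, htsub, htfin, ht⟩ := totallyBounded_iff_subset.1 htb _
      (Metric.dist_mem_uniformity hδ)
    choose! c hc using fun y (hy : y ∈ t) => htsub hy
    refine ⟨(fun y => R (c y)) '' t, htfin.image _, ?_⟩
    rintro _ ⟨f, hf, rfl⟩
    obtain ⟨y, hy, hfy⟩ := Set.mem_iUnion₂.1 (ht ⟨f, hf, rfl⟩)
    simp only [Set.mem_ofPred_eq] at hfy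
    refine Set.mem_iUnion₂.2 ⟨_, ⟨y, hy, rfl⟩, ?_⟩
    obtain ⟨hcb, hcy⟩ := hc y hy
    rw [← hcy, dist_eq_norm, ← map_sub] at hfy
    rw [Metric.mem_ball, dist_eq_norm, ← map_sub]
    have h1 : ‖f - c y‖ ≤ 2 := by
      have a1 : ‖f‖ ≤ 1 := by simpa using hf
      have a2 : ‖c y‖ ≤ 1 := by simpa using hcb
      linarith [norm_sub_le f (c y)]
    have h2 : ∑ i, ‖ℓ i (f - c y)‖ ^ 2 ≤ N * δ ^ 2 := by
      calc ∑ i, ‖ℓ i (f - c y)‖ ^ 2 ≤ ∑ _i : Fin N, δ ^ 2 := by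
            refine Finset.sum_le_sum fun i _ => ?_
            have : ‖ℓ i (f - c y)‖ ≤ ‖K (f - c y)‖ := norm_le_pi_norm (K (f - c y)) i
            gcongr
            linarith
        _ = N * δ ^ 2 := by simp
    have h3 := hℓ (f - c y)
    have h4 : ‖R (f - c y)‖ ^ 2 < ε ^ 2 := by
      have : ‖f - c y‖ ^ 2 ≤ 4 := by nlinarith [norm_nonneg (f - c y)]
      nlinarith [sq_nonneg ε, mul_le_mul_of_nonneg_left this (sq_nonneg ε), sq_pos_of_pos hε]
    exact lt_of_pow_lt_pow_left₀ 2 hε.le h4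
  refine (isCompactOperator_iff_isCompact_closure_image_closedBall (R : H →ₗ[ℂ] H) one_pos).2 ?_
  exact htb.closure.isCompact_of_isClosed isClosed_closure

/-- Let `A` be a densely defined operator with numerical range in a half-plane. If `A + λ` has dense
range for a `λ` beyond the half-plane, and the graph norm controls the norm compactly, then the
closure of `A` has compact resolvent. -/
theorem hasCompactResolvent_closure [CompleteSpace H] (A : H →ₗ.[ℂ] H)
    (hd : Dense (A.domain : Set H)) (b : ℝ) (hb0 : 0 ≤ b)
    (hA : ∀ u : A.domain, -b * ‖(u : H)‖ ^ 2 ≤ (⟪(u : H), A u⟫_ℂ).re)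
    (hrange : ∀ f : H, (∀ u : A.domain, ⟪f, A u + ((b + 1 : ℝ) : ℂ) • (u : H)⟫_ℂ = 0) → f = 0)
    (hcomp : ∀ ε : ℝ, 0 < ε → ∃ (N : ℕ) (ℓ : Fin N → H →L[ℂ] ℂ), ∀ u : A.domain,
      ‖(u : H)‖ ^ 2 ≤ ε * (‖A u‖ ^ 2 + ‖(u : H)‖ ^ 2) + ∑ i, ‖ℓ i u‖ ^ 2) :
    HasCompactResolvent A.closure := by
  have hcl := isClosable_of_re_inner_ge A hd b hA
  refine ⟨hcl.closure_isClosed, ?_⟩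
  have hG := hcl.graph_closure_eq_closure_graph
  set G : Submodule ℂ (H × H) := A.graph.topologicalClosure with hGdef
  have hGcl : IsClosed (G : Set (H × H)) := Submodule.isClosed_topologicalClosure _
  have hext : ∀ {s : Set (H × H)}, IsClosed s → (∀ u : A.domain, ((u : H), A u) ∈ s) →
      ∀ p ∈ G, p ∈ s := by
    intro s hs h p hp
    refine closure_minimal ?_ hs hp
    rintro ⟨a, b⟩ hab
    obtain ⟨u, hu1, hu2⟩ := (LinearPMap.mem_graph_iff A).1 hab
    simp only at hu1 hu2
    rw [← hu1, ← hu2]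
    exact h u
  have hcoer : ∀ p ∈ G, ‖p.1‖ ≤ ‖p.2 + ((b + 1 : ℝ) : ℂ) • p.1‖ := by
    refine hext (s := {p : H × H | ‖p.1‖ ≤ ‖p.2 + ((b + 1 : ℝ) : ℂ) • p.1‖})
      (isClosed_le (by fun_prop) (by fun_prop)) fun u => ?_
    simp only [Set.mem_ofPred_eq]
    have h1 := hA u
    have h2 : (⟪(u : H), A u + ((b + 1 : ℝ) : ℂ) • (u : H)⟫_ℂ).re
        = (⟪(u : H), A u⟫_ℂ).re + (b + 1) * ‖(u : H)‖ ^ 2 := by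
      rw [inner_add_right, inner_smul_right, inner_self_eq_norm_sq_to_K, Complex.add_re,
        Complex.re_ofReal_mul]
      norm_cast
    have h3 : (⟪(u : H), A u + ((b + 1 : ℝ) : ℂ) • (u : H)⟫_ℂ).re
        ≤ ‖(u : H)‖ * ‖A u + ((b + 1 : ℝ) : ℂ) • (u : H)‖ :=
      (Complex.re_le_norm _).trans (norm_inner_le_norm _ _)
    rcases eq_or_lt_of_le (norm_nonneg (u : H)) with h0 | h0
    · rw [← h0]; positivity
    · refine le_of_mul_le_mul_left ?_ h0
      nlinarith
  let S : G →L[ℂ] H := (ContinuousLinearMap.snd ℂ H H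
    + ((b + 1 : ℝ) : ℂ) • ContinuousLinearMap.fst ℂ H H).comp G.subtypeL
  have hS : ∀ p : G, S p = (p : H × H).2 + ((b + 1 : ℝ) : ℂ) • (p : H × H).1 := fun p => rfl
  have hSb : ∀ p : G, ‖p‖ ≤ (b + 2) * ‖S p‖ := by
    intro p
    have h1 := hcoer p p.2
    rw [← hS] at h1
    have h2 : ‖(p : H × H).2‖ ≤ ‖S p‖ + (b + 1) * ‖(p : H × H).1‖ := by
      have : (p : H × H).2 = S p - ((b + 1 : ℝ) : ℂ) • (p : H × H).1 := by rw [hS]; abel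
      rw [this]
      refine (norm_sub_le _ _).trans ?_
      rw [norm_smul, Complex.norm_real, Real.norm_of_nonneg (by linarith)]
    have h3 := norm_nonneg (S p)
    change ‖(p : H × H)‖ ≤ _
    rw [Prod.norm_def]
    refine max_le (by nlinarith) (by nlinarith)
  have hGc : CompleteSpace G := hGcl.completeSpace_coe
  have hanti : AntilipschitzWith (⟨b + 2, by linarith⟩ : NNReal) S :=
    S.antilipschitz_of_bound hSb
  have hker : LinearMap.ker S.toLinearMap = ⊥ := LinearMap.ker_eq_bot.2 hanti.injective
  have hran : LinearMap.range S.toLinearMap = ⊤ := by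
    have hc : IsClosed (Set.range S) := hanti.isClosed_range S.uniformContinuous
    have hK : IsClosed ((LinearMap.range S.toLinearMap : Submodule ℂ H) : Set H) := by
      rwa [LinearMap.coe_range]
    have hbot : (LinearMap.range S.toLinearMap)ᗮ = ⊥ := by
      rw [Submodule.eq_bot_iff]
      intro f hf
      apply hrange
      intro u
      rw [Submodule.mem_orthogonal'] at hf
      refine hf _ ⟨⟨((u : H), A u), ?_⟩, rfl⟩
      exact A.graph.le_topologicalClosure (A.mem_graph u)
    have : CompleteSpace (LinearMap.range S.toLinearMap) := hK.completeSpace_coe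
    exact (Submodule.orthogonal_eq_bot_iff).1 hbot
  let Se : G ≃L[ℂ] H := ContinuousLinearEquiv.ofBijective S hker hran
  have hSe : ∀ p, Se p = S p := fun p => rfl
  let R : H →L[ℂ] H := (ContinuousLinearMap.fst ℂ H H).comp
    (G.subtypeL.comp (Se.symm : H →L[ℂ] G))
  have hR : ∀ f, R f = (Se.symm f : H × H).1 := fun f => rfl
  refine ⟨-((b + 1 : ℝ) : ℂ), R, ⟨?_, ?_⟩, ?_⟩
  · intro u
    have hu : ((u : H), A.closure u) ∈ G := by rw [hG]; exact LinearPMap.mem_graph _ u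
    have : A.closure u - -((b + 1 : ℝ) : ℂ) • (u : H) = Se ⟨_, hu⟩ := by
      rw [hSe, hS, neg_smul, sub_neg_eq_add]
    rw [this, hR, Se.symm_apply_apply]
  · intro f
    have hp := (Se.symm f).2
    have hp' : ((Se.symm f : H × H).1, (Se.symm f : H × H).2) ∈ A.closure.graph := by
      rw [← hG]; exact hp
    obtain ⟨v, hv1, hv2⟩ := (LinearPMap.mem_graph_iff _).1 hp'
    simp only at hv1 hv2
    have hmem : R f ∈ A.closure.domain := by rw [hR, ← hv1]; exact v.2
    refine ⟨hmem, ?_⟩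
    have : (⟨R f, hmem⟩ : A.closure.domain) = v := Subtype.ext hv1.symm
    rw [this, hv2, hR, neg_smul, sub_neg_eq_add, ← hS, ← hSe, Se.apply_symm_apply]
  · apply isCompactOperator_of_le_finite_sum
    intro ε hε
    have hC : 0 < (b + 2) ^ 2 * 2 := by positivity
    obtain ⟨N, ℓ, hℓ⟩ := hcomp (ε / ((b + 2) ^ 2 * 2)) (by positivity)
    refine ⟨N, fun i => (ℓ i).comp R, fun f => ?_⟩
    have h1 : ∀ p ∈ G, ‖p.1‖ ^ 2 ≤ (ε / ((b + 2) ^ 2 * 2)) * (‖p.2‖ ^ 2 + ‖p.1‖ ^ 2)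
        + ∑ i, ‖ℓ i p.1‖ ^ 2 := by
      exact hext (s := {p : H × H | ‖p.1‖ ^ 2 ≤ (ε / ((b + 2) ^ 2 * 2))
        * (‖p.2‖ ^ 2 + ‖p.1‖ ^ 2) + ∑ i, ‖ℓ i p.1‖ ^ 2})
        (isClosed_le (by fun_prop) (by fun_prop)) fun u => by
          simpa only [Set.mem_ofPred_eq] using hℓ u
    have h2 := h1 _ (Se.symm f).2
    have h3 := hSb (Se.symm f)
    rw [← hSe, Se.apply_symm_apply] at h3
    have h4 : ‖(Se.symm f : H × H).1‖ ≤ (b + 2) * ‖f‖ :=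
      (norm_fst_le (Se.symm f : H × H)).trans h3
    have h5 : ‖(Se.symm f : H × H).2‖ ≤ (b + 2) * ‖f‖ :=
      (norm_snd_le (Se.symm f : H × H)).trans h3
    have h6 : ‖(Se.symm f : H × H).2‖ ^ 2 + ‖(Se.symm f : H × H).1‖ ^ 2
        ≤ (b + 2) ^ 2 * 2 * ‖f‖ ^ 2 := by
      have := pow_le_pow_left₀ (norm_nonneg _) h4 2
      have := pow_le_pow_left₀ (norm_nonneg _) h5 2
      nlinarith
    rw [hR]
    refine h2.trans ?_
    simp only [ContinuousLinearMap.comp_apply]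
    refine add_le_add ?_ le_rfl
    calc ε / ((b + 2) ^ 2 * 2) * (‖(Se.symm f : H × H).2‖ ^ 2 + ‖(Se.symm f : H × H).1‖ ^ 2)
        ≤ ε / ((b + 2) ^ 2 * 2) * ((b + 2) ^ 2 * 2 * ‖f‖ ^ 2) := by gcongr
      _ = ε * ‖f‖ ^ 2 := by field_simp

end abstract_operators

end

section

section potential

variable {n : ℕ} {V : Rn n → ℝ}

/-- `1 + |∂ₓV(x)|²`. -/
def Phi (V : Rn n → ℝ) (x : Rn n) : ℝ := 1 + gradSq V x

theorem gradSq_nonneg (V : Rn n → ℝ) (x : Rn n) : 0 ≤ gradSq V x :=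
  Finset.sum_nonneg fun _ _ => sq_nonneg _

theorem one_le_Phi (V : Rn n → ℝ) (x : Rn n) : 1 ≤ Phi V x := by
  have := gradSq_nonneg V x
  unfold Phi; linarith

theorem Phi_pos (V : Rn n → ℝ) (x : Rn n) : 0 < Phi V x := one_pos.trans_le (one_le_Phi V x)

theorem contDiff_pd_potential (hV : ContDiff ℝ 2 V) (v : Rn n) : ContDiff ℝ 1 (pd v V) :=
  pd_contDiff hV (by norm_num) v

theorem contDiff_Phi (hV : ContDiff ℝ 2 V) : ContDiff ℝ 1 (Phi V) := by
  unfold Phi gradSq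
  exact contDiff_const.add (ContDiff.sum fun j _ => (contDiff_pd_potential hV (e j)).pow 2)

theorem abs_pd_le_sqrt_Phi (V : Rn n → ℝ) (x : Rn n) (j : Fin n) :
    |pd (e j) V x| ≤ Phi V x ^ (1 / 2 : ℝ) := by
  rw [← Real.sqrt_eq_rpow, ← Real.sqrt_sq_eq_abs]
  apply Real.sqrt_le_sqrt
  have : (pd (e j) V x) ^ 2 ≤ gradSq V x :=
    Finset.single_le_sum (f := fun j => (pd (e j) V x) ^ 2) (fun _ _ => sq_nonneg _)
      (Finset.mem_univ j)
  unfold Phi; linarith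

theorem sum_smul_e (v : Rn n) : v = ∑ i, v i • e i := by
  ext k
  simp [e, Finset.sum_apply, Pi.single_apply]

theorem fderiv_apply_eq_sum {F : Type} [NormedAddCommGroup F] [NormedSpace ℝ F]
    (f : Rn n → F) (x v : Rn n) : fderiv ℝ f x v = ∑ i, v i • pd (e i) f x := by
  conv_lhs => rw [sum_smul_e v]
  simp [pd]

theorem abs_apply_le_norm (v : Rn n) (i : Fin n) : |v i| ≤ ‖v‖ := by
  simpa using PiLp.norm_apply_le v i

/-- The Hessian of `V` is bounded by a multiple of `(1 + |∂ₓV|²)^{2/3}`. -/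
def HessBound (V : Rn n → ℝ) (C : ℝ) : Prop :=
  0 < C ∧ ∀ (x : Rn n) (i j : Fin n), |pd (e i) (pd (e j) V) x| ≤ C * Phi V x ^ (2 / 3 : ℝ)

theorem exists_hessBound {s : ℝ} (hs : s < 4 / 3)
    (hVs : ∀ i j : Fin n, ∃ C : ℝ, 0 < C ∧
      ∀ x : Rn n, |pd (e i) (pd (e j) V) x| ≤ C * (1 + gradSq V x) ^ (s / 2)) :
    ∃ C, HessBound V C := by
  choose C hC hb using hVs
  refine ⟨1 + ∑ i, ∑ j, C i j, ?_, fun x i j => (hb i j x).trans ?_⟩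
  · have : 0 ≤ ∑ i, ∑ j, C i j :=
      Finset.sum_nonneg fun i _ => Finset.sum_nonneg fun j _ => (hC i j).le
    linarith
  · have h1 : C i j ≤ ∑ j, C i j :=
      Finset.single_le_sum (f := fun j => C i j) (fun j _ => (hC i j).le) (Finset.mem_univ j)
    have h2 : ∑ j, C i j ≤ ∑ i, ∑ j, C i j :=
      Finset.single_le_sum (f := fun i => ∑ j, C i j)
        (fun i _ => Finset.sum_nonneg fun j _ => (hC i j).le) (Finset.mem_univ i)
    have h3 : (1 + gradSq V x) ^ (s / 2) ≤ Phi V x ^ (2 / 3 : ℝ) :=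
      Real.rpow_le_rpow_of_exponent_le (one_le_Phi V x) (by linarith)
    exact mul_le_mul (by linarith) h3 (Real.rpow_nonneg (Phi_pos V x).le _)
      (by linarith [(hC i j).le])

theorem abs_fderiv_pd_le {C : ℝ} (hC : HessBound V C) (x v : Rn n) (j : Fin n) :
    |fderiv ℝ (pd (e j) V) x v| ≤ n * C * Phi V x ^ (2 / 3 : ℝ) * ‖v‖ := by
  rw [fderiv_apply_eq_sum]
  refine (Finset.abs_sum_le_sum_abs _ _).trans ?_
  calc ∑ i, |v i • pd (e i) (pd (e j) V) x|
      ≤ ∑ _i : Fin n, ‖v‖ * (C * Phi V x ^ (2 / 3 : ℝ)) := by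
        refine Finset.sum_le_sum fun i _ => ?_
        rw [smul_eq_mul, abs_mul]
        exact mul_le_mul (abs_apply_le_norm v i) (hC.2 x i j) (abs_nonneg _) (norm_nonneg _)
    _ = n * C * Phi V x ^ (2 / 3 : ℝ) * ‖v‖ := by
        rw [Finset.sum_const, Finset.card_univ, Fintype.card_fin, nsmul_eq_mul]; ring

theorem fderiv_Phi_apply (hV : ContDiff ℝ 2 V) (x v : Rn n) :
    fderiv ℝ (Phi V) x v = ∑ j, 2 * pd (e j) V x * fderiv ℝ (pd (e j) V) x v := by
  have h : ∀ j : Fin n, HasFDerivAt (fun x => (pd (e j) V x) ^ 2)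
      ((2 * pd (e j) V x) • fderiv ℝ (pd (e j) V) x) x := fun j => by
    simpa using ((contDiff_pd_potential hV (e j)).differentiable (by simp) x).hasFDerivAt.pow 2
  have h2 : HasFDerivAt (Phi V) (∑ j, (2 * pd (e j) V x) • fderiv ℝ (pd (e j) V) x) x := by
    unfold Phi gradSq
    exact (HasFDerivAt.fun_sum fun j _ => h j).const_add 1
  rw [h2.fderiv]
  simp

theorem abs_fderiv_Phi_le (hV : ContDiff ℝ 2 V) {C : ℝ} (hC : HessBound V C) (x v : Rn n) :
    |fderiv ℝ (Phi V) x v| ≤ 2 * n ^ 2 * C * Phi V x ^ (7 / 6 : ℝ) * ‖v‖ := by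
  rw [fderiv_Phi_apply hV]
  refine (Finset.abs_sum_le_sum_abs _ _).trans ?_
  have hp : Phi V x ^ (7 / 6 : ℝ) = Phi V x ^ (1 / 2 : ℝ) * Phi V x ^ (2 / 3 : ℝ) := by
    rw [← Real.rpow_add (Phi_pos V x)]; norm_num
  calc ∑ j, |2 * pd (e j) V x * fderiv ℝ (pd (e j) V) x v|
      ≤ ∑ _j : Fin n, 2 * Phi V x ^ (1 / 2 : ℝ) * (n * C * Phi V x ^ (2 / 3 : ℝ) * ‖v‖) := by
        refine Finset.sum_le_sum fun j _ => ?_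
        rw [abs_mul, abs_mul, abs_two]
        have := Real.rpow_nonneg (Phi_pos V x).le (1 / 2)
        exact mul_le_mul (by linarith [abs_pd_le_sqrt_Phi V x j]) (abs_fderiv_pd_le hC x v j)
          (abs_nonneg _) (by positivity)
    _ = _ := by
        rw [Finset.sum_const, Finset.card_univ, Fintype.card_fin, nsmul_eq_mul, hp]; ring

theorem hasFDerivAt_Phi_rpow (hV : ContDiff ℝ 2 V) (r : ℝ) (x : Rn n) :
    HasFDerivAt (fun x => Phi V x ^ r) ((r * Phi V x ^ (r - 1)) • fderiv ℝ (Phi V) x) x :=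
  ((contDiff_Phi hV).differentiable (by simp) x).hasFDerivAt.rpow_const
    (Or.inl (Phi_pos V x).ne')

/-- Where `Phi` is bounded, it is bounded on balls of a fixed radius. -/
theorem exists_radius_Phi_le (hV : ContDiff ℝ 2 V) {C : ℝ} (hC : HessBound V C) (M : ℝ) :
    ∃ r > 0, ∀ x x' : Rn n, Phi V x ≤ M → dist x' x ≤ r → Phi V x' ≤ 64 * M := by
  rcases lt_or_ge M 1 with hM | hM
  · exact ⟨1, one_pos, fun x _ hx => absurd (one_le_Phi V x) (by linarith)⟩
  have hM0 : 0 < M := by linarith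
  set D : ℝ := 2 * n ^ 2 * C with hD
  have hD0 : 0 ≤ D := by have := hC.1; positivity
  have hlip : ∀ x x' : Rn n, ‖Phi V x' ^ (-(1 / 6) : ℝ) - Phi V x ^ (-(1 / 6) : ℝ)‖
      ≤ D * ‖x' - x‖ := by
    intro x x'
    refine Convex.norm_image_sub_le_of_norm_hasFDerivWithin_le (s := Set.univ)
      (fun x _ => (hasFDerivAt_Phi_rpow hV (-(1 / 6)) x).hasFDerivWithinAt) (fun x _ => ?_)
      convex_univ (Set.mem_univ _) (Set.mem_univ _)
    refine ContinuousLinearMap.opNorm_le_bound _ hD0 fun v => ?_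
    rw [smul_apply, norm_smul, norm_mul, Real.norm_eq_abs, Real.norm_eq_abs,
      Real.norm_eq_abs, abs_of_nonneg (Real.rpow_nonneg (Phi_pos V x).le _)]
    have h1 := abs_fderiv_Phi_le hV hC x v
    have h2 : Phi V x ^ (-(1 / 6) - 1 : ℝ) * Phi V x ^ (7 / 6 : ℝ) = 1 := by
      rw [← Real.rpow_add (Phi_pos V x)]; norm_num
    have h3 := Real.rpow_nonneg (Phi_pos V x).le (-(1 / 6) - 1 : ℝ)
    have h4 : |(-(1 / 6) : ℝ)| ≤ 1 := by rw [abs_neg, abs_of_pos] <;> norm_num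
    calc |(-(1 / 6) : ℝ)| * Phi V x ^ (-(1 / 6) - 1 : ℝ) * |fderiv ℝ (Phi V) x v|
        ≤ 1 * Phi V x ^ (-(1 / 6) - 1 : ℝ) * (D * Phi V x ^ (7 / 6 : ℝ) * ‖v‖) := by gcongr
      _ = (Phi V x ^ (-(1 / 6) - 1 : ℝ) * Phi V x ^ (7 / 6 : ℝ)) * (D * ‖v‖) := by ring
      _ = D * ‖v‖ := by rw [h2, one_mul]
  have hMp : 0 < M ^ (-(1 / 6) : ℝ) := Real.rpow_pos_of_pos hM0 _
  refine ⟨M ^ (-(1 / 6) : ℝ) / (2 * (D + 1)), by positivity, fun x x' hx hxx => ?_⟩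
  have h1 := hlip x x'
  rw [← dist_eq_norm x' x] at h1
  have h2 : D * dist x' x ≤ M ^ (-(1 / 6) : ℝ) / 2 := by
    calc D * dist x' x ≤ (D + 1) * (M ^ (-(1 / 6) : ℝ) / (2 * (D + 1))) := by gcongr; linarith
      _ = M ^ (-(1 / 6) : ℝ) / 2 := by field_simp
  have h3 : M ^ (-(1 / 6) : ℝ) ≤ Phi V x ^ (-(1 / 6) : ℝ) :=
    Real.rpow_le_rpow_of_nonpos (Phi_pos V x) hx (by norm_num)
  have h4 : M ^ (-(1 / 6) : ℝ) / 2 ≤ Phi V x' ^ (-(1 / 6) : ℝ) := by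
    have := (abs_le.1 ((Real.norm_eq_abs _).symm.le.trans h1)).1
    linarith
  have h5 : (64 * M) ^ (-(1 / 6) : ℝ) = M ^ (-(1 / 6) : ℝ) / 2 := by
    rw [Real.mul_rpow (by norm_num) hM0.le]
    have : (64 : ℝ) ^ (-(1 / 6) : ℝ) = 1 / 2 := by
      rw [show (64 : ℝ) = 2 ^ (6 : ℝ) by norm_num, ← Real.rpow_mul (by norm_num)]
      norm_num
    rw [this]; ring
  rw [← h5] at h4
  by_contra hlt
  push Not at hlt
  have := Real.rpow_lt_rpow_of_neg (by positivity : 0 < 64 * M) hlt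
    (by norm_num : (-(1 / 6) : ℝ) < 0)
  linarith

end potential

section L2_norms

open scoped InnerProductSpace ComplexConjugate

variable {X : Type} [MeasureSpace X]

theorem L2_norm_sq (f : L2 X) : ‖f‖ ^ 2 = ∫ x, ‖f x‖ ^ 2 := by
  have h : ((‖f‖ ^ 2 : ℝ) : ℂ) = ((∫ x, ‖f x‖ ^ 2 : ℝ) : ℂ) := by
    rw [← integral_complex_ofReal]
    have := inner_self_eq_norm_sq_to_K (𝕜 := ℂ) f
    rw [L2.inner_def] at this
    push_cast
    rw [← Complex.coe_algebraMap] at *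
    refine this.symm.trans (integral_congr_ae (Filter.Eventually.of_forall fun x => ?_))
    simp
  exact_mod_cast h

theorem norm_toLp_sq {f : X → ℂ} (hf : MemLp f 2 (volume : Measure X)) :
    ‖hf.toLp f‖ ^ 2 = ∫ x, ‖f x‖ ^ 2 := by
  rw [L2_norm_sq]
  refine integral_congr_ae ?_
  filter_upwards [hf.coeFn_toLp] with x hx
  rw [hx]

theorem inner_toLp_right (f : L2 X) {g : X → ℂ} (hg : MemLp g 2 (volume : Measure X)) :
    ⟪f, hg.toLp g⟫_ℂ = ∫ x, conj (f x) * g x := by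
  rw [L2.inner_def]
  refine integral_congr_ae ?_
  filter_upwards [hg.coeFn_toLp] with x hx
  rw [hx, RCLike.inner_apply, mul_comm]

theorem inner_toLp_toLp {f g : X → ℂ} (hf : MemLp f 2 (volume : Measure X))
    (hg : MemLp g 2 (volume : Measure X)) :
    ⟪hf.toLp f, hg.toLp g⟫_ℂ = ∫ x, conj (f x) * g x := by
  rw [inner_toLp_right]
  refine integral_congr_ae ?_
  filter_upwards [hf.coeFn_toLp] with x hx
  rw [hx]

variable [NormedAddCommGroup X] [NormedSpace ℝ X] [BorelSpace X]
  [IsFiniteMeasureOnCompacts (volume : Measure X)]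

theorem norm_toL2_sq {D : (X → ℂ) → X → ℂ} (hD : IsTestOperator D) (u : Cc X) :
    ‖hD.toL2 u‖ ^ 2 = ∫ x, ‖D u x‖ ^ 2 := norm_toLp_sq (hD.memLp u)

theorem norm_embed_sq (u : Cc X) : ‖embed X u‖ ^ 2 = ∫ x, ‖u x‖ ^ 2 :=
  norm_toLp_sq (isTestOperator_id.memLp u)

end L2_norms

/-- A smooth compactly supported function as an element of `C₀^∞`. -/
def mkCc {X : Type} [NormedAddCommGroup X] [NormedSpace ℝ X] (f : X → ℂ) (hf : ContDiff ℝ ∞ f)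
    (hc : HasCompactSupport f) : Cc X :=
  ⟨f, hf, hc, by simp⟩

section witten

open scoped InnerProductSpace ComplexConjugate

variable {n : ℕ} {V : Rn n → ℝ}

/-- The translate `u(· - a)`. -/
def translate (a : Rn n) (u : Cc (Rn n)) : Cc (Rn n) :=
  mkCc (fun x => u (x - a)) (u.smooth.comp (contDiff_id.sub contDiff_const))
    (u.hasCompactSupport.comp_homeomorph (Homeomorph.subRight a))

theorem pd_comp_sub {F : Type} [NormedAddCommGroup F] [NormedSpace ℝ F] (v a : Rn n)
    (f : Rn n → F) : pd v (fun x => f (x - a)) = fun x => pd v f (x - a) := by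
  funext x
  simp [pd, fderiv_comp_sub]

theorem wittenExpr_translate (a : Rn n) (u : Cc (Rn n)) (x : Rn n) :
    wittenExpr V (translate a u) x = -(∑ j, pd (e j) (pd (e j) u) (x - a))
      + ((gradSq V x / 4 - lap V x / 2 : ℝ) : ℂ) * u (x - a) := by
  change wittenExpr V (fun x => u (x - a)) x = _
  simp only [wittenExpr, pd_comp_sub]

theorem norm_wittenExpr_translate_le {C M r : ℝ} (hC : HessBound V C)
    (hr : ∀ x x' : Rn n, Phi V x ≤ M → dist x' x ≤ r → Phi V x' ≤ 64 * M)
    {a : Rn n} (ha : Phi V a ≤ M) (u : Cc (Rn n)) (hu : ∀ x, r < ‖x‖ → u x = 0) (x : Rn n) :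
    ‖wittenExpr V (translate a u) x‖ ≤ ‖∑ j, pd (e j) (pd (e j) u) (x - a)‖
      + (64 * M + n * (C * (64 * M) ^ (2 / 3 : ℝ))) * ‖u (x - a)‖ := by
  rw [wittenExpr_translate]
  refine (norm_add_le _ _).trans ?_
  rw [norm_neg, norm_mul]
  gcongr ‖_‖ + ?_
  rcases lt_or_ge r ‖x - a‖ with h | h
  · simp [hu _ h]
  gcongr
  have hΦ := hr a x ha (by rwa [dist_eq_norm])
  have h0 := gradSq_nonneg V x
  have h1 : gradSq V x ≤ 64 * M := by unfold Phi at hΦ; linarith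
  have h2 : |lap V x| ≤ n * (C * (64 * M) ^ (2 / 3 : ℝ)) := by
    unfold lap
    refine (Finset.abs_sum_le_sum_abs _ _).trans ?_
    calc _ ≤ ∑ _j : Fin n, C * (64 * M) ^ (2 / 3 : ℝ) := by
          refine Finset.sum_le_sum fun j _ => (hC.2 x j j).trans ?_
          have := hC.1
          have := (Phi_pos V x).le
          gcongr
      _ = _ := by simp
  rw [Complex.norm_real, Real.norm_eq_abs, abs_le]
  have := abs_le.1 h2
  constructor <;> linarith

theorem exists_bump {r : ℝ} (hr : 0 < r) :
    ∃ φ : Cc (Rn n), embed (Rn n) φ ≠ 0 ∧ ∀ x, r ≤ ‖x‖ → φ x = 0 := by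
  let b : ContDiffBump (0 : Rn n) := ⟨r / 2, r, by positivity, by linarith⟩
  have hs : ContDiff ℝ ∞ (fun x => ((b x : ℝ) : ℂ)) := Complex.ofRealCLM.contDiff.comp b.contDiff
  have hc : HasCompactSupport (fun x => ((b x : ℝ) : ℂ)) :=
    HasCompactSupport.comp_left (g := Complex.ofReal) b.hasCompactSupport Complex.ofReal_zero
  obtain ⟨φ, hφ⟩ : ∃ φ : Cc (Rn n), ∀ x, φ x = ((b x : ℝ) : ℂ) := ⟨mkCc _ hs hc, fun _ => rfl⟩
  refine ⟨φ, fun h => ?_, fun x hx => ?_⟩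
  · have h0 := DFunLike.congr_fun (embed_injective (h.trans (map_zero _).symm)) (0 : Rn n)
    have h1 : b 0 = 1 := b.one_of_mem_closedBall
      (Metric.mem_closedBall_self b.rIn_pos.le)
    rw [hφ, h1] at h0
    exact one_ne_zero (h0.trans rfl : ((1 : ℝ) : ℂ) = 0)
  · have : b x = 0 := b.zero_of_le_dist (by simpa using hx)
    rw [hφ, this, Complex.ofReal_zero]

theorem norm_embed_translate (a : Rn n) (φ : Cc (Rn n)) :
    ‖embed (Rn n) (translate a φ)‖ = ‖embed (Rn n) φ‖ := by
  refine (sq_eq_sq₀ (norm_nonneg _) (norm_nonneg _)).1 ?_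
  rw [norm_embed_sq, norm_embed_sq]
  exact integral_sub_right_eq_self (fun x => ‖φ x‖ ^ 2) a

theorem norm_embed_translate_sub {r : ℝ} {φ : Cc (Rn n)} (hφ0 : ∀ x, r ≤ ‖x‖ → φ x = 0)
    {a a' : Rn n} (haa : 2 * r ≤ dist a a') :
    ‖embed (Rn n) (translate a φ) - embed (Rn n) (translate a' φ)‖ ^ 2
      = 2 * ‖embed (Rn n) φ‖ ^ 2 := by
  have h0 : ⟪embed (Rn n) (translate a φ), embed (Rn n) (translate a' φ)⟫_ℂ = 0 := by
    refine (inner_toLp_toLp (isTestOperator_id.memLp _) (isTestOperator_id.memLp _)).trans ?_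
    refine integral_eq_zero_of_ae (Filter.Eventually.of_forall fun x => ?_)
    change conj (φ (x - a)) * φ (x - a') = 0
    rcases lt_or_ge ‖x - a‖ r with h | h
    · have : r ≤ ‖x - a'‖ := by
        have := dist_triangle_left a a' x
        rw [dist_eq_norm x a, dist_eq_norm x a'] at this
        linarith
      rw [hφ0 _ this, mul_zero]
    · rw [hφ0 _ h, map_zero, zero_mul]
  rw [@norm_sub_sq ℂ, h0, norm_embed_translate, norm_embed_translate, map_zero]
  ring

theorem exists_norm_witten_translate_le (hV : ContDiff ℝ 2 V) {C M r : ℝ} (hC : HessBound V C)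
    (hr : ∀ x x' : Rn n, Phi V x ≤ M → dist x' x ≤ r → Phi V x' ≤ 64 * M)
    {φ : Cc (Rn n)} (hφ0 : ∀ x, r ≤ ‖x‖ → φ x = 0) :
    ∃ K : ℝ, ∀ a, Phi V a ≤ M →
      ‖(isTestOperator_wittenExpr hV).toL2 (translate a φ)‖ ≤ K := by
  obtain ⟨h, hdef⟩ : ∃ h : Rn n → ℝ, h = fun x => ‖∑ j, pd (e j) (pd (e j) φ) x‖
    + (64 * M + n * (C * (64 * M) ^ (2 / 3 : ℝ))) * ‖φ x‖ := ⟨_, rfl⟩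
  have hInt : Integrable (fun x => h x ^ 2) := by
    have h1 : Continuous h := by
      have h2 := fun w => (pd_smooth (pd_smooth φ.smooth w) w).continuous
      have h3 := φ.continuous
      rw [hdef]
      fun_prop
    refine (h1.pow 2).integrable_of_hasCompactSupport ?_
    refine HasCompactSupport.intro φ.hasCompactSupport fun x hx => ?_
    have k1 : ∀ w, pd w (pd w φ) x = 0 := fun w =>
      image_eq_zero_of_notMem_tsupport fun h => hx (tsupport_fderiv_apply_subset ℝ w
        (tsupport_fderiv_apply_subset ℝ w h))
    simp [hdef, k1, image_eq_zero_of_notMem_tsupport hx]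
  refine ⟨Real.sqrt (∫ x, h x ^ 2), fun a ha => Real.le_sqrt_of_sq_le ?_⟩
  rw [norm_toL2_sq, ← integral_sub_right_eq_self (fun x => h x ^ 2) a]
  refine integral_mono_of_nonneg (Filter.Eventually.of_forall fun x => by positivity)
    (hInt.comp_sub_right a) (Filter.Eventually.of_forall fun x => ?_)
  have := norm_wittenExpr_translate_le hC hr ha φ (fun x hx => hφ0 x hx.le) x
  rw [hdef]
  exact pow_le_pow_left₀ (norm_nonneg _) this 2

/-- If the Witten Laplacian has compact resolvent, then `|∂ₓV| → ∞` at infinity. -/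
theorem isBounded_Phi_le (hV : ContDiff ℝ 2 V) {C : ℝ} (hC : HessBound V C)
    (hW : HasCompactResolvent (wittenLaplacian hV)) (M : ℝ) :
    Bornology.IsBounded {x | Phi V x ≤ M} := by
  obtain ⟨-, z, R, hR, hRc⟩ := hW
  obtain ⟨r, hr, hrM⟩ := exists_radius_Phi_le hV hC M
  obtain ⟨φ, hφne, hφ0⟩ := exists_bump (n := n) hr
  obtain ⟨K, hK⟩ := exists_norm_witten_translate_le hV hC hrM hφ0
  have hmem : ∀ a, Phi V a ≤ M → embed (Rn n) (translate a φ)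
      ∈ R '' Metric.closedBall 0 (|K| + ‖z‖ * ‖embed (Rn n) φ‖ + 1) := by
    intro a ha
    have hle : minimalOperator (isTestOperator_wittenExpr hV) ≤ wittenLaplacian hV :=
      LinearPMap.le_closure _
    have hdom : embed (Rn n) (translate a φ)
        ∈ (minimalOperator (isTestOperator_wittenExpr hV)).domain :=
      LinearMap.mem_range_self _ _
    have hTu : wittenLaplacian hV ⟨_, hle.1 hdom⟩
        = (isTestOperator_wittenExpr hV).toL2 (translate a φ) := by
      rw [← minimalOperator_apply]
      exact (hle.2 rfl).symm
    refine ⟨_, ?_, hR.1 ⟨_, hle.1 hdom⟩⟩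
    rw [hTu, mem_closedBall_zero_iff]
    refine (norm_sub_le _ _).trans ?_
    rw [norm_smul, norm_embed_translate]
    have := hK a ha
    linarith [le_abs_self K]
  have htb : TotallyBounded ((fun a => embed (Rn n) (translate a φ)) '' {x | Phi V x ≤ M}) := by
    have hc := (isCompactOperator_iff_isCompact_closure_image_closedBall
      (R : L2 (Rn n) →ₗ[ℂ] L2 (Rn n)) (r := |K| + ‖z‖ * ‖embed (Rn n) φ‖ + 1)
      (by positivity)).1 hRc
    refine hc.totallyBounded.subset ?_
    rintro _ ⟨a, ha, rfl⟩
    exact subset_closure (hmem a ha)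
  obtain ⟨t, hts, htf, ht⟩ := totallyBounded_iff_subset.1 htb _
    (Metric.dist_mem_uniformity (norm_pos_iff.2 hφne))
  choose! c hc using fun y (hy : y ∈ t) => hts hy
  refine (Bornology.IsBounded.subset (t := ⋃ y ∈ t, Metric.ball (c y) (2 * r)) ?_) ?_
  · exact (Bornology.isBounded_biUnion htf).2 fun y _ => Metric.isBounded_ball
  · intro a ha
    obtain ⟨y, hy, hay⟩ := Set.mem_iUnion₂.1 (ht ⟨a, ha, rfl⟩)
    refine Set.mem_iUnion₂.2 ⟨y, hy, ?_⟩
    by_contra hfar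
    rw [Metric.mem_ball, not_lt] at hfar
    have h0 := norm_embed_translate_sub hφ0 hfar
    rw [Set.mem_ofPred_eq, ← (hc y hy).2, Set.mem_ofPred_eq, dist_eq_norm] at hay
    have h1 := norm_pos_iff.2 hφne
    have h2 := pow_le_pow_left₀ (norm_nonneg _) hay.le 2
    rw [h0] at h2
    nlinarith

end witten

end

section

section parts

variable {X : Type} [NormedAddCommGroup X] [NormedSpace ℝ X]

theorem pd_mul_apply {f g : X → ℝ} {x : X} (hf : DifferentiableAt ℝ f x)
    (hg : DifferentiableAt ℝ g x) (v : X) :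
    pd v (fun x => f x * g x) x = pd v f x * g x + f x * pd v g x := by
  simp only [pd, fderiv_fun_mul hf hg, add_apply, smul_apply, smul_eq_mul]
  ring

theorem pd_add_apply {f g : X → ℝ} {x : X} (hf : DifferentiableAt ℝ f x)
    (hg : DifferentiableAt ℝ g x) (v : X) :
    pd v (fun x => f x + g x) x = pd v f x + pd v g x := by
  simp only [pd, fderiv_fun_add hf hg, add_apply]

theorem pd_inner_apply {f g : X → ℂ} {x : X} (hf : DifferentiableAt ℝ f x)
    (hg : DifferentiableAt ℝ g x) (v : X) :
    pd v (fun x => inner ℝ (f x) (g x)) x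
      = inner ℝ (pd v f x) (g x) + inner ℝ (f x) (pd v g x) := by
  simp only [pd, fderiv_inner_apply ℝ hf hg]
  ring

theorem pd_real_smul_apply {f : X → ℝ} {g : X → ℂ} {x : X} (hf : DifferentiableAt ℝ f x)
    (hg : DifferentiableAt ℝ g x) (v : X) :
    pd v (fun x => f x • g x) x = pd v f x • g x + f x • pd v g x := by
  simp only [pd, fderiv_fun_smul hf hg, add_apply, smul_apply,
    ContinuousLinearMap.smulRight_apply]
  ring

variable [MeasureSpace X] [BorelSpace X] [FiniteDimensional ℝ X]
  [(volume : Measure X).IsAddHaarMeasure]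

/-- The integral of a derivative of a compactly supported function vanishes. -/
theorem integral_pd_eq_zero {h : X → ℝ} (hh : ContDiff ℝ 1 h) (hc : HasCompactSupport h) (v : X) :
    ∫ x, pd v h x = 0 := by
  have h1 : Continuous (pd v h) := (pd_contDiff (m := 0) hh (by simp) v).continuous
  have h2 : HasCompactSupport (pd v h) := hc.fderiv_apply ℝ v
  have := integral_mul_fderiv_eq_neg_fderiv_mul_of_integrable (μ := (volume : Measure X))
    (f := fun _ => (1 : ℝ)) (g := h) (v := v) (by simp)
    (by simpa only [one_mul] using! h1.integrable_of_hasCompactSupport h2)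
    (by simpa using hh.continuous.integrable_of_hasCompactSupport hc)
    (fun _ _ => by simp) (fun _ _ => hh.differentiable (by simp) _)
  simpa [pd] using this

end parts

variable {n : ℕ} {V : Rn n → ℝ}

instance : (volume : Measure (R2n n)).IsAddHaarMeasure :=
  inferInstanceAs ((volume : Measure (Rn n)).prod (volume : Measure (Rn n))).IsAddHaarMeasure

/-- The gradient `∂ₓV(x)` as a vector. -/
def grad (V : Rn n → ℝ) (x : Rn n) : Rn n := WithLp.toLp 2 fun j => pd (e j) V x

@[simp]
theorem grad_apply (V : Rn n → ℝ) (x : Rn n) (j : Fin n) : grad V x j = pd (e j) V x := rfl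

theorem norm_sq_eq_sum (y : Rn n) : ‖y‖ ^ 2 = ∑ j, y j ^ 2 := EuclideanSpace.real_norm_sq_eq y

/-- The Hamiltonian vector field `y·∂ₓ - ∂ₓV·∂_y` applied to a real function. -/
def transport (V : Rn n → ℝ) (h : R2n n → ℝ) (p : R2n n) : ℝ :=
  fderiv ℝ h p (p.2, -grad V p.1)

theorem transport_eq_sum (V : Rn n → ℝ) (h : R2n n → ℝ) (p : R2n n) :
    transport V h p = ∑ j, p.2 j * pd (e j, 0) h p - ∑ j, pd (e j) V p.1 * pd (0, e j) h p := by
  have h1 : ((p.2, -grad V p.1) : R2n n)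
      = ∑ j, p.2 j • ((e j, 0) : R2n n) - ∑ j, pd (e j) V p.1 • ((0, e j) : R2n n) := by
    refine Prod.ext ?_ ?_
    · simp only [Prod.fst_sub, Prod.fst_sum, Prod.smul_fst, smul_zero, Finset.sum_const_zero,
        sub_zero]
      exact sum_smul_e p.2
    · simp only [Prod.snd_sub, Prod.snd_sum, Prod.smul_snd, smul_zero, Finset.sum_const_zero,
        zero_sub]
      exact congrArg Neg.neg (sum_smul_e (grad V p.1))
  rw [transport, h1]
  simp only [pd, map_sub, map_sum, map_smul, smul_eq_mul]

/-- A vector field on phase space in divergence form has vanishing integral. -/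
theorem integral_divergence_eq_zero (A B : Fin n → R2n n → ℝ)
    (hA : ∀ j, ContDiff ℝ 1 (A j)) (hB : ∀ j, ContDiff ℝ 1 (B j))
    (hAc : ∀ j, HasCompactSupport (A j)) (hBc : ∀ j, HasCompactSupport (B j)) :
    Integrable (fun p => ∑ j, (pd (e j, 0) (A j) p + pd (0, e j) (B j) p)) ∧
    ∫ p, ∑ j, (pd (e j, 0) (A j) p + pd (0, e j) (B j) p) = 0 := by
  have hi : ∀ (h : R2n n → ℝ) (_ : ContDiff ℝ 1 h) (_ : HasCompactSupport h) (v : R2n n),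
      Integrable (pd v h) := fun h hh hc v =>
    (pd_contDiff (m := 0) hh (by simp) v).continuous.integrable_of_hasCompactSupport
      (hc.fderiv_apply ℝ v)
  refine ⟨integrable_finsetSum _ fun j _ =>
    (hi _ (hA j) (hAc j) _).add (hi _ (hB j) (hBc j) _), ?_⟩
  refine (integral_finsetSum _ fun j _ =>
    (hi _ (hA j) (hAc j) (e j, 0)).add (hi _ (hB j) (hBc j) (0, e j))).trans ?_
  refine Finset.sum_eq_zero fun j _ => ?_
  refine (integral_add (hi _ (hA j) (hAc j) _) (hi _ (hB j) (hBc j) _)).trans ?_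
  rw [integral_pd_eq_zero (hA j) (hAc j), integral_pd_eq_zero (hB j) (hBc j), add_zero]

theorem inner_fokkerPlanckExpr (V : Rn n → ℝ) (w : ℂ) (u : R2n n → ℂ) (p : R2n n) :
    inner ℝ w (fokkerPlanckExpr V u p)
      = ∑ j, p.2 j * inner ℝ w (pd (e j, 0) u p)
        - ∑ j, pd (e j) V p.1 * inner ℝ w (pd (0, e j) u p)
        - ∑ j, inner ℝ w (pd (0, e j) (pd (0, e j) u) p)
        + (‖p.2‖ ^ 2 / 4 - n / 2) * inner ℝ w (u p) := by
  simp only [fokkerPlanckExpr, ← Complex.real_smul, inner_add_right, inner_sub_right,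
    inner_sum, inner_smul_right]

theorem pd_fst_comp_eq_zero (f : Rn n → ℝ) (hf : Differentiable ℝ f) (w : Rn n) (p : R2n n) :
    pd ((0, w) : R2n n) (fun p : R2n n => f p.1) p = 0 := by
  have : HasFDerivAt (fun p : R2n n => f p.1) ((fderiv ℝ f p.1).comp
    (ContinuousLinearMap.fst ℝ (Rn n) (Rn n))) p :=
    (hf p.1).hasFDerivAt.comp p hasFDerivAt_fst
  simp [pd, this.fderiv]

theorem hasFDerivAt_snd_apply (j : Fin n) (p : R2n n) : HasFDerivAt (fun p : R2n n => p.2 j)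
    ((EuclideanSpace.proj j : Rn n →L[ℝ] ℝ).comp (ContinuousLinearMap.snd ℝ (Rn n) (Rn n))) p :=
  ((EuclideanSpace.proj j : Rn n →L[ℝ] ℝ).comp
    (ContinuousLinearMap.snd ℝ (Rn n) (Rn n))).hasFDerivAt

theorem contDiff_snd_apply (j : Fin n) : ContDiff ℝ ∞ (fun p : R2n n => p.2 j) :=
  ((EuclideanSpace.proj j : Rn n →L[ℝ] ℝ).comp
    (ContinuousLinearMap.snd ℝ (Rn n) (Rn n))).contDiff

theorem pd_snd_apply_eq_zero (j : Fin n) (v : Rn n) (p : R2n n) :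
    pd ((v, 0) : R2n n) (fun p : R2n n => p.2 j) p = 0 := by
  simp [pd, (hasFDerivAt_snd_apply j p).fderiv]

/-- The energy identity for the Fokker–Planck operator with a real multiplier `m`. -/
theorem energy_identity (hV : ContDiff ℝ 2 V) (u : Cc (R2n n)) {m : R2n n → ℝ}
    (hm : ContDiff ℝ 1 m) :
    ∫ p, m p * inner ℝ (u p) (fokkerPlanckExpr V u p)
      = ∫ p, (∑ j, (m p * ‖pd (0, e j) u p‖ ^ 2
          + pd (0, e j) m p * inner ℝ (u p) (pd (0, e j) u p))
        + (‖p.2‖ ^ 2 / 4 - n / 2) * (m p * ‖u p‖ ^ 2)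
        - 1 / 2 * (‖u p‖ ^ 2 * transport V m p)) := by
  have hu1 : ContDiff ℝ 1 (u : R2n n → ℂ) := u.smooth.of_le (by simp)
  have hdu : ∀ w, ContDiff ℝ 1 (pd w (u : R2n n → ℂ)) := fun w =>
    (pd_smooth u.smooth w).of_le (by simp)
  have hV1 := contDiff_pd_potential hV
  obtain ⟨N, hNdef⟩ : ∃ N : R2n n → ℝ, N = fun p => inner ℝ (u p) (u p) := ⟨_, rfl⟩
  have hN : ContDiff ℝ 1 N := by rw [hNdef]; exact hu1.inner ℝ hu1
  have hNc : HasCompactSupport N := HasCompactSupport.intro u.hasCompactSupport fun p hp => by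
    simp [hNdef, image_eq_zero_of_notMem_tsupport hp]
  obtain ⟨ρ, hρdef⟩ : ∃ ρ : Fin n → R2n n → ℝ,
      ρ = fun j p => inner ℝ (u p) (pd (0, e j) u p) := ⟨_, rfl⟩
  have hρ : ∀ j, ContDiff ℝ 1 (ρ j) := fun j => by rw [hρdef]; exact hu1.inner ℝ (hdu _)
  have hρc : ∀ j, HasCompactSupport (ρ j) := fun j =>
    HasCompactSupport.intro u.hasCompactSupport fun p hp => by
      simp [hρdef, image_eq_zero_of_notMem_tsupport hp]
  have hVp : ∀ j, ContDiff ℝ 1 (fun p : R2n n => pd (e j) V p.1) := fun j =>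
    (contDiff_pd_potential hV (e j)).comp contDiff_fst
  have hy : ∀ j, ContDiff ℝ 1 (fun p : R2n n => p.2 j) := fun j =>
    (contDiff_snd_apply j).of_le (by simp)
  have hmN : ContDiff ℝ 1 (fun p => m p * N p) := hm.mul hN
  obtain ⟨hdi, hd0⟩ := integral_divergence_eq_zero
    (fun j p => 1 / 2 * (p.2 j * (m p * N p)))
    (fun j p => -1 / 2 * (pd (e j) V p.1 * (m p * N p)) + -1 * (m p * ρ j p))
    (fun j => contDiff_const.mul ((hy j).mul hmN))
    (fun j => (contDiff_const.mul ((hVp j).mul hmN)).add (contDiff_const.mul (hm.mul (hρ j))))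
    (fun j => hNc.mul_left.mul_left.mul_left)
    (fun j => hNc.mul_left.mul_left.mul_left.add (hρc j).mul_left.mul_left)
  have hF1 : Integrable (fun p => m p * inner ℝ (u p) (fokkerPlanckExpr V u p)) := by
    refine Continuous.integrable_of_hasCompactSupport (hm.continuous.mul
      (u.continuous.inner ((isTestOperator_fokkerPlanckExpr hV).continuous u))) ?_
    exact HasCompactSupport.intro u.hasCompactSupport fun p hp => by
      simp [image_eq_zero_of_notMem_tsupport hp]
  rw [← sub_zero (∫ p, m p * inner ℝ (u p) (fokkerPlanckExpr V u p)), ← hd0, ← integral_sub hF1 hdi]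
  refine integral_congr_ae (Filter.Eventually.of_forall fun p => ?_)
  have dm := hm.differentiable (by simp) p
  have dN := hN.differentiable (by simp) p
  have dmN := hmN.differentiable (by simp) p
  have du := hu1.differentiable (by simp) p
  have hNp : ∀ w, pd w N p = 2 * inner ℝ (u p) (pd w u p) := fun w => by
    rw [hNdef, pd_inner_apply du du, real_inner_comm]; ring
  have hρp : ∀ j, pd (0, e j) (ρ j) p = ‖pd (0, e j) u p‖ ^ 2
      + inner ℝ (u p) (pd (0, e j) (pd (0, e j) u) p) := fun j => by
    rw [hρdef, pd_inner_apply du ((hdu _).differentiable (by simp) p),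
      real_inner_self_eq_norm_sq]
  have hA : ∀ j, pd (e j, 0) (fun p : R2n n => 1 / 2 * (p.2 j * (m p * N p))) p
      = 1 / 2 * (p.2 j * (pd (e j, 0) m p * N p + m p * pd (e j, 0) N p)) := fun j => by
    rw [pd_mul_apply (differentiableAt_const _) (((hy j).mul hmN).differentiable (by simp) p),
      pd_mul_apply ((hy j).differentiable (by simp) p) dmN, pd_mul_apply dm dN,
      pd_snd_apply_eq_zero]
    simp [pd]
  have hB : ∀ j, pd (0, e j) (fun p => -1 / 2 * (pd (e j) V p.1 * (m p * N p))
        + -1 * (m p * ρ j p)) p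
      = -1 / 2 * (pd (e j) V p.1 * (pd (0, e j) m p * N p + m p * pd (0, e j) N p))
        - (pd (0, e j) m p * ρ j p + m p * pd (0, e j) (ρ j) p) := fun j => by
    have d1 := (contDiff_const (c := (-1 / 2 : ℝ)) |>.mul ((hVp j).mul hmN)).differentiable
      (by simp) p
    have d2 := (contDiff_const (c := (-1 : ℝ)) |>.mul (hm.mul (hρ j))).differentiable (by simp) p
    rw [pd_add_apply d1 d2, pd_mul_apply (differentiableAt_const _)
        (((hVp j).mul hmN).differentiable (by simp) p),
      pd_mul_apply ((hVp j).differentiable (by simp) p) dmN, pd_mul_apply dm dN,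
      pd_mul_apply (differentiableAt_const _) ((hm.mul (hρ j)).differentiable (by simp) p),
      pd_mul_apply dm ((hρ j).differentiable (by simp) p),
      pd_fst_comp_eq_zero _ ((contDiff_pd_potential hV (e j)).differentiable (by simp))]
    simp [pd]
    ring
  simp only [hA, hB, hNp, hρp]
  rw [inner_fokkerPlanckExpr, transport_eq_sum, real_inner_self_eq_norm_sq]
  have hNv : N p = ‖u p‖ ^ 2 := by simp only [hNdef, real_inner_self_eq_norm_sq]
  have hρv : ∀ j, inner ℝ (u p) (pd (0, e j) u p) = ρ j p := fun j => by rw [hρdef]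
  simp only [hNv, hρv, mul_add, mul_sub, Finset.mul_sum, Finset.sum_add_distrib,
    Finset.sum_sub_distrib]
  have e1 : ∀ j, 1 / 2 * (p.2 j * (m p * (2 * inner ℝ (u p) (pd (e j, 0) u p))))
      = m p * (p.2 j * inner ℝ (u p) (pd (e j, 0) u p)) := fun j => by ring
  have e2 : ∀ j, -1 / 2 * (pd (e j) V p.1 * (m p * (2 * ρ j p)))
      = -(m p * (pd (e j) V p.1 * ρ j p)) := fun j => by ring
  have e3 : ∀ j, 1 / 2 * (p.2 j * (pd (e j, 0) m p * ‖u p‖ ^ 2))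
      = 1 / 2 * (‖u p‖ ^ 2 * (p.2 j * pd (e j, 0) m p)) := fun j => by ring
  have e4 : ∀ j, -1 / 2 * (pd (e j) V p.1 * (pd (0, e j) m p * ‖u p‖ ^ 2))
      = -(1 / 2 * (‖u p‖ ^ 2 * (pd (e j) V p.1 * pd (0, e j) m p))) := fun j => by ring
  simp only [e1, e2, e3, e4, Finset.sum_neg_distrib]
  ring

end

section

variable {n : ℕ} {V : Rn n → ℝ}

section support

variable {X : Type} [NormedAddCommGroup X] [NormedSpace ℝ X]

theorem pd_eq_zero_of_notMem_tsupport {F : Type} [NormedAddCommGroup F] [NormedSpace ℝ F]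
    {f : X → F} {x : X} (hx : x ∉ tsupport f) (v : X) : pd v f x = 0 := by
  have : fderiv ℝ f x = 0 :=
    image_eq_zero_of_notMem_tsupport fun h => hx (tsupport_fderiv_subset ℝ h)
  simp [pd, this]

theorem notMem_tsupport_pd {F : Type} [NormedAddCommGroup F] [NormedSpace ℝ F]
    {f : X → F} {x : X} (hx : x ∉ tsupport f) (v : X) : x ∉ tsupport (pd v f) := fun h =>
  hx (tsupport_fderiv_apply_subset ℝ v h)

theorem Cc.integrable_of_eq_zero [MeasureSpace X] [BorelSpace X]
    [IsFiniteMeasureOnCompacts (volume : Measure X)] {E : Type} [NormedAddCommGroup E]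
    (u : Cc X) {f : X → E} (hf : Continuous f) (h0 : ∀ x ∉ tsupport u, f x = 0) : Integrable f :=
  hf.integrable_of_hasCompactSupport (HasCompactSupport.intro u.hasCompactSupport h0)

end support

theorem fokkerPlanckExpr_eq_zero {u : R2n n → ℂ} {p : R2n n} (hp : p ∉ tsupport u) :
    fokkerPlanckExpr V u p = 0 := by
  simp [fokkerPlanckExpr, image_eq_zero_of_notMem_tsupport hp, pd_eq_zero_of_notMem_tsupport hp,
    pd_eq_zero_of_notMem_tsupport (notMem_tsupport_pd hp _)]

/-- The squared graph norm of `P` at a test function. -/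
def graphSq (V : Rn n → ℝ) (u : Cc (R2n n)) : ℝ :=
  ∫ p, (‖fokkerPlanckExpr V u p‖ ^ 2 + ‖u p‖ ^ 2)

theorem integrable_graphSq (hV : ContDiff ℝ 2 V) (u : Cc (R2n n)) :
    Integrable (fun p => ‖fokkerPlanckExpr V u p‖ ^ 2 + ‖u p‖ ^ 2) := by
  have h1 := (isTestOperator_fokkerPlanckExpr hV).continuous u
  have h2 := u.continuous
  refine u.integrable_of_eq_zero (by fun_prop) fun p hp => ?_
  simp [fokkerPlanckExpr_eq_zero hp, image_eq_zero_of_notMem_tsupport hp]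

theorem graphSq_nonneg (V : Rn n → ℝ) (u : Cc (R2n n)) : 0 ≤ graphSq V u :=
  integral_nonneg fun p => by positivity

/-- The density of the dissipation `|∂_y u|² + |y|²|u|²/4`. -/
def dissip (u : R2n n → ℂ) (p : R2n n) : ℝ :=
  ∑ j, ‖pd (0, e j) u p‖ ^ 2 + ‖p.2‖ ^ 2 / 4 * ‖u p‖ ^ 2

theorem dissip_nonneg (u : R2n n → ℂ) (p : R2n n) : 0 ≤ dissip u p :=
  add_nonneg (Finset.sum_nonneg fun _ _ => by positivity) (by positivity)

theorem integrable_dissip (u : Cc (R2n n)) : Integrable (dissip (n := n) u) := by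
  have h2 := u.continuous
  have h1 := fun w => (pd_smooth u.smooth w).continuous
  refine u.integrable_of_eq_zero (by unfold dissip; fun_prop) fun p hp => ?_
  simp [dissip, image_eq_zero_of_notMem_tsupport hp, pd_eq_zero_of_notMem_tsupport hp]

theorem integrable_norm_sq (u : Cc (R2n n)) : Integrable (fun p => ‖u p‖ ^ 2) := by
  have h2 := u.continuous
  refine u.integrable_of_eq_zero (by fun_prop) fun p hp => ?_
  simp [image_eq_zero_of_notMem_tsupport hp]

theorem integral_inner_fokkerPlanck (hV : ContDiff ℝ 2 V) (u : Cc (R2n n)) :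
    ∫ p, inner ℝ (u p) (fokkerPlanckExpr V u p)
      = (∫ p, dissip u p) - n / 2 * ∫ p, ‖u p‖ ^ 2 := by
  have h := energy_identity hV u (m := fun _ => 1) contDiff_const
  simp only [one_mul] at h
  rw [h, ← integral_const_mul, ← integral_sub (integrable_dissip u)
    ((integrable_norm_sq u).const_mul _)]
  refine integral_congr_ae (Filter.Eventually.of_forall fun p => ?_)
  simp [transport, dissip, pd]
  ring

theorem integral_dissip_le (hV : ContDiff ℝ 2 V) (u : Cc (R2n n)) :
    ∫ p, dissip u p ≤ (n + 1) * graphSq V u := by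
  have h := integral_inner_fokkerPlanck hV u
  have h1 : ∫ p, inner ℝ (u p) (fokkerPlanckExpr V u p) ≤ graphSq V u := by
    refine integral_mono ?_ (integrable_graphSq hV u) fun p => ?_
    · have h1 := (isTestOperator_fokkerPlanckExpr hV).continuous u
      refine u.integrable_of_eq_zero (u.continuous.inner h1) fun p hp => ?_
      simp [image_eq_zero_of_notMem_tsupport hp]
    · have := real_inner_le_norm (u p) (fokkerPlanckExpr V u p)
      simp only
      nlinarith [sq_nonneg (‖u p‖ - ‖fokkerPlanckExpr V u p‖), norm_nonneg (u p),
        norm_nonneg (fokkerPlanckExpr V u p)]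
  have h2 : ∫ p, ‖u p‖ ^ 2 ≤ graphSq V u :=
    integral_mono (integrable_norm_sq u) (integrable_graphSq hV u) fun p => by
      simp only
      nlinarith [sq_nonneg ‖fokkerPlanckExpr V u p‖]
  have h3 := graphSq_nonneg V u
  have h4 : (0 : ℝ) ≤ n := n.cast_nonneg
  nlinarith

section multiplier

/-- The slope `(y·∂ₓV)(1 + |∂ₓV|²)^{-2/3}`. -/
def slope (V : Rn n → ℝ) (p : R2n n) : ℝ :=
  (∑ j, p.2 j * pd (e j) V p.1) * Phi V p.1 ^ (-(2 / 3) : ℝ)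

theorem contDiff_slope (hV : ContDiff ℝ 2 V) : ContDiff ℝ 1 (slope V) := by
  refine ContDiff.mul (ContDiff.sum fun j _ => ?_) ?_
  · exact ((contDiff_snd_apply j).of_le (by simp)).mul
      ((contDiff_pd_potential hV (e j)).comp contDiff_fst)
  · exact ((contDiff_Phi hV).comp contDiff_fst).rpow_const_of_ne fun p => (Phi_pos V p.1).ne'

theorem fderiv_slope (hV : ContDiff ℝ 2 V) (p q : R2n n) :
    fderiv ℝ (slope V) p q
      = (∑ j, p.2 j * pd (e j) V p.1)
          * (-(2 / 3) * Phi V p.1 ^ (-(2 / 3) - 1 : ℝ) * fderiv ℝ (Phi V) p.1 q.1)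
        + Phi V p.1 ^ (-(2 / 3) : ℝ)
          * ∑ j, (p.2 j * fderiv ℝ (pd (e j) V) p.1 q.1 + pd (e j) V p.1 * q.2 j) := by
  have h1 : ∀ j, HasFDerivAt (fun p : R2n n => pd (e j) V p.1)
      ((fderiv ℝ (pd (e j) V) p.1).comp (ContinuousLinearMap.fst ℝ (Rn n) (Rn n))) p := fun j =>
    ((contDiff_pd_potential hV (e j)).differentiable (by simp) p.1).hasFDerivAt.comp p
      hasFDerivAt_fst
  have h2 := HasFDerivAt.fun_sum (u := Finset.univ) fun j _ =>
    (hasFDerivAt_snd_apply j p).mul (h1 j)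
  have h3 : HasFDerivAt (fun p : R2n n => Phi V p.1 ^ (-(2 / 3) : ℝ)) _ p :=
    (hasFDerivAt_Phi_rpow hV (-(2 / 3)) p.1).comp p hasFDerivAt_fst
  have h4 : HasFDerivAt (slope V) _ p := h2.mul h3
  rw [h4.fderiv]
  simp only [add_apply, smul_apply, smul_eq_mul, ContinuousLinearMap.comp_apply,
    ContinuousLinearMap.coe_fst', ContinuousLinearMap.coe_snd', sum_apply]
  rfl

theorem sq_sum_mul_pd_le (V : Rn n → ℝ) (p : R2n n) :
    (∑ j, p.2 j * pd (e j) V p.1) ^ 2 ≤ ‖p.2‖ ^ 2 * Phi V p.1 := by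
  refine (Finset.sum_mul_sq_le_sq_mul_sq _ _ _).trans ?_
  rw [← norm_sq_eq_sum]
  have : ∑ j, pd (e j) V p.1 ^ 2 ≤ Phi V p.1 := by
    change gradSq V p.1 ≤ 1 + gradSq V p.1
    linarith
  gcongr

theorem slope_sq_mul_le (V : Rn n → ℝ) (p : R2n n) :
    slope V p ^ 2 * Phi V p.1 ^ (1 / 3 : ℝ) ≤ ‖p.2‖ ^ 2 := by
  have hΦ := Phi_pos V p.1
  have h1 : (Phi V p.1 ^ (-(2 / 3) : ℝ)) ^ 2 * Phi V p.1 ^ (1 / 3 : ℝ) * Phi V p.1 = 1 := by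
    rw [← Real.rpow_natCast, ← Real.rpow_mul hΦ.le, ← Real.rpow_add hΦ, ← Real.rpow_add_one hΦ.ne']
    norm_num
  have h2 := sq_sum_mul_pd_le V p
  have h3 : 0 ≤ (Phi V p.1 ^ (-(2 / 3) : ℝ)) ^ 2 * Phi V p.1 ^ (1 / 3 : ℝ) := by positivity
  calc slope V p ^ 2 * Phi V p.1 ^ (1 / 3 : ℝ)
      = (∑ j, p.2 j * pd (e j) V p.1) ^ 2
        * ((Phi V p.1 ^ (-(2 / 3) : ℝ)) ^ 2 * Phi V p.1 ^ (1 / 3 : ℝ)) := by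
        rw [slope]; ring
    _ ≤ (‖p.2‖ ^ 2 * Phi V p.1)
        * ((Phi V p.1 ^ (-(2 / 3) : ℝ)) ^ 2 * Phi V p.1 ^ (1 / 3 : ℝ)) := by gcongr
    _ = ‖p.2‖ ^ 2 * ((Phi V p.1 ^ (-(2 / 3) : ℝ)) ^ 2 * Phi V p.1 ^ (1 / 3 : ℝ) * Phi V p.1) := by
        ring
    _ = ‖p.2‖ ^ 2 := by rw [h1, mul_one]

theorem abs_transport_slope_add_le (hV : ContDiff ℝ 2 V) {C : ℝ} (hC : HessBound V C)
    (p : R2n n) :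
    |transport V (slope V) p + gradSq V p.1 * Phi V p.1 ^ (-(2 / 3) : ℝ)|
      ≤ 3 * n ^ 2 * C * ‖p.2‖ ^ 2 := by
  have hΦ := Phi_pos V p.1
  have hg : ∑ j, pd (e j) V p.1 * pd (e j) V p.1 = gradSq V p.1 :=
    Finset.sum_congr rfl fun j _ => by ring
  have h0 : transport V (slope V) p + gradSq V p.1 * Phi V p.1 ^ (-(2 / 3) : ℝ)
      = (∑ j, p.2 j * pd (e j) V p.1)
          * (-(2 / 3) * Phi V p.1 ^ (-(2 / 3) - 1 : ℝ) * fderiv ℝ (Phi V) p.1 p.2)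
        + Phi V p.1 ^ (-(2 / 3) : ℝ) * ∑ j, p.2 j * fderiv ℝ (pd (e j) V) p.1 p.2 := by
    rw [transport, fderiv_slope hV]
    simp only [PiLp.neg_apply, grad_apply, mul_neg, Finset.sum_add_distrib, Finset.sum_neg_distrib,
      hg]
    ring
  have hS : |∑ j, p.2 j * pd (e j) V p.1| ≤ ‖p.2‖ * Phi V p.1 ^ (1 / 2 : ℝ) := by
    refine abs_le_of_sq_le_sq ?_ (by positivity)
    rw [mul_pow, ← Real.rpow_natCast (Phi V p.1 ^ (1 / 2 : ℝ)), ← Real.rpow_mul hΦ.le]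
    norm_num
    exact sq_sum_mul_pd_le V p
  have hT : |∑ j, p.2 j * fderiv ℝ (pd (e j) V) p.1 p.2|
      ≤ n * (‖p.2‖ * (n * C * Phi V p.1 ^ (2 / 3 : ℝ) * ‖p.2‖)) := by
    refine (Finset.abs_sum_le_sum_abs _ _).trans ?_
    calc _ ≤ ∑ _j : Fin n, ‖p.2‖ * (n * C * Phi V p.1 ^ (2 / 3 : ℝ) * ‖p.2‖) := by
          refine Finset.sum_le_sum fun j _ => ?_
          rw [abs_mul]
          exact mul_le_mul (abs_apply_le_norm _ _) (abs_fderiv_pd_le hC _ _ _) (abs_nonneg _)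
            (norm_nonneg _)
      _ = _ := by simp
  have hF := abs_fderiv_Phi_le hV hC p.1 p.2
  have k1 : Phi V p.1 ^ (1 / 2 : ℝ) * (Phi V p.1 ^ (-(2 / 3) - 1 : ℝ) * Phi V p.1 ^ (7 / 6 : ℝ))
      = 1 := by
    rw [← Real.rpow_add hΦ, ← Real.rpow_add hΦ]; norm_num
  have k2 : Phi V p.1 ^ (-(2 / 3) : ℝ) * Phi V p.1 ^ (2 / 3 : ℝ) = 1 := by
    rw [← Real.rpow_add hΦ]; norm_num
  have hC0 := hC.1
  rw [h0]
  refine (abs_add_le _ _).trans ?_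
  rw [abs_mul, abs_mul (Phi V p.1 ^ (-(2 / 3) : ℝ)), abs_mul, abs_mul (-(2 / 3) : ℝ),
    abs_of_pos (Real.rpow_pos_of_pos hΦ _), abs_of_pos (Real.rpow_pos_of_pos hΦ _)]
  have h23 : |(-(2 / 3) : ℝ)| ≤ 1 := by rw [abs_neg, abs_of_pos] <;> norm_num
  calc _ ≤ ‖p.2‖ * Phi V p.1 ^ (1 / 2 : ℝ)
          * (1 * Phi V p.1 ^ (-(2 / 3) - 1 : ℝ)
            * (2 * n ^ 2 * C * Phi V p.1 ^ (7 / 6 : ℝ) * ‖p.2‖))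
        + Phi V p.1 ^ (-(2 / 3) : ℝ)
          * (n * (‖p.2‖ * (n * C * Phi V p.1 ^ (2 / 3 : ℝ) * ‖p.2‖))) := by gcongr
    _ = 2 * n ^ 2 * C * ‖p.2‖ ^ 2 * (Phi V p.1 ^ (1 / 2 : ℝ)
          * (Phi V p.1 ^ (-(2 / 3) - 1 : ℝ) * Phi V p.1 ^ (7 / 6 : ℝ)))
        + n ^ 2 * C * ‖p.2‖ ^ 2 * (Phi V p.1 ^ (-(2 / 3) : ℝ) * Phi V p.1 ^ (2 / 3 : ℝ)) := by ring
    _ = _ := by rw [k1, k2]; ring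

theorem fderiv_arctan_slope (hV : ContDiff ℝ 2 V) (p q : R2n n) :
    fderiv ℝ (fun p => Real.arctan (slope V p)) p q
      = (1 + slope V p ^ 2)⁻¹ * fderiv ℝ (slope V) p q := by
  have := ((contDiff_slope hV).differentiable (by simp) p).hasFDerivAt.arctan
  rw [this.fderiv]
  simp

theorem pd_arctan_slope (hV : ContDiff ℝ 2 V) (j : Fin n) (p : R2n n) :
    pd (0, e j) (fun p => Real.arctan (slope V p)) p
      = (1 + slope V p ^ 2)⁻¹ * (Phi V p.1 ^ (-(2 / 3) : ℝ) * pd (e j) V p.1) := by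
  rw [pd, fderiv_arctan_slope hV, fderiv_slope hV]
  have h3 : ∑ i, (p.2 i * fderiv ℝ (pd (e i) V) p.1 ((0, e j) : R2n n).1
      + pd (e i) V p.1 * ((0, e j) : R2n n).2 i) = pd (e j) V p.1 := by
    simp [e]
  rw [h3]
  simp only [map_zero, mul_zero, zero_add]

theorem abs_pd_arctan_slope_le (hV : ContDiff ℝ 2 V) (j : Fin n) (p : R2n n) :
    |pd (0, e j) (fun p => Real.arctan (slope V p)) p| ≤ 1 := by
  have hΦ := Phi_pos V p.1
  rw [pd_arctan_slope hV, abs_mul]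
  have h1 : |(1 + slope V p ^ 2)⁻¹| ≤ 1 := by
    rw [abs_of_pos (by positivity)]
    exact inv_le_one_of_one_le₀ (by nlinarith [sq_nonneg (slope V p)])
  have h2 : |Phi V p.1 ^ (-(2 / 3) : ℝ) * pd (e j) V p.1| ≤ 1 := by
    rw [abs_mul, abs_of_pos (Real.rpow_pos_of_pos hΦ _)]
    calc _ ≤ Phi V p.1 ^ (-(2 / 3) : ℝ) * Phi V p.1 ^ (1 / 2 : ℝ) := by
          gcongr; exact abs_pd_le_sqrt_Phi V p.1 j
      _ ≤ 1 := by
          rw [← Real.rpow_add hΦ]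
          exact Real.rpow_le_one_of_one_le_of_nonpos (one_le_Phi V p.1) (by norm_num)
  nlinarith [abs_nonneg (Phi V p.1 ^ (-(2 / 3) : ℝ) * pd (e j) V p.1),
    abs_nonneg ((1 + slope V p ^ 2)⁻¹)]

theorem Phi_rpow_le (hV : ContDiff ℝ 2 V) {C : ℝ} (hC : HessBound V C) (p : R2n n) :
    Phi V p.1 ^ (1 / 3 : ℝ) ≤ -transport V (fun p => Real.arctan (slope V p)) p + 1
      + (3 * n ^ 2 * C + 1) * ‖p.2‖ ^ 2 := by
  have hΦ := Phi_pos V p.1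
  have h1 : transport V (fun p => Real.arctan (slope V p)) p
      = (1 + slope V p ^ 2)⁻¹ * transport V (slope V) p := by
    rw [transport, fderiv_arctan_slope hV]; rfl
  have h2 := (abs_le.1 (abs_transport_slope_add_le hV hC p)).2
  have h3 := slope_sq_mul_le V p
  have h4 : gradSq V p.1 * Phi V p.1 ^ (-(2 / 3) : ℝ)
      = Phi V p.1 ^ (1 / 3 : ℝ) - Phi V p.1 ^ (-(2 / 3) : ℝ) := by
    have : Phi V p.1 ^ (1 / 3 : ℝ) = Phi V p.1 ^ (-(2 / 3) : ℝ) * Phi V p.1 := by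
      rw [← Real.rpow_add_one hΦ.ne']; norm_num
    rw [this]
    have : gradSq V p.1 = Phi V p.1 - 1 := by unfold Phi; ring
    rw [this]; ring
  have h5 : Phi V p.1 ^ (-(2 / 3) : ℝ) ≤ 1 :=
    Real.rpow_le_one_of_one_le_of_nonpos (one_le_Phi V p.1) (by norm_num)
  rw [h1]
  set a := Phi V p.1 ^ (1 / 3 : ℝ)
  set s := slope V p
  set t := transport V (slope V) p
  have ht : (1 + s ^ 2)⁻¹ ≤ 1 := inv_le_one_of_one_le₀ (by nlinarith [sq_nonneg s])
  have ht0 : 0 < (1 + s ^ 2)⁻¹ := by positivity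
  have ha : a = (1 + s ^ 2)⁻¹ * (a + s ^ 2 * a) := by field_simp
  have hb : t ≤ -a + (1 + 3 * n ^ 2 * C * ‖p.2‖ ^ 2) := by linarith
  have hc : (1 + s ^ 2)⁻¹ * t ≤ (1 + s ^ 2)⁻¹ * (-a + (1 + 3 * n ^ 2 * C * ‖p.2‖ ^ 2)) := by
    gcongr
  have hC0 := hC.1
  have hd : (1 + s ^ 2)⁻¹ * (1 + 3 * n ^ 2 * C * ‖p.2‖ ^ 2) ≤ 1 + 3 * n ^ 2 * C * ‖p.2‖ ^ 2 :=
    mul_le_of_le_one_left (by positivity) ht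
  have he : (1 + s ^ 2)⁻¹ * (s ^ 2 * a) ≤ ‖p.2‖ ^ 2 :=
    (mul_le_of_le_one_left (by positivity) ht).trans h3
  nlinarith

end multiplier

/-- The weighted estimate `‖(1 + |∂ₓV|²)^{1/6} u‖² ≤ K (‖Pu‖² + ‖u‖²)`. -/
theorem exists_weighted_estimate (hV : ContDiff ℝ 2 V) {C : ℝ} (hC : HessBound V C) :
    ∃ K : ℝ, 0 ≤ K ∧ ∀ u : Cc (R2n n),
      ∫ p, Phi V p.1 ^ (1 / 3 : ℝ) * ‖u p‖ ^ 2 ≤ K * graphSq V u := by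
  obtain ⟨m, hm⟩ : ∃ m : R2n n → ℝ, m = fun p => Real.arctan (slope V p) := ⟨_, rfl⟩
  have hmC : ContDiff ℝ 1 m := by rw [hm]; exact (contDiff_slope hV).arctan
  have hmb : ∀ p, |m p| ≤ 2 := fun p => by
    have h1 := Real.arctan_lt_pi_div_two (slope V p)
    have h2 := Real.neg_pi_div_two_lt_arctan (slope V p)
    have h3 := Real.pi_le_four
    rw [hm, abs_le]
    constructor <;> simp only <;> linarith
  set D : ℝ := 3 * n ^ 2 * C + 1 with hD
  have hD0 : 0 ≤ D := by have := hC.1; positivity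
  refine ⟨6 * n + 8 + (8 + 4 * D) * (n + 1), by positivity, fun u => ?_⟩
  have hu := u.continuous
  have hdu := fun w => (pd_smooth u.smooth w).continuous
  have hPu := (isTestOperator_fokkerPlanckExpr hV).continuous u
  have hΦc : Continuous fun p : R2n n => Phi V p.1 ^ (1 / 3 : ℝ) :=
    ((contDiff_Phi hV).continuous.comp continuous_fst).rpow_const
      fun p => Or.inl (Phi_pos V p.1).ne'
  have hen := energy_identity hV u hmC
  have hdm : ∀ w, Continuous (pd w m) := fun w => (pd_contDiff (m := 0) hmC (by simp) w).continuous
  have htr : Continuous (transport V m) := by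
    have h3 := fun w => (contDiff_pd_potential hV w).continuous
    rw [funext (transport_eq_sum V m)]
    fun_prop
  have hmc := hmC.continuous
  obtain ⟨R, hR⟩ : ∃ R : R2n n → ℝ, R = fun p => ∑ j, (m p * ‖pd (0, e j) u p‖ ^ 2
      + pd (0, e j) m p * inner ℝ (u p) (pd (0, e j) u p))
      + (‖p.2‖ ^ 2 / 4 - n / 2) * (m p * ‖u p‖ ^ 2)
      - 1 / 2 * (‖u p‖ ^ 2 * transport V m p) := ⟨_, rfl⟩
  rw [← hR] at hen
  have hRi : Integrable R := by
    refine u.integrable_of_eq_zero (by rw [hR]; fun_prop) fun p hp => ?_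
    simp [hR, image_eq_zero_of_notMem_tsupport hp, pd_eq_zero_of_notMem_tsupport hp]
  have hai : Integrable (fun p : R2n n => Phi V p.1 ^ (1 / 3 : ℝ) * ‖u p‖ ^ 2) := by
    refine u.integrable_of_eq_zero (by fun_prop) fun p hp => ?_
    simp [image_eq_zero_of_notMem_tsupport hp]
  have hmi : Integrable (fun p => m p * inner ℝ (u p) (fokkerPlanckExpr V u p)) := by
    refine u.integrable_of_eq_zero (by fun_prop) fun p hp => ?_
    simp [image_eq_zero_of_notMem_tsupport hp]
  have hNi := integrable_norm_sq u
  have h1 : ∫ p, (Phi V p.1 ^ (1 / 3 : ℝ) * ‖u p‖ ^ 2 - 2 * R p)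
      ≤ ∫ p, ((8 + 4 * D) * dissip u p + (3 * n + 1) * ‖u p‖ ^ 2) := by
    refine integral_mono (hai.sub (hRi.const_mul 2))
      (((integrable_dissip u).const_mul _).add (hNi.const_mul _)) fun p => ?_
    have hp := Phi_rpow_le hV hC p
    rw [← hm, ← hD] at hp
    have hp' := mul_le_mul_of_nonneg_right hp (sq_nonneg ‖u p‖)
    have hmp := abs_le.1 (hmb p)
    have hj : ∀ j, -(m p * ‖pd (0, e j) u p‖ ^ 2
        + pd (0, e j) m p * inner ℝ (u p) (pd (0, e j) u p))
        ≤ 4 * ‖pd (0, e j) u p‖ ^ 2 + 1 / 2 * ‖u p‖ ^ 2 := fun j => by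
      have k1 : |pd (0, e j) m p| ≤ 1 := by rw [hm]; exact abs_pd_arctan_slope_le hV j p
      have k2 := abs_real_inner_le_norm (u p) (pd (0, e j) u p)
      have k3 : |pd (0, e j) m p * inner ℝ (u p) (pd (0, e j) u p)|
          ≤ ‖u p‖ * ‖pd (0, e j) u p‖ := by
        rw [abs_mul]
        exact (mul_le_of_le_one_left (abs_nonneg _) k1).trans k2
      have k4 := (abs_le.1 k3).1
      nlinarith [sq_nonneg (‖u p‖ - ‖pd (0, e j) u p‖), sq_nonneg ‖pd (0, e j) u p‖]
    have hs := Finset.sum_le_sum fun j (_ : j ∈ Finset.univ) => hj j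
    have hse : ∑ j, (4 * ‖pd (0, e j) u p‖ ^ 2 + 1 / 2 * ‖u p‖ ^ 2)
        = 4 * ∑ j, ‖pd (0, e j) u p‖ ^ 2 + n * (1 / 2 * ‖u p‖ ^ 2) := by
      rw [Finset.sum_add_distrib, ← Finset.mul_sum, Finset.sum_const, Finset.card_univ,
        Fintype.card_fin, nsmul_eq_mul]
    rw [Finset.sum_neg_distrib, hse] at hs
    have hq : -((‖p.2‖ ^ 2 / 4 - n / 2) * (m p * ‖u p‖ ^ 2))
        ≤ 2 * (‖p.2‖ ^ 2 / 4 + n / 2) * ‖u p‖ ^ 2 := by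
      have h4 : (0 : ℝ) ≤ n := n.cast_nonneg
      have k1 : -((‖p.2‖ ^ 2 / 4 - n / 2) * m p) ≤ 2 * (‖p.2‖ ^ 2 / 4 + n / 2) := by
        nlinarith [sq_nonneg ‖p.2‖]
      nlinarith [sq_nonneg ‖u p‖]
    have hsn : 0 ≤ ∑ j, ‖pd (0, e j) u p‖ ^ 2 := Finset.sum_nonneg fun _ _ => by positivity
    have hyn : 0 ≤ ‖p.2‖ ^ 2 * ‖u p‖ ^ 2 := by positivity
    simp only [hR, dissip]
    nlinarith [mul_nonneg hD0 hsn, mul_nonneg hD0 hyn]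
  rw [integral_sub hai (hRi.const_mul 2), integral_const_mul, ← hen,
    integral_add ((integrable_dissip u).const_mul _) (hNi.const_mul _), integral_const_mul,
    integral_const_mul] at h1
  have h2 : ∫ p, m p * inner ℝ (u p) (fokkerPlanckExpr V u p) ≤ graphSq V u := by
    refine integral_mono hmi (integrable_graphSq hV u) fun p => ?_
    have k2 := abs_real_inner_le_norm (u p) (fokkerPlanckExpr V u p)
    have k3 : |m p * inner ℝ (u p) (fokkerPlanckExpr V u p)|
        ≤ 2 * (‖u p‖ * ‖fokkerPlanckExpr V u p‖) := by
      rw [abs_mul]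
      exact mul_le_mul (hmb p) k2 (abs_nonneg _) (by norm_num)
    have k4 := (abs_le.1 k3).2
    simp only
    nlinarith [sq_nonneg (‖u p‖ - ‖fokkerPlanckExpr V u p‖)]
  have h3 : ∫ p, ‖u p‖ ^ 2 ≤ graphSq V u :=
    integral_mono hNi (integrable_graphSq hV u) fun p => by
      simp only
      nlinarith [sq_nonneg ‖fokkerPlanckExpr V u p‖]
  have h4 := integral_dissip_le hV u
  have h5 : (0 : ℝ) ≤ n := n.cast_nonneg
  have h6 := graphSq_nonneg V u
  have h7 := mul_le_mul_of_nonneg_left h4 (by positivity : 0 ≤ 8 + 4 * D)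
  have h8 := mul_le_mul_of_nonneg_left h3 (by positivity : (0 : ℝ) ≤ 3 * n + 1)
  nlinarith [mul_nonneg h5 h6]

end

section

variable {n : ℕ}

section fourier

open scoped SchwartzMap FourierTransform LineDeriv
open SchwartzMap Real

/-- The identification of phase space with a Euclidean space. -/
def euclidEquiv (n : ℕ) : WithLp 2 (Rn n × Rn n) ≃L[ℝ] R2n n :=
  WithLp.prodContinuousLinearEquiv 2 ℝ (Rn n) (Rn n)

/-- The Fourier transform on phase space. -/
def FT : 𝓢(R2n n, ℂ) →ₗ[ℂ] 𝓢(R2n n, ℂ) where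
  toFun f := compCLMOfContinuousLinearEquiv ℂ (euclidEquiv n).symm
    (𝓕 (compCLMOfContinuousLinearEquiv ℂ (euclidEquiv n) f))
  map_add' f g := by simp only [map_add, FourierTransform.fourier_add]
  map_smul' c f := by simp only [map_smul, FourierTransform.fourier_smul, RingHom.id_apply]

theorem FT_apply (f : 𝓢(R2n n, ℂ)) (p : R2n n) :
    FT f p = 𝓕 (compCLMOfContinuousLinearEquiv ℂ (euclidEquiv n) f) ((euclidEquiv n).symm p) := rfl

theorem inner_symm (p q : R2n n) :
    inner ℝ ((euclidEquiv n).symm p) ((euclidEquiv n).symm q) = inner ℝ p.1 q.1 + inner ℝ p.2 q.2 :=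
  WithLp.prod_inner_apply _ _

theorem integral_comp_euclidEquiv {F : Type} [NormedAddCommGroup F] [NormedSpace ℝ F]
    (f : R2n n → F) : ∫ x, f (euclidEquiv n x) = ∫ p, f p :=
  (WithLp.volume_preserving_ofLp (Rn n) (Rn n)).integral_comp
    (euclidEquiv n).toHomeomorph.measurableEmbedding f

theorem integral_comp_euclidEquiv_symm {F : Type} [NormedAddCommGroup F] [NormedSpace ℝ F]
    (f : WithLp 2 (Rn n × Rn n) → F) : ∫ p, f ((euclidEquiv n).symm p) = ∫ x, f x :=
  (WithLp.volume_preserving_toLp (Rn n) (Rn n)).integral_comp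
    (euclidEquiv n).symm.toHomeomorph.measurableEmbedding f

theorem FT_apply_eq_integral (f : 𝓢(R2n n, ℂ)) (p : R2n n) :
    FT f p = ∫ q, 𝐞 (-(inner ℝ q.1 p.1 + inner ℝ q.2 p.2)) • f q := by
  rw [FT_apply, fourier_coe, Real.fourier_eq, ← integral_comp_euclidEquiv]
  rfl

theorem integral_norm_sq_FT (f : 𝓢(R2n n, ℂ)) : ∫ p, ‖FT f p‖ ^ 2 = ∫ p, ‖f p‖ ^ 2 := by
  simp only [FT_apply]
  rw [integral_comp_euclidEquiv_symm
    (fun x => ‖𝓕 (compCLMOfContinuousLinearEquiv ℂ (euclidEquiv n) f) x‖ ^ 2),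
    integral_norm_sq_fourier, ← integral_comp_euclidEquiv (fun p => ‖f p‖ ^ 2)]
  rfl

theorem hasTemperateGrowth_inner (m : WithLp 2 (Rn n × Rn n)) :
    (inner ℝ · m : WithLp 2 (Rn n × Rn n) → ℝ).HasTemperateGrowth := by fun_prop

theorem FT_lineDeriv (f : 𝓢(R2n n, ℂ)) (m p : R2n n) :
    FT (∂_{m} f) p = (2 * π * Complex.I) * ((inner ℝ p.1 m.1 + inner ℝ p.2 m.2 : ℝ) * FT f p) := by
  have h : compCLMOfContinuousLinearEquiv ℂ (euclidEquiv n) (∂_{m} f)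
      = ∂_{(euclidEquiv n).symm m} (compCLMOfContinuousLinearEquiv ℂ (euclidEquiv n) f) := by
    rw [lineDerivOp_compCLMOfContinuousLinearEquiv, ContinuousLinearEquiv.apply_symm_apply]
  rw [FT_apply, h, fourier_lineDerivOp_eq, smul_apply,
    smulLeftCLM_apply_apply (hasTemperateGrowth_inner _), inner_symm, Complex.real_smul,
    smul_eq_mul, FT_apply]

theorem lineDeriv_FT (f g : 𝓢(R2n n, ℂ)) (m : R2n n)
    (hg : ∀ q, g q = ((inner ℝ q.1 m.1 + inner ℝ q.2 m.2 : ℝ) : ℂ) * f q) (p : R2n n) :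
    ∂_{m} (FT f) p = -(2 * π * Complex.I) * FT g p := by
  have h : FT f = compCLMOfContinuousLinearEquiv ℂ (euclidEquiv n).symm
    (𝓕 (compCLMOfContinuousLinearEquiv ℂ (euclidEquiv n) f)) := rfl
  rw [h, lineDerivOp_compCLMOfContinuousLinearEquiv, lineDerivOp_fourier_eq,
    compCLMOfContinuousLinearEquiv_apply, Function.comp_apply, FT_apply,
    FourierTransform.fourier_smul, smul_apply, smul_eq_mul]
  congr 3
  ext x
  rw [smulLeftCLM_apply_apply (hasTemperateGrowth_inner _)]
  simp only [compCLMOfContinuousLinearEquiv_apply, Function.comp_apply, hg, Complex.real_smul]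
  congr 2

theorem inner_e (x : Rn n) (j : Fin n) : inner ℝ x (e j) = x j := by
  simp [e, EuclideanSpace.inner_single_right]

theorem hasTemperateGrowth_snd_apply (j : Fin n) :
    (fun p : R2n n => p.2 j).HasTemperateGrowth :=
  ((EuclideanSpace.proj j : Rn n →L[ℝ] ℝ).comp
    (ContinuousLinearMap.snd ℝ (Rn n) (Rn n))).hasTemperateGrowth

theorem pd_FT_eq (f : 𝓢(R2n n, ℂ)) (j : Fin n) (p : R2n n) :
    FT (smulLeftCLM ℂ (fun p : R2n n => p.2 j) (∂_{((e j, 0) : R2n n)} f)) p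
      = -(((p.1 j : ℝ) : ℂ) * pd (0, e j) (FT f) p) := by
  have h1 := lineDeriv_FT (∂_{((e j, 0) : R2n n)} f)
    (smulLeftCLM ℂ (fun p : R2n n => p.2 j) (∂_{((e j, 0) : R2n n)} f)) (0, e j)
    (fun q => by
      rw [smulLeftCLM_apply_apply (hasTemperateGrowth_snd_apply j)]
      simp [inner_e]) p
  have h2 : ∂_{((0, e j) : R2n n)} (FT (∂_{((e j, 0) : R2n n)} f)) p
      = (2 * π * Complex.I) * (((p.1 j : ℝ) : ℂ) * pd (0, e j) (FT f) p) := by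
    have hfun : (FT (∂_{((e j, 0) : R2n n)} f) : R2n n → ℂ)
        = fun p => (2 * π * Complex.I) * (((p.1 j : ℝ) : ℂ) * FT f p) := by
      funext q
      rw [FT_lineDeriv]
      simp [inner_e]
    rw [lineDerivOp_apply_eq_fderiv, hfun]
    have d1 : HasFDerivAt (fun p : R2n n => ((p.1 j : ℝ) : ℂ))
        (Complex.ofRealCLM.comp ((EuclideanSpace.proj j : Rn n →L[ℝ] ℝ).comp
          (ContinuousLinearMap.fst ℝ (Rn n) (Rn n)))) p :=
      (Complex.ofRealCLM.comp ((EuclideanSpace.proj j : Rn n →L[ℝ] ℝ).comp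
          (ContinuousLinearMap.fst ℝ (Rn n) (Rn n)))).hasFDerivAt
    have d2 := (d1.mul (FT f).differentiableAt.hasFDerivAt).const_mul (2 * π * Complex.I)
    have d3 : HasFDerivAt (fun p => (2 * π * Complex.I) * (((p.1 j : ℝ) : ℂ) * FT f p)) _ p := d2
    rw [d3.fderiv]
    simp [pd]
  have h3 := h1.symm.trans h2
  have hne : (2 * π * Complex.I : ℂ) ≠ 0 := by
    simp [Complex.I_ne_zero, Real.pi_ne_zero]
  refine mul_left_cancel₀ hne ?_
  linear_combination -h3

end fourier

end

section

variable {n : ℕ}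

section fourier_estimate

open scoped SchwartzMap FourierTransform LineDeriv
open SchwartzMap Real

/-- The potential whose gradient is the identity. -/
def halfSq (x : Rn n) : ℝ := 1 / 2 * ‖x‖ ^ 2

theorem contDiff_halfSq : ContDiff ℝ 2 (halfSq (n := n)) :=
  contDiff_const.mul (contDiff_norm_sq ℝ)

theorem pd_halfSq (x : Rn n) (j : Fin n) : pd (e j) halfSq x = x j := by
  have h : HasFDerivAt (fun x : Rn n => 1 / 2 * ‖x‖ ^ 2) _ x :=
    ((hasStrictFDerivAt_norm_sq x).hasFDerivAt).const_mul (1 / 2)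
  change fderiv ℝ (fun x : Rn n => 1 / 2 * ‖x‖ ^ 2) x (e j) = _
  rw [h.fderiv]
  simp [inner_e]

theorem Phi_halfSq (x : Rn n) : Phi halfSq x = 1 + ‖x‖ ^ 2 := by
  rw [Phi, gradSq, norm_sq_eq_sum]
  simp only [pd_halfSq]

/-- The bounded multiplier `arctan ((ξ·η)(1 + |ξ|²)^{-2/3})`. -/
def mult (p : R2n n) : ℝ := Real.arctan (slope halfSq p)

theorem contDiff_mult : ContDiff ℝ 1 (mult (n := n)) := (contDiff_slope contDiff_halfSq).arctan

theorem abs_mult_le (p : R2n n) : |mult p| ≤ 2 := by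
  have h1 := Real.arctan_lt_pi_div_two (slope halfSq p)
  have h2 := Real.neg_pi_div_two_lt_arctan (slope halfSq p)
  have h3 := Real.pi_le_four
  rw [mult, abs_le]
  constructor <;> linarith

theorem one_add_norm_sq_rpow_le (p : R2n n) :
    (1 + ‖p.1‖ ^ 2) ^ (1 / 3 : ℝ) ≤ ∑ j, p.1 j * pd (0, e j) mult p + 1 + ‖p.2‖ ^ 2 := by
  have hΦ := Phi_pos halfSq p.1
  have h1 : ∑ j, p.1 j * pd (0, e j) mult p
      = (1 + slope halfSq p ^ 2)⁻¹ * (Phi halfSq p.1 ^ (-(2 / 3) : ℝ) * ‖p.1‖ ^ 2) := by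
    have : ∀ j, pd (0, e j) mult p
        = (1 + slope halfSq p ^ 2)⁻¹ * (Phi halfSq p.1 ^ (-(2 / 3) : ℝ) * p.1 j) := fun j => by
      rw [← pd_halfSq]
      exact pd_arctan_slope contDiff_halfSq j p
    simp only [this]
    rw [norm_sq_eq_sum, Finset.mul_sum, Finset.mul_sum]
    exact Finset.sum_congr rfl fun j _ => by ring
  have h3 := slope_sq_mul_le halfSq p
  have h4 : ‖p.1‖ ^ 2 = Phi halfSq p.1 - 1 := by rw [Phi_halfSq]; ring
  have h5 : Phi halfSq p.1 ^ (-(2 / 3) : ℝ) ≤ 1 :=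
    Real.rpow_le_one_of_one_le_of_nonpos (one_le_Phi halfSq p.1) (by norm_num)
  have h6 : Phi halfSq p.1 ^ (1 / 3 : ℝ) = Phi halfSq p.1 ^ (-(2 / 3) : ℝ) * Phi halfSq p.1 := by
    rw [← Real.rpow_add_one hΦ.ne']; norm_num
  rw [← Phi_halfSq, h1, h4, mul_sub, ← h6, mul_one]
  set a := Phi halfSq p.1 ^ (1 / 3 : ℝ)
  set b := Phi halfSq p.1 ^ (-(2 / 3) : ℝ)
  set s := slope halfSq p
  have ht : (1 + s ^ 2)⁻¹ ≤ 1 := inv_le_one_of_one_le₀ (by nlinarith [sq_nonneg s])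
  have ht0 : 0 < (1 + s ^ 2)⁻¹ := by positivity
  have ha : a = (1 + s ^ 2)⁻¹ * (a + s ^ 2 * a) := by field_simp
  have hb0 : 0 ≤ b := by positivity
  have hb : (1 + s ^ 2)⁻¹ * b ≤ 1 := (mul_le_of_le_one_left hb0 ht).trans h5
  have he : (1 + s ^ 2)⁻¹ * (s ^ 2 * a) ≤ ‖p.2‖ ^ 2 :=
    (mul_le_of_le_one_left (by positivity) ht).trans h3
  nlinarith

theorem abs_pd_mult_le (j : Fin n) (p : R2n n) : |pd (0, e j) mult p| ≤ 1 :=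
  abs_pd_arctan_slope_le contDiff_halfSq j p

/-- The integral of a derivative vanishes if the function and its derivative are integrable. -/
theorem integral_pd_eq_zero_of_integrable {h : R2n n → ℝ} (hh : Differentiable ℝ h)
    (v : R2n n) (hi : Integrable h) (hi' : Integrable (pd v h)) : ∫ x, pd v h x = 0 := by
  have := integral_mul_fderiv_eq_neg_fderiv_mul_of_integrable (μ := (volume : Measure (R2n n)))
    (f := fun _ => (1 : ℝ)) (g := h) (v := v) (by simp)
    (by simpa only [one_mul] using! hi') (by simpa using hi)
    (fun _ _ => by simp) (fun _ _ => hh _)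
  simpa [pd] using this

theorem exists_norm_le (f : 𝓢(R2n n, ℂ)) : ∃ B : ℝ, ∀ p, ‖f p‖ ≤ B :=
  ⟨SchwartzMap.seminorm ℝ 0 0 f, fun p => f.norm_le_seminorm ℝ p⟩

theorem integrable_norm_mul_norm_mul (f g : 𝓢(R2n n, ℂ)) :
    Integrable (fun p => ‖p‖ * (‖f p‖ * ‖g p‖)) := by
  obtain ⟨B, hB⟩ := exists_norm_le g
  have h1 := (f.integrable_pow_mul (volume : Measure (R2n n)) 1).mul_const B
  refine h1.mono' (by
    have := f.continuous
    have := g.continuous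
    exact Continuous.aestronglyMeasurable (by fun_prop)) (Filter.Eventually.of_forall fun p => ?_)
  rw [Real.norm_of_nonneg (by positivity), pow_one]
  have := hB p
  calc ‖p‖ * (‖f p‖ * ‖g p‖) = ‖p‖ * ‖f p‖ * ‖g p‖ := by ring
    _ ≤ _ := by gcongr

theorem integrable_norm_sq_schwartz (f : 𝓢(R2n n, ℂ)) : Integrable (fun p => ‖f p‖ ^ 2) :=
  (memLp_two_iff_integrable_sq_norm f.continuous.aestronglyMeasurable).1 (f.memLp 2 volume)

theorem norm_FT_lineDeriv_sq (f : 𝓢(R2n n, ℂ)) (j : Fin n) (p : R2n n) :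
    ‖FT (∂_{((0, e j) : R2n n)} f) p‖ ^ 2 = (2 * π) ^ 2 * (p.2 j ^ 2 * ‖FT f p‖ ^ 2) := by
  rw [FT_lineDeriv]
  simp [inner_e, mul_pow, abs_of_pos Real.pi_pos]

/-- Gain of a third of a derivative in `x` for kinetic transport equations, on the Fourier side. -/
theorem integral_rpow_mul_norm_FT_sq_le (f g : 𝓢(R2n n, ℂ)) (k : Fin n → 𝓢(R2n n, ℂ))
    (h : ∑ j, smulLeftCLM ℂ (fun p : R2n n => p.2 j) (∂_{((e j, 0) : R2n n)} f)
      = g + ∑ j, ∂_{((0, e j) : R2n n)} (k j)) :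
    Integrable (fun p : R2n n => (1 + ‖p.1‖ ^ 2) ^ (1 / 3 : ℝ) * ‖FT f p‖ ^ 2) ∧
    ∫ p : R2n n, (1 + ‖p.1‖ ^ 2) ^ (1 / 3 : ℝ) * ‖FT f p‖ ^ 2
      ≤ 3 * ∫ p, (‖f p‖ ^ 2 + ‖g p‖ ^ 2
        + ∑ j, (‖pd (0, e j) f p‖ ^ 2 + ‖k j p‖ ^ 2)) := by
  obtain ⟨w, hw⟩ : ∃ w : 𝓢(R2n n, ℂ), w = FT f := ⟨_, rfl⟩
  have heq : ∀ p, -∑ j, ((p.1 j : ℝ) : ℂ) * pd (0, e j) w p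
      = FT g p + ∑ j, (2 * π * Complex.I) * (((p.2 j : ℝ) : ℂ) * FT (k j) p) := by
    intro p
    have h1 := congrArg (fun F : 𝓢(R2n n, ℂ) => FT F p) h
    simp only [map_sum, map_add, sum_apply, add_apply] at h1
    simp only [pd_FT_eq, FT_lineDeriv, inner_e, inner_zero_right, zero_add] at h1
    rw [hw, ← Finset.sum_neg_distrib]
    exact h1
  obtain ⟨N, hNdef⟩ : ∃ N : R2n n → ℝ, N = fun p => inner ℝ (w p) (w p) := ⟨_, rfl⟩
  have hNv : ∀ p, N p = ‖w p‖ ^ 2 := fun p => by rw [hNdef]; exact real_inner_self_eq_norm_sq _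
  have hwC : ContDiff ℝ 1 w := w.smooth 1
  have hN : ContDiff ℝ 1 N := by rw [hNdef]; exact hwC.inner ℝ hwC
  have hx : ∀ j : Fin n, ContDiff ℝ 1 (fun p : R2n n => p.1 j) := fun j =>
    ((EuclideanSpace.proj j : Rn n →L[ℝ] ℝ).comp
      (ContinuousLinearMap.fst ℝ (Rn n) (Rn n))).contDiff
  have hxz : ∀ (j : Fin n) (p : R2n n), pd (0, e j) (fun p : R2n n => p.1 j) p = 0 := fun j p =>
    pd_fst_comp_eq_zero (fun x => x j) (EuclideanSpace.proj j : Rn n →L[ℝ] ℝ).differentiable _ p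
  have hmN := (contDiff_mult (n := n)).mul hN
  have hH : ∀ j, ContDiff ℝ 1 (fun p : R2n n => p.1 j * (mult p * N p)) := fun j => (hx j).mul hmN
  have hpd : ∀ (j : Fin n) (p : R2n n), pd (0, e j) (fun p : R2n n => p.1 j * (mult p * N p)) p
      = p.1 j * (pd (0, e j) mult p * N p + mult p * (2 * inner ℝ (w p) (pd (0, e j) w p))) := by
    intro j p
    have dw := hwC.differentiable (by simp) p
    rw [pd_mul_apply ((hx j).differentiable (by simp) p) (hmN.differentiable (by simp) p), hxz,
      pd_mul_apply (contDiff_mult.differentiable (by simp) p) (hN.differentiable (by simp) p),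
      hNdef, pd_inner_apply dw dw, real_inner_comm]
    ring
  have hxle : ∀ (j : Fin n) (p : R2n n), |p.1 j| ≤ ‖p‖ := fun j p =>
    (abs_apply_le_norm p.1 j).trans (norm_fst_le p)
  have hHi : ∀ j, Integrable (fun p : R2n n => p.1 j * (mult p * N p)) := fun j => by
    refine ((integrable_norm_mul_norm_mul w w).const_mul 2).mono'
      (hH j).continuous.aestronglyMeasurable (Filter.Eventually.of_forall fun p => ?_)
    rw [norm_mul, norm_mul, Real.norm_eq_abs, Real.norm_eq_abs, hNv, norm_pow, norm_norm]
    calc |p.1 j| * (|mult p| * ‖w p‖ ^ 2) ≤ ‖p‖ * (2 * ‖w p‖ ^ 2) := by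
          gcongr
          exacts [hxle j p, abs_mult_le p]
      _ = _ := by ring
  have hHi' : ∀ j, Integrable (pd (0, e j) (fun p : R2n n => p.1 j * (mult p * N p))) := fun j => by
    refine ((integrable_norm_mul_norm_mul w w).add
      ((integrable_norm_mul_norm_mul w (∂_{((0, e j) : R2n n)} w)).const_mul 4)).mono'
      (pd_contDiff (m := 0) (hH j) (by simp) _).continuous.aestronglyMeasurable
      (Filter.Eventually.of_forall fun p => ?_)
    rw [hpd, hNv]
    have k1 := abs_real_inner_le_norm (w p) (pd (0, e j) w p)
    have k2 := abs_pd_mult_le j p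
    have k3 := abs_mult_le p
    rw [norm_mul, Real.norm_eq_abs, Real.norm_eq_abs]
    have k4 : |pd (0, e j) mult p * ‖w p‖ ^ 2 + mult p * (2 * inner ℝ (w p) (pd (0, e j) w p))|
        ≤ 1 * ‖w p‖ ^ 2 + 2 * (2 * (‖w p‖ * ‖pd (0, e j) w p‖)) := by
      refine (abs_add_le _ _).trans ?_
      rw [abs_mul, abs_mul, abs_mul, abs_two, abs_of_nonneg (sq_nonneg ‖w p‖)]
      gcongr
    have k5 : ‖(∂_{((0, e j) : R2n n)} w) p‖ = ‖pd (0, e j) w p‖ := rfl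
    simp only [Pi.add_apply]
    rw [k5]
    calc _ ≤ ‖p‖ * (1 * ‖w p‖ ^ 2 + 2 * (2 * (‖w p‖ * ‖pd (0, e j) w p‖))) := by
          gcongr
          exact hxle j p
      _ = _ := by ring
  have hdi : Integrable (fun p => ∑ j, pd (0, e j) (fun p : R2n n => p.1 j * (mult p * N p)) p) :=
    integrable_finsetSum _ fun j _ => hHi' j
  have hd0 : ∫ p, ∑ j, pd (0, e j) (fun p : R2n n => p.1 j * (mult p * N p)) p = 0 := by
    rw [integral_finsetSum _ fun j _ => hHi' j]
    exact Finset.sum_eq_zero fun j _ => integral_pd_eq_zero_of_integrable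
      ((hH j).differentiable (by simp)) _ (hHi j) (hHi' j)
  obtain ⟨Q, hQ⟩ : ∃ Q : R2n n → ℝ, Q = fun p => ‖FT f p‖ ^ 2 + ‖FT g p‖ ^ 2
      + ∑ j, (‖FT (∂_{((0, e j) : R2n n)} f) p‖ ^ 2 + ‖FT (k j) p‖ ^ 2) := ⟨_, rfl⟩
  have hQi : Integrable Q := by
    rw [hQ]
    exact ((integrable_norm_sq_schwartz _).add (integrable_norm_sq_schwartz _)).add
      (integrable_finsetSum _ fun j _ =>
        (integrable_norm_sq_schwartz _).add (integrable_norm_sq_schwartz _))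
  have hQv : ∫ p, Q p = ∫ p, (‖f p‖ ^ 2 + ‖g p‖ ^ 2
        + ∑ j, (‖pd (0, e j) f p‖ ^ 2 + ‖k j p‖ ^ 2)) := by
    have i1 := fun F : 𝓢(R2n n, ℂ) => integrable_norm_sq_schwartz F
    have e1 : ∀ (j : Fin n) p, ‖pd (0, e j) f p‖ ^ 2 = ‖(∂_{((0, e j) : R2n n)} f) p‖ ^ 2 :=
      fun _ _ => rfl
    simp only [hQ, e1]
    have s1 : ∀ (a b : 𝓢(R2n n, ℂ)) (c d : Fin n → 𝓢(R2n n, ℂ)),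
        ∫ p, (‖a p‖ ^ 2 + ‖b p‖ ^ 2 + ∑ j, (‖c j p‖ ^ 2 + ‖d j p‖ ^ 2))
        = (∫ p, ‖a p‖ ^ 2) + (∫ p, ‖b p‖ ^ 2)
          + ∑ j, ((∫ p, ‖c j p‖ ^ 2) + ∫ p, ‖d j p‖ ^ 2) := by
      intro a b c d
      have i2 : Integrable (fun p => ‖a p‖ ^ 2 + ‖b p‖ ^ 2) := (i1 a).add (i1 b)
      have i3 : ∀ j ∈ Finset.univ, Integrable (fun p => ‖c j p‖ ^ 2 + ‖d j p‖ ^ 2) :=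
        fun j _ => (i1 (c j)).add (i1 (d j))
      rw [integral_add i2 (integrable_finsetSum _ i3), integral_add (i1 a) (i1 b),
        integral_finsetSum _ i3]
      congr 1
      exact Finset.sum_congr rfl fun j _ => integral_add (i1 _) (i1 _)
    rw [s1, s1 f g (fun j => ∂_{((0, e j) : R2n n)} f) k]
    simp only [integral_norm_sq_FT]
  have hpt : ∀ p : R2n n, (1 + ‖p.1‖ ^ 2) ^ (1 / 3 : ℝ) * ‖FT f p‖ ^ 2
      ≤ ∑ j, pd (0, e j) (fun p : R2n n => p.1 j * (mult p * N p)) p + 3 * Q p := by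
    intro p
    have k1 := mul_le_mul_of_nonneg_right (one_add_norm_sq_rpow_le p) (sq_nonneg ‖w p‖)
    have k2 : ∑ j, pd (0, e j) (fun p : R2n n => p.1 j * (mult p * N p)) p
        = (∑ j, p.1 j * pd (0, e j) mult p) * ‖w p‖ ^ 2
          - 2 * mult p * inner ℝ (w p) (FT g p
            + ∑ j, (2 * π * Complex.I) * (((p.2 j : ℝ) : ℂ) * FT (k j) p)) := by
      rw [← heq p, inner_neg_right, inner_sum, Finset.sum_mul, mul_neg, sub_neg_eq_add,
        Finset.mul_sum, ← Finset.sum_add_distrib]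
      refine Finset.sum_congr rfl fun j _ => ?_
      rw [hpd, hNv, ← Complex.real_smul, inner_smul_right]
      ring
    have k3 : ∀ j, ‖w p‖ * ‖(2 * π * Complex.I) * (((p.2 j : ℝ) : ℂ) * FT (k j) p)‖
        ≤ 1 / 2 * (‖FT (∂_{((0, e j) : R2n n)} f) p‖ ^ 2 + ‖FT (k j) p‖ ^ 2) := by
      intro j
      rw [norm_FT_lineDeriv_sq, ← hw]
      have : ‖(2 * π * Complex.I) * (((p.2 j : ℝ) : ℂ) * FT (k j) p)‖
          = 2 * π * (|p.2 j| * ‖FT (k j) p‖) := by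
        simp [abs_of_pos Real.pi_pos]
      rw [this, ← sq_abs (p.2 j)]
      nlinarith [sq_nonneg (2 * π * (|p.2 j| * ‖w p‖) - ‖FT (k j) p‖)]
    have k4 : |inner ℝ (w p) (FT g p
            + ∑ j, (2 * π * Complex.I) * (((p.2 j : ℝ) : ℂ) * FT (k j) p))|
        ≤ 1 / 2 * Q p := by
      refine (abs_real_inner_le_norm _ _).trans ?_
      calc _ ≤ ‖w p‖ * (‖FT g p‖
            + ∑ j, ‖(2 * π * Complex.I) * (((p.2 j : ℝ) : ℂ) * FT (k j) p)‖) := by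
            gcongr
            exact (norm_add_le _ _).trans (by gcongr; exact norm_sum_le _ _)
        _ = ‖w p‖ * ‖FT g p‖
            + ∑ j, ‖w p‖ * ‖(2 * π * Complex.I) * (((p.2 j : ℝ) : ℂ) * FT (k j) p)‖ := by
            rw [mul_add, Finset.mul_sum]
        _ ≤ 1 / 2 * (‖w p‖ ^ 2 + ‖FT g p‖ ^ 2)
            + ∑ j, 1 / 2 * (‖FT (∂_{((0, e j) : R2n n)} f) p‖ ^ 2 + ‖FT (k j) p‖ ^ 2) := by
            refine add_le_add ?_ (Finset.sum_le_sum fun j _ => k3 j)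
            nlinarith [sq_nonneg (‖w p‖ - ‖FT g p‖)]
        _ = 1 / 2 * Q p := by rw [← Finset.mul_sum, hQ, hw]; ring
    have k5 : ‖p.2‖ ^ 2 * ‖w p‖ ^ 2 ≤ ∑ j, ‖FT (∂_{((0, e j) : R2n n)} f) p‖ ^ 2 := by
      rw [norm_sq_eq_sum, Finset.sum_mul]
      refine Finset.sum_le_sum fun j _ => ?_
      rw [norm_FT_lineDeriv_sq, ← hw]
      have : 1 ≤ (2 * π) ^ 2 := by nlinarith [Real.pi_gt_three]
      nlinarith [mul_nonneg (sq_nonneg (p.2 j)) (sq_nonneg ‖w p‖)]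
    have k6 : ‖w p‖ ^ 2 + ∑ j, ‖FT (∂_{((0, e j) : R2n n)} f) p‖ ^ 2 ≤ Q p := by
      rw [hQ, hw]
      simp only [Finset.sum_add_distrib]
      have : 0 ≤ ∑ j, ‖FT (k j) p‖ ^ 2 := Finset.sum_nonneg fun _ _ => by positivity
      nlinarith [sq_nonneg ‖FT g p‖]
    have k7 : |2 * mult p * inner ℝ (w p) (FT g p
            + ∑ j, (2 * π * Complex.I) * (((p.2 j : ℝ) : ℂ) * FT (k j) p))| ≤ 2 * Q p := by
      rw [abs_mul, abs_mul, abs_two]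
      have := abs_mult_le p
      calc _ ≤ 2 * 2 * (1 / 2 * Q p) := by gcongr
        _ = 2 * Q p := by ring
    have k8 := (abs_le.1 k7).2
    rw [← hw, k2]
    nlinarith
  have hcont : Continuous (fun p : R2n n => (1 + ‖p.1‖ ^ 2) ^ (1 / 3 : ℝ) * ‖FT f p‖ ^ 2) := by
    have := (FT f).continuous
    refine Continuous.mul (Continuous.rpow_const (by fun_prop) fun p => Or.inl ?_) (by fun_prop)
    positivity
  have hInt : Integrable (fun p : R2n n => (1 + ‖p.1‖ ^ 2) ^ (1 / 3 : ℝ) * ‖FT f p‖ ^ 2) := by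
    refine (hdi.add (hQi.const_mul 3)).mono' hcont.aestronglyMeasurable
      (Filter.Eventually.of_forall fun p => ?_)
    rw [Real.norm_of_nonneg (by positivity)]
    exact hpt p
  refine ⟨hInt, ?_⟩
  refine (integral_mono hInt (hdi.add (hQi.const_mul 3)) hpt).trans_eq ?_
  rw [integral_add' hdi (hQi.const_mul 3), hd0, zero_add, integral_const_mul, hQv]

end fourier_estimate

end

section

variable {n : ℕ} {V : Rn n → ℝ}

section localization

open scoped SchwartzMap FourierTransform LineDeriv
open SchwartzMap Real

/-- A real cutoff function on phase space. -/
structure Cutoff (n : ℕ) where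
  /-- The underlying function. -/
  toFun : R2n n → ℝ
  smooth : ContDiff ℝ ∞ toFun
  compact : HasCompactSupport toFun

/-- The product of a cutoff and a smooth function, as a test function. -/
def Cutoff.mulCc (κ : Cutoff n) (f : R2n n → ℂ) (hf : ContDiff ℝ ∞ f) : Cc (R2n n) :=
  mkCc (fun p => κ.toFun p • f p) (κ.smooth.smul hf) κ.compact.smul_right

theorem Cutoff.mulCc_apply (κ : Cutoff n) (f : R2n n → ℂ) (hf : ContDiff ℝ ∞ f) (p : R2n n) :
    κ.mulCc f hf p = κ.toFun p • f p := rfl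

/-- A test function as a Schwartz function. -/
def schw (u : Cc (R2n n)) : 𝓢(R2n n, ℂ) := u.hasCompactSupport.toSchwartzMap u.smooth

@[simp]
theorem schw_apply (u : Cc (R2n n)) (p : R2n n) : schw u p = u p := rfl

theorem coe_schw (u : Cc (R2n n)) : ⇑(schw u) = u := rfl

theorem exists_abs_le_of_hasCompactSupport {h : R2n n → ℝ} (hh : Continuous h)
    (hc : HasCompactSupport h) : ∃ B : ℝ, 0 ≤ B ∧ ∀ p, |h p| ≤ B := by
  obtain ⟨B, hB⟩ := hh.bounded_above_of_compact_support hc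
  exact ⟨|B|, abs_nonneg B, fun p => ((Real.norm_eq_abs _).symm.le.trans (hB p)).trans
    (le_abs_self B)⟩

theorem norm_add_sq_le_two (a b : ℂ) : ‖a + b‖ ^ 2 ≤ 2 * (‖a‖ ^ 2 + ‖b‖ ^ 2) := by
  have := pow_le_pow_left₀ (norm_nonneg _) (norm_add_le a b) 2
  nlinarith [sq_nonneg (‖a‖ - ‖b‖)]

theorem norm_sum_sq_le (a : Fin n → ℂ) : ‖∑ j, a j‖ ^ 2 ≤ n * ∑ j, ‖a j‖ ^ 2 := by
  have h1 := pow_le_pow_left₀ (norm_nonneg _) (norm_sum_le Finset.univ a) 2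
  have h2 := sq_sum_le_card_mul_sum_sq (s := Finset.univ) (f := fun j => ‖a j‖)
  simp only [Finset.card_univ, Fintype.card_fin] at h2
  exact h1.trans h2

theorem norm_real_smul_sq_le {r B : ℝ} (h : |r| ≤ B) (z : ℂ) :
    ‖r • z‖ ^ 2 ≤ B ^ 2 * ‖z‖ ^ 2 := by
  rw [norm_smul, mul_pow, Real.norm_eq_abs]
  gcongr

/-- The remainder `g` in the decomposition `y·∂ₓ(κu) = g + ∂_y·(κ ∂_y u)`. -/
theorem transport_cutoff (κ : Cutoff n) (u : Cc (R2n n)) (p : R2n n) :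
    (∑ j, p.2 j • pd (e j, 0) (κ.mulCc u u.smooth) p)
      - ∑ j, pd (0, e j) (κ.mulCc (pd (0, e j) u) (pd_smooth u.smooth _)) p
    = κ.toFun p • fokkerPlanckExpr V u p
      + (∑ j, (κ.toFun p * pd (e j) V p.1) • pd (0, e j) u p
      + ((-(κ.toFun p * (‖p.2‖ ^ 2 / 4 - n / 2)) + ∑ j, p.2 j * pd (e j, 0) κ.toFun p) • u p
      + ∑ j, (-pd (0, e j) κ.toFun p) • pd (0, e j) u p)) := by
  have dκ := κ.smooth.differentiable (by simp) p
  have du := u.smooth.differentiable (by simp) p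
  have h1 : ∀ w, pd w (κ.mulCc u u.smooth) p = pd w κ.toFun p • u p + κ.toFun p • pd w u p :=
    fun w => pd_real_smul_apply dκ du w
  have h2 : ∀ w, pd w (κ.mulCc (pd w u) (pd_smooth u.smooth _)) p
      = pd w κ.toFun p • pd w u p + κ.toFun p • pd w (pd w u) p :=
    fun w => pd_real_smul_apply dκ ((pd_smooth u.smooth w).differentiable (by simp) p) w
  simp only [h1, h2, fokkerPlanckExpr, Complex.real_smul]
  push_cast
  simp only [mul_add, mul_sub, add_mul, Finset.mul_sum, Finset.sum_mul, Finset.sum_add_distrib,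
    neg_mul, Finset.sum_neg_distrib]
  have e1 : ∀ j, ((p.2 j : ℝ) : ℂ) * (((κ.toFun p : ℝ) : ℂ) * pd (e j, 0) u p)
      = ((κ.toFun p : ℝ) : ℂ) * (((p.2 j : ℝ) : ℂ) * pd (e j, 0) u p) := fun j => by ring
  have e2 : ∀ j, ((p.2 j : ℝ) : ℂ) * (((pd (e j, 0) κ.toFun p : ℝ) : ℂ) * u p)
      = ((p.2 j : ℝ) : ℂ) * ((pd (e j, 0) κ.toFun p : ℝ) : ℂ) * u p := fun j => by ring
  have e3 : ∀ j, ((κ.toFun p : ℝ) : ℂ) * (((pd (e j) V p.1 : ℝ) : ℂ) * pd (0, e j) u p)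
      = ((κ.toFun p : ℝ) : ℂ) * ((pd (e j) V p.1 : ℝ) : ℂ) * pd (0, e j) u p := fun j => by ring
  simp only [e1, e2, e3]
  ring

theorem exists_cutoff_bound (hV : ContDiff ℝ 2 V) (κ : Cutoff n) :
    ∃ B : ℝ, 0 ≤ B ∧ ∀ p, |κ.toFun p| ≤ B ∧ (∀ j, |κ.toFun p * pd (e j) V p.1| ≤ B)
      ∧ |-(κ.toFun p * (‖p.2‖ ^ 2 / 4 - n / 2)) + ∑ j, p.2 j * pd (e j, 0) κ.toFun p| ≤ B
      ∧ ∀ j, |-pd (0, e j) κ.toFun p| ≤ B := by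
  have hκ := κ.smooth.continuous
  have hc := κ.compact
  have hdκ : ∀ w, Continuous (pd w κ.toFun) := fun w =>
    (pd_contDiff (m := 0) κ.smooth (by simp) w).continuous
  have hdc : ∀ w, HasCompactSupport (pd w κ.toFun) := fun w => hc.fderiv_apply ℝ w
  have hdV : ∀ w, Continuous (pd w V) := fun w => (contDiff_pd_potential hV w).continuous
  obtain ⟨B1, h1, hB1⟩ := exists_abs_le_of_hasCompactSupport hκ hc
  choose B2 h2 hB2 using fun j : Fin n => exists_abs_le_of_hasCompactSupport
    (h := fun p : R2n n => κ.toFun p * pd (e j) V p.1) (by fun_prop) hc.mul_right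
  obtain ⟨B3, h3, hB3⟩ := exists_abs_le_of_hasCompactSupport
    (h := fun p => -(κ.toFun p * (‖p.2‖ ^ 2 / 4 - n / 2)) + ∑ j, p.2 j * pd (e j, 0) κ.toFun p)
    (by fun_prop) (HasCompactSupport.intro hc fun p hp => by
      simp [image_eq_zero_of_notMem_tsupport hp, pd_eq_zero_of_notMem_tsupport hp])
  choose B4 h4 hB4 using fun j : Fin n => exists_abs_le_of_hasCompactSupport
    (h := fun p : R2n n => -pd (0, e j) κ.toFun p) (by fun_prop) (hdc _).neg
  have s2 : 0 ≤ ∑ j, B2 j := Finset.sum_nonneg fun j _ => h2 j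
  have s4 : 0 ≤ ∑ j, B4 j := Finset.sum_nonneg fun j _ => h4 j
  refine ⟨B1 + ∑ j, B2 j + B3 + ∑ j, B4 j, by positivity, fun p => ⟨?_, fun j => ?_, ?_,
    fun j => ?_⟩⟩
  · linarith [hB1 p]
  · have := Finset.single_le_sum (f := B2) (fun j _ => h2 j) (Finset.mem_univ j)
    linarith [hB2 j p]
  · linarith [hB3 p]
  · have := Finset.single_le_sum (f := B4) (fun j _ => h4 j) (Finset.mem_univ j)
    linarith [hB4 j p]

/-- Localized regularity: the graph norm of `P` controls positive powers of both frequencies of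
`κu`. -/
theorem exists_local_regularity (hV : ContDiff ℝ 2 V) (κ : Cutoff n) :
    ∃ K : ℝ, 0 ≤ K ∧ ∀ u : Cc (R2n n),
      Integrable (fun p : R2n n => ((1 + ‖p.1‖ ^ 2) ^ (1 / 3 : ℝ) + ‖p.2‖ ^ 2)
        * ‖FT (schw (κ.mulCc u u.smooth)) p‖ ^ 2) ∧
      ∫ p : R2n n, ((1 + ‖p.1‖ ^ 2) ^ (1 / 3 : ℝ) + ‖p.2‖ ^ 2)
        * ‖FT (schw (κ.mulCc u u.smooth)) p‖ ^ 2 ≤ K * graphSq V u := by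
  obtain ⟨B, hB0, hB⟩ := exists_cutoff_bound hV κ
  refine ⟨4 * (B ^ 2 * (9 + 21 * n)) * (n + 2), by positivity, fun u => ?_⟩
  obtain ⟨v, hv⟩ : ∃ v : Cc (R2n n), v = κ.mulCc u u.smooth := ⟨_, rfl⟩
  obtain ⟨k, hk⟩ : ∃ k : Fin n → Cc (R2n n),
    k = fun j => κ.mulCc (pd (0, e j) u) (pd_smooth u.smooth _) := ⟨_, rfl⟩
  let g : 𝓢(R2n n, ℂ) := ∑ j, smulLeftCLM ℂ (fun p : R2n n => p.2 j)
    (∂_{((e j, 0) : R2n n)} (schw v)) - ∑ j, ∂_{((0, e j) : R2n n)} (schw (k j))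
  have hg : ∀ p, g p = (∑ j, p.2 j • pd (e j, 0) v p) - ∑ j, pd (0, e j) (k j) p := fun p => by
    simp only [g, sub_apply, sum_apply,
      smulLeftCLM_apply_apply (hasTemperateGrowth_snd_apply _)]
    rfl
  obtain ⟨hi, hle⟩ := integral_rpow_mul_norm_FT_sq_le (schw v) g (fun j => schw (k j))
    (by simp only [g, sub_add_cancel])
  have hη : ∀ p : R2n n, ‖p.2‖ ^ 2 * ‖FT (schw v) p‖ ^ 2
      ≤ ∑ j, ‖FT (∂_{((0, e j) : R2n n)} (schw v)) p‖ ^ 2 := fun p => by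
    rw [norm_sq_eq_sum, Finset.sum_mul]
    refine Finset.sum_le_sum fun j _ => ?_
    rw [norm_FT_lineDeriv_sq]
    have : 1 ≤ (2 * π) ^ 2 := by nlinarith [Real.pi_gt_three]
    nlinarith [mul_nonneg (sq_nonneg (p.2 j)) (sq_nonneg ‖FT (schw v) p‖)]
  have hηi : Integrable (fun p : R2n n => ∑ j, ‖FT (∂_{((0, e j) : R2n n)} (schw v)) p‖ ^ 2) :=
    integrable_finsetSum _ fun j _ => integrable_norm_sq_schwartz _
  have hηi' : Integrable (fun p : R2n n => ‖p.2‖ ^ 2 * ‖FT (schw v) p‖ ^ 2) := by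
    refine hηi.mono' ?_ (Filter.Eventually.of_forall fun p => ?_)
    · have := (FT (schw v)).continuous
      exact Continuous.aestronglyMeasurable (by fun_prop)
    · rw [Real.norm_of_nonneg (by positivity)]
      exact hη p
  have hηle : ∫ p : R2n n, ‖p.2‖ ^ 2 * ‖FT (schw v) p‖ ^ 2
      ≤ ∫ p, ∑ j, ‖pd (0, e j) v p‖ ^ 2 := by
    refine (integral_mono hηi' hηi hη).trans_eq ?_
    rw [integral_finsetSum _ fun j _ => integrable_norm_sq_schwartz _]
    refine Eq.trans ?_ (integral_finsetSum _ fun j _ =>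
      integrable_norm_sq_schwartz (∂_{((0, e j) : R2n n)} (schw v))).symm
    exact Finset.sum_congr rfl fun j _ => integral_norm_sq_FT _
  rw [← hv]
  simp only [add_mul]
  refine ⟨hi.add hηi', ?_⟩
  rw [integral_add hi hηi']
  have hDi : ∀ j, Integrable (fun p => ‖pd (0, e j) v p‖ ^ 2) := fun j =>
    integrable_norm_sq_schwartz (∂_{((0, e j) : R2n n)} (schw v))
  have hQi : Integrable (fun p => ‖v p‖ ^ 2 + ‖g p‖ ^ 2
      + ∑ j, (‖pd (0, e j) v p‖ ^ 2 + ‖k j p‖ ^ 2)) :=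
    ((integrable_norm_sq_schwartz (schw v)).add (integrable_norm_sq_schwartz g)).add
      (integrable_finsetSum _ fun j _ => (hDi j).add (integrable_norm_sq_schwartz (schw (k j))))
  have hpt : ∀ p, ‖v p‖ ^ 2 + ‖g p‖ ^ 2 + ∑ j, (‖pd (0, e j) v p‖ ^ 2 + ‖k j p‖ ^ 2)
      ≤ (B ^ 2 * (9 + 21 * n)) * ((‖fokkerPlanckExpr V u p‖ ^ 2 + ‖u p‖ ^ 2) + dissip u p) := by
    intro p
    obtain ⟨b1, b2, b3, b4⟩ := hB p
    have hS : 0 ≤ ∑ j, ‖pd (0, e j) u p‖ ^ 2 := Finset.sum_nonneg fun _ _ => by positivity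
    have hSd : ∑ j, ‖pd (0, e j) u p‖ ^ 2 ≤ dissip u p := by
      unfold dissip
      have : 0 ≤ ‖p.2‖ ^ 2 / 4 * ‖u p‖ ^ 2 := by positivity
      linarith
    have hn : (0 : ℝ) ≤ n := n.cast_nonneg
    have c1 : ‖v p‖ ^ 2 ≤ B ^ 2 * ‖u p‖ ^ 2 := by
      rw [hv, Cutoff.mulCc_apply]; exact norm_real_smul_sq_le b1 _
    have c2 : ∀ j, ‖k j p‖ ^ 2 ≤ B ^ 2 * ‖pd (0, e j) u p‖ ^ 2 := fun j => by
      rw [hk, Cutoff.mulCc_apply]; exact norm_real_smul_sq_le b1 _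
    have c3 : ∀ j, ‖pd (0, e j) v p‖ ^ 2
        ≤ 2 * (B ^ 2 * ‖u p‖ ^ 2 + B ^ 2 * ‖pd (0, e j) u p‖ ^ 2) := fun j => by
      have : pd (0, e j) v p = pd (0, e j) κ.toFun p • u p + κ.toFun p • pd (0, e j) u p := by
        rw [hv]
        exact pd_real_smul_apply (κ.smooth.differentiable (by simp) p)
          (u.smooth.differentiable (by simp) p) _
      rw [this]
      refine (norm_add_sq_le_two _ _).trans ?_
      have := norm_real_smul_sq_le (by simpa using b4 j) (u p)
      have := norm_real_smul_sq_le b1 (pd (0, e j) u p)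
      linarith
    have c4 : ‖g p‖ ^ 2 ≤ 2 * B ^ 2 * ‖fokkerPlanckExpr V u p‖ ^ 2
        + 12 * n * (B ^ 2 * ∑ j, ‖pd (0, e j) u p‖ ^ 2) + 8 * B ^ 2 * ‖u p‖ ^ 2 := by
      have hgp := hg p
      rw [hv, hk, transport_cutoff (V := V)] at hgp
      rw [hgp]
      have f1 := norm_real_smul_sq_le b1 (fokkerPlanckExpr V u p)
      have f2 := norm_sum_sq_le fun j => (κ.toFun p * pd (e j) V p.1) • pd (0, e j) u p
      have f2' : ∑ j, ‖(κ.toFun p * pd (e j) V p.1) • pd (0, e j) u p‖ ^ 2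
          ≤ B ^ 2 * ∑ j, ‖pd (0, e j) u p‖ ^ 2 := by
        rw [Finset.mul_sum]
        exact Finset.sum_le_sum fun j _ => norm_real_smul_sq_le (b2 j) _
      have f3 := norm_real_smul_sq_le b3 (u p)
      have f4 := norm_sum_sq_le fun j => (-pd (0, e j) κ.toFun p) • pd (0, e j) u p
      have f4' : ∑ j, ‖(-pd (0, e j) κ.toFun p) • pd (0, e j) u p‖ ^ 2
          ≤ B ^ 2 * ∑ j, ‖pd (0, e j) u p‖ ^ 2 := by
        rw [Finset.mul_sum]
        exact Finset.sum_le_sum fun j _ => norm_real_smul_sq_le (b4 j) _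
      have f2'' := f2.trans (mul_le_mul_of_nonneg_left f2' hn)
      have f4'' := f4.trans (mul_le_mul_of_nonneg_left f4' hn)
      refine (norm_add_sq_le_two _ _).trans ?_
      have g1 := norm_add_sq_le_two (∑ j, (κ.toFun p * pd (e j) V p.1) • pd (0, e j) u p)
        ((-(κ.toFun p * (‖p.2‖ ^ 2 / 4 - n / 2)) + ∑ j, p.2 j * pd (e j, 0) κ.toFun p) • u p
          + ∑ j, (-pd (0, e j) κ.toFun p) • pd (0, e j) u p)
      have g2 := norm_add_sq_le_two
        ((-(κ.toFun p * (‖p.2‖ ^ 2 / 4 - n / 2)) + ∑ j, p.2 j * pd (e j, 0) κ.toFun p) • u p)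
        (∑ j, (-pd (0, e j) κ.toFun p) • pd (0, e j) u p)
      linarith
    have c5 : ∑ j, (‖pd (0, e j) v p‖ ^ 2 + ‖k j p‖ ^ 2)
        ≤ 2 * n * (B ^ 2 * ‖u p‖ ^ 2) + 3 * (B ^ 2 * ∑ j, ‖pd (0, e j) u p‖ ^ 2) := by
      calc _ ≤ ∑ j, (2 * (B ^ 2 * ‖u p‖ ^ 2) + 3 * (B ^ 2 * ‖pd (0, e j) u p‖ ^ 2)) :=
            Finset.sum_le_sum fun j _ => by linarith [c2 j, c3 j]
        _ = _ := by
            simp only [Finset.sum_add_distrib, ← Finset.mul_sum, Finset.sum_const,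
              Finset.card_univ, Fintype.card_fin, nsmul_eq_mul]
            ring
    set S := ∑ j, ‖pd (0, e j) u p‖ ^ 2
    have hBS : 0 ≤ B ^ 2 * S := by positivity
    have hBu : 0 ≤ B ^ 2 * ‖u p‖ ^ 2 := by positivity
    have hBP : 0 ≤ B ^ 2 * ‖fokkerPlanckExpr V u p‖ ^ 2 := by positivity
    have hfin : B ^ 2 * (9 + 21 * n) * ((‖fokkerPlanckExpr V u p‖ ^ 2 + ‖u p‖ ^ 2) + S)
        ≤ B ^ 2 * (9 + 21 * n) * ((‖fokkerPlanckExpr V u p‖ ^ 2 + ‖u p‖ ^ 2) + dissip u p) := by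
      gcongr
    refine le_trans ?_ hfin
    nlinarith [mul_nonneg hn hBS, mul_nonneg hn hBu, mul_nonneg hn hBP]
  have hQle : ∫ p, (‖v p‖ ^ 2 + ‖g p‖ ^ 2 + ∑ j, (‖pd (0, e j) v p‖ ^ 2 + ‖k j p‖ ^ 2))
      ≤ (B ^ 2 * (9 + 21 * n)) * ((n + 2) * graphSq V u) := by
    have i1 := integrable_graphSq hV u
    have i2 := integrable_dissip u
    refine (integral_mono hQi ((i1.add i2).const_mul _) hpt).trans ?_
    rw [integral_const_mul]
    gcongr
    refine (integral_add i1 i2).le.trans ?_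
    have := integral_dissip_le hV u
    change graphSq V u + _ ≤ _
    linarith
  have hDle : ∫ p, ∑ j, ‖pd (0, e j) v p‖ ^ 2
      ≤ ∫ p, (‖v p‖ ^ 2 + ‖g p‖ ^ 2 + ∑ j, (‖pd (0, e j) v p‖ ^ 2 + ‖k j p‖ ^ 2)) := by
    refine integral_mono (integrable_finsetSum _ fun j _ => hDi j) hQi fun p => ?_
    simp only [Finset.sum_add_distrib]
    have : 0 ≤ ∑ j, ‖k j p‖ ^ 2 := Finset.sum_nonneg fun _ _ => by positivity
    nlinarith [sq_nonneg ‖v p‖, sq_nonneg ‖g p‖]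
  simp only [schw_apply, coe_schw] at hle
  linarith

end localization

end

section

variable {n : ℕ} {V : Rn n → ℝ}

section frequency

open scoped SchwartzMap FourierTransform ComplexConjugate InnerProductSpace
open SchwartzMap Real

theorem norm_fourierChar_sub_le (a b : ℝ) :
    ‖(Real.fourierChar a : ℂ) - Real.fourierChar b‖ ≤ 2 * π * |a - b| := by
  have h : (Real.fourierChar a : ℂ) - Real.fourierChar b
      = Real.fourierChar b * (Complex.exp (Complex.I * ((2 * π * (a - b) : ℝ) : ℂ)) - 1) := by
    rw [mul_sub, mul_one, Real.fourierChar_apply, Real.fourierChar_apply, ← Complex.exp_add]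
    congr 2
    push_cast
    ring
  rw [h, norm_mul, Circle.norm_coe, one_mul]
  refine norm_exp_I_mul_ofReal_sub_one_le.trans_eq ?_
  rw [Real.norm_eq_abs, abs_mul, abs_of_pos (by positivity)]

/-- The function `q ↦ exp (2πi⟨q, p⟩) κ q`. -/
def wave (κ : Cutoff n) (p q : R2n n) : ℂ :=
  κ.toFun q • (Real.fourierChar (inner ℝ q.1 p.1 + inner ℝ q.2 p.2) : ℂ)

theorem memLp_wave (κ : Cutoff n) (p : R2n n) : MemLp (wave κ p) 2 (volume : Measure (R2n n)) := by
  have h1 := κ.smooth.continuous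
  refine Continuous.memLp_of_hasCompactSupport ?_ κ.compact.smul_right
  unfold wave
  fun_prop

theorem FT_cutoff_eq_inner (κ : Cutoff n) (u : Cc (R2n n)) (p : R2n n) :
    FT (schw (κ.mulCc u u.smooth)) p = ⟪(memLp_wave κ p).toLp (wave κ p), embed (R2n n) u⟫_ℂ := by
  rw [FT_apply_eq_integral]
  refine Eq.trans ?_ (inner_toLp_toLp (memLp_wave κ p) (isTestOperator_id.memLp u)).symm
  refine integral_congr_ae (Filter.Eventually.of_forall fun q => ?_)
  simp only [schw_apply, Cutoff.mulCc_apply, wave, Complex.real_smul, map_mul, Complex.conj_ofReal,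
    AddChar.map_neg_eq_inv, Circle.smul_def, Circle.coe_inv_eq_conj, smul_eq_mul]
  ring

theorem continuous_wave (κ : Cutoff n) :
    Continuous fun p => (memLp_wave κ p).toLp (wave κ p) := by
  have h1 := κ.smooth.continuous
  set D : ℝ := ∫ q, (2 * π * (‖q.1‖ + ‖q.2‖) * κ.toFun q) ^ 2
  have hD : 0 ≤ D := integral_nonneg fun _ => sq_nonneg _
  have hi : Integrable (fun q : R2n n => (2 * π * (‖q.1‖ + ‖q.2‖) * κ.toFun q) ^ 2) := by
    refine Continuous.integrable_of_hasCompactSupport (by fun_prop) ?_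
    exact HasCompactSupport.intro κ.compact fun q hq => by
      simp [image_eq_zero_of_notMem_tsupport hq]
  refine (LipschitzWith.of_dist_le_mul (K := (√D).toNNReal) fun p p' => ?_).continuous
  rw [dist_eq_norm, ← MemLp.toLp_sub]
  refine (pow_le_pow_iff_left₀ (norm_nonneg _) (by positivity) two_ne_zero).1 ?_
  rw [norm_toLp_sq, mul_pow, Real.coe_toNNReal _ (Real.sqrt_nonneg D), Real.sq_sqrt hD,
    ← integral_mul_const]
  refine integral_mono_of_nonneg (Filter.Eventually.of_forall fun _ => sq_nonneg _)
    (hi.mul_const _) (Filter.Eventually.of_forall fun q => ?_)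
  simp only [Pi.sub_apply, wave]
  rw [← smul_sub, norm_smul, ← mul_pow, Real.norm_eq_abs]
  have h2 := norm_fourierChar_sub_le (inner ℝ q.1 p.1 + inner ℝ q.2 p.2)
    (inner ℝ q.1 p'.1 + inner ℝ q.2 p'.2)
  have h3 : |inner ℝ q.1 p.1 + inner ℝ q.2 p.2 - (inner ℝ q.1 p'.1 + inner ℝ q.2 p'.2)|
      ≤ (‖q.1‖ + ‖q.2‖) * dist p p' := by
    have : inner ℝ q.1 p.1 + inner ℝ q.2 p.2 - (inner ℝ q.1 p'.1 + inner ℝ q.2 p'.2)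
      = inner ℝ q.1 (p - p').1 + inner ℝ q.2 (p - p').2 := by
      simp only [Prod.fst_sub, Prod.snd_sub, inner_sub_right]; ring
    rw [this, dist_eq_norm, add_mul]
    refine (abs_add_le _ _).trans (add_le_add ?_ ?_)
    · exact (abs_real_inner_le_norm _ _).trans (by gcongr; exact norm_fst_le _)
    · exact (abs_real_inner_le_norm _ _).trans (by gcongr; exact norm_snd_le _)
  rw [← sq_abs (_ * _ * dist _ _), abs_mul, abs_mul, abs_of_nonneg (dist_nonneg (x := p)),
    abs_of_nonneg (a := 2 * π * (‖q.1‖ + ‖q.2‖)) (by positivity)]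
  refine pow_le_pow_left₀ (by positivity) ?_ 2
  calc _ ≤ |κ.toFun q| * (2 * π * ((‖q.1‖ + ‖q.2‖) * dist p p')) := by
        gcongr; exact h2.trans (by gcongr)
    _ = _ := by ring

/-- The low frequencies of `κu` are controlled by finitely many linear functionals of `u`. -/
theorem exists_low_frequency (κ : Cutoff n) (ρ : ℝ) {δ : ℝ} (hδ : 0 < δ) :
    ∃ (N : ℕ) (ℓ : Fin N → L2 (R2n n) →L[ℂ] ℂ), ∀ u : Cc (R2n n),
      ∫ p in Metric.closedBall 0 ρ, ‖FT (schw (κ.mulCc u u.smooth)) p‖ ^ 2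
        ≤ δ * (∫ p, ‖u p‖ ^ 2) + ∑ i, ‖ℓ i (embed (R2n n) u)‖ ^ 2 := by
  set m : ℝ := (volume : Measure (R2n n)).real (Metric.closedBall 0 ρ)
  have hm : 0 ≤ m := measureReal_nonneg
  set d : ℝ := √(δ / (2 * (m + 1)))
  have hd : 0 < d := Real.sqrt_pos.2 (by positivity)
  have hd2 : 2 * d ^ 2 * m ≤ δ := by
    rw [Real.sq_sqrt (by positivity)]
    have : 2 * (δ / (2 * (m + 1))) * m = δ * (m / (m + 1)) := by field_simp
    rw [this]
    exact mul_le_of_le_one_right hδ.le ((div_le_one (by positivity)).2 (by linarith))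
  have hK := ((isCompact_closedBall (0 : R2n n) ρ).image (continuous_wave κ)).totallyBounded
  obtain ⟨t, ht, hcov⟩ := Metric.totallyBounded_iff.1 hK d hd
  obtain ⟨N, a, ha⟩ : ∃ (N : ℕ) (a : Fin N → L2 (R2n n)), t = Set.range a := by
    obtain ⟨N, ⟨g⟩⟩ := (ht.to_subtype).exists_equiv_fin t
    exact ⟨N, fun i => g.symm i, by
      ext x; constructor
      · intro hx; exact ⟨g ⟨x, hx⟩, by simp⟩
      · rintro ⟨i, rfl⟩; exact (g.symm i).2⟩
  refine ⟨N, fun i => ((√(2 * m) : ℝ) : ℂ) • innerSL ℂ (a i), fun u => ?_⟩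
  have hpt : ∀ p ∈ Metric.closedBall (0 : R2n n) ρ, ‖FT (schw (κ.mulCc u u.smooth)) p‖ ^ 2
      ≤ 2 * d ^ 2 * (∫ p, ‖u p‖ ^ 2) + 2 * ∑ i, ‖⟪a i, embed (R2n n) u⟫_ℂ‖ ^ 2 := by
    intro p hp
    obtain ⟨y, hy, hpy⟩ := Set.mem_iUnion₂.1 (hcov (Set.mem_image_of_mem _ hp))
    rw [ha] at hy
    obtain ⟨i, rfl⟩ := hy
    rw [FT_cutoff_eq_inner, ← sub_add_cancel ((memLp_wave κ p).toLp (wave κ p)) (a i),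
      inner_add_left]
    refine (norm_add_sq_le_two _ _).trans ?_
    rw [mul_add, mul_assoc, ← norm_embed_sq, ← mul_pow]
    gcongr 2 * ?_ + 2 * ?_
    · refine pow_le_pow_left₀ (norm_nonneg _) ((norm_inner_le_norm _ _).trans ?_) 2
      gcongr
      rw [← dist_eq_norm]
      exact (Metric.mem_ball.1 hpy).le
    · exact Finset.single_le_sum (f := fun i => ‖⟪a i, embed (R2n n) u⟫_ℂ‖ ^ 2)
        (fun _ _ => sq_nonneg _) (Finset.mem_univ i)
  have hu : 0 ≤ ∫ p, ‖u p‖ ^ 2 := integral_nonneg fun _ => sq_nonneg _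
  have h1 := setIntegral_mono_on (μ := volume) (s := Metric.closedBall (0 : R2n n) ρ)
    (integrable_norm_sq_schwartz (FT (schw (κ.mulCc u u.smooth)))).integrableOn
    (integrableOn_const (isCompact_closedBall (0 : R2n n) ρ).measure_lt_top.ne)
    Metric.isClosed_closedBall.measurableSet hpt
  refine h1.trans ?_
  rw [setIntegral_const, smul_eq_mul]
  have h2 : ∀ i, ‖(((√(2 * m) : ℝ) : ℂ) • innerSL ℂ (a i)) (embed (R2n n) u)‖ ^ 2
      = 2 * m * ‖⟪a i, embed (R2n n) u⟫_ℂ‖ ^ 2 := fun i => by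
    rw [smul_apply, norm_smul, mul_pow, Complex.norm_real, Real.norm_eq_abs,
      sq_abs, Real.sq_sqrt (by positivity), innerSL_apply_apply]
  simp only [h2, ← Finset.mul_sum]
  have := mul_le_mul_of_nonneg_right hd2 hu
  change m * _ ≤ _
  linarith

theorem le_frequency_weight {L : ℝ} (hL : 1 ≤ L) {p : R2n n}
    (hp : p ∉ Metric.closedBall 0 (L ^ 2)) :
    L ≤ (1 + ‖p.1‖ ^ 2) ^ (1 / 3 : ℝ) + ‖p.2‖ ^ 2 := by
  rw [mem_closedBall_zero_iff, not_le, Prod.norm_def, lt_max_iff] at hp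
  have hw : 0 ≤ (1 + ‖p.1‖ ^ 2) ^ (1 / 3 : ℝ) := by positivity
  have hL3 : L ≤ (L ^ 2) ^ 2 := by
    rw [← pow_mul]; exact le_self_pow₀ hL (by norm_num)
  rcases hp with hp | hp
  · have h1 : L ^ 3 ≤ 1 + ‖p.1‖ ^ 2 := by
      have h2 : L ^ 3 ≤ (L ^ 2) ^ 2 := by rw [← pow_mul]; exact pow_le_pow_right₀ hL (by norm_num)
      have h3 := pow_le_pow_left₀ (by positivity) hp.le 2
      linarith
    have h4 : L = (L ^ 3) ^ (1 / 3 : ℝ) := by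
      rw [← Real.rpow_natCast, ← Real.rpow_mul (by positivity)]; norm_num
    have h5 := Real.rpow_le_rpow (by positivity) h1 (by norm_num : (0 : ℝ) ≤ 1 / 3)
    rw [← h4] at h5
    nlinarith [sq_nonneg ‖p.2‖]
  · have h3 := pow_le_pow_left₀ (by positivity) hp.le 2
    linarith

end frequency

theorem exists_cutoff (hb : ∀ M, Bornology.IsBounded {x | Phi V x ≤ M}) {M : ℝ} (hM : 0 < M) :
    ∃ κ : Cutoff n, ∀ p, (1 - κ.toFun p) ^ 2 * M ≤ Phi V p.1 ^ (1 / 3 : ℝ) + ‖p.2‖ ^ 2 := by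
  obtain ⟨R, hR⟩ := (hb (M ^ 3)).exists_norm_le
  set r : ℝ := max 1 (max R (M + 1)) with hr
  have hr0 : 0 < r := lt_max_of_lt_left one_pos
  let f : ContDiffBump (0 : R2n n) := ⟨r, r + 1, hr0, by linarith⟩
  refine ⟨⟨f, f.contDiff, f.hasCompactSupport⟩, fun p => ?_⟩
  change (1 - f p) ^ 2 * M ≤ _
  have hw : 0 ≤ Phi V p.1 ^ (1 / 3 : ℝ) := Real.rpow_nonneg (Phi_pos V _).le _
  by_cases hp : p ∈ Metric.closedBall 0 r
  · rw [f.one_of_mem_closedBall hp, sub_self]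
    norm_num
    positivity
  · have h01 : (1 - f p) ^ 2 ≤ 1 := by
      have h1 := f.nonneg (x := p)
      have h2 := f.le_one (x := p)
      nlinarith
    refine (mul_le_mul_of_nonneg_right h01 hM.le).trans ?_
    rw [one_mul]
    rw [mem_closedBall_zero_iff, not_le, Prod.norm_def, lt_max_iff] at hp
    rcases hp with hp | hp
    · have h1 : M ^ 3 ≤ Phi V p.1 := by
        by_contra! h
        exact absurd (hR p.1 h.le)
          (not_le.2 (((le_max_left _ _).trans (le_max_right _ _)).trans_lt hp))
      have h4 : M = (M ^ 3) ^ (1 / 3 : ℝ) := by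
        rw [← Real.rpow_natCast, ← Real.rpow_mul hM.le]; norm_num
      have h5 := Real.rpow_le_rpow (by positivity) h1 (by norm_num : (0 : ℝ) ≤ 1 / 3)
      rw [← h4] at h5
      nlinarith [sq_nonneg ‖p.2‖]
    · have h6 : M + 1 < ‖p.2‖ := ((le_max_right _ _).trans (le_max_right _ _)).trans_lt hp
      nlinarith

theorem integral_norm_sq_le_graphSq (hV : ContDiff ℝ 2 V) (u : Cc (R2n n)) :
    ∫ p, ‖u p‖ ^ 2 ≤ graphSq V u :=
  integral_mono (integrable_norm_sq u) (integrable_graphSq hV u) fun p => by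
    simp

/-- The graph norm of `P` is compact relative to the `L²` norm. -/
theorem exists_compactness_estimate (hV : ContDiff ℝ 2 V) {C : ℝ} (hC : HessBound V C)
    (hb : ∀ M, Bornology.IsBounded {x | Phi V x ≤ M}) {ε : ℝ} (hε : 0 < ε) :
    ∃ (N : ℕ) (ℓ : Fin N → L2 (R2n n) →L[ℂ] ℂ), ∀ u : Cc (R2n n),
      ∫ p, ‖u p‖ ^ 2 ≤ ε * graphSq V u + ∑ i, ‖ℓ i (embed (R2n n) u)‖ ^ 2 := by
  obtain ⟨K, hK0, hK⟩ := exists_weighted_estimate hV hC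
  set M : ℝ := 6 * (K + 4 * (n + 1)) / ε with hMdef
  have hM : 0 < M := by positivity
  obtain ⟨κ, hκ⟩ := exists_cutoff hb hM
  obtain ⟨K', hK0', hK'⟩ := exists_local_regularity hV κ
  set L : ℝ := 1 + 6 * K' / ε with hLdef
  have hL : 1 ≤ L := by have : 0 ≤ 6 * K' / ε := by positivity
                        linarith
  have hL0 : 0 < L := one_pos.trans_le hL
  obtain ⟨N, ℓ, hℓ⟩ := exists_low_frequency κ (L ^ 2) (δ := ε / 6) (by positivity)
  refine ⟨N, fun i => ((√2 : ℝ) : ℂ) • ℓ i, fun u => ?_⟩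
  obtain ⟨hi, hle⟩ := hK' u
  set v : Cc (R2n n) := κ.mulCc u u.smooth with hv
  have hG := graphSq_nonneg V u
  have hκc := κ.smooth.continuous
  have huc := u.continuous
  have hPc : Continuous (Phi V) := (contDiff_Phi hV).continuous
  have i1 : Integrable (fun p => (1 - κ.toFun p) ^ 2 * ‖u p‖ ^ 2) :=
    u.integrable_of_eq_zero (by fun_prop) fun p hp => by
      simp [image_eq_zero_of_notMem_tsupport hp]
  have i2 : Integrable (fun p => ‖v p‖ ^ 2) := integrable_norm_sq v
  have i3 : Integrable (fun p => Phi V p.1 ^ (1 / 3 : ℝ) * ‖u p‖ ^ 2) :=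
    u.integrable_of_eq_zero (((hPc.comp continuous_fst).rpow_const fun p =>
      Or.inl (Phi_pos V _).ne').mul (by fun_prop)) fun p hp => by
      simp [image_eq_zero_of_notMem_tsupport hp]
  have i4 : Integrable (fun p => 4 * dissip u p) := (integrable_dissip u).const_mul 4
  have h1 : ∫ p, ‖u p‖ ^ 2
      ≤ 2 * (∫ p, (1 - κ.toFun p) ^ 2 * ‖u p‖ ^ 2) + 2 * ∫ p, ‖v p‖ ^ 2 := by
    rw [← integral_const_mul, ← integral_const_mul,
      ← integral_add (i1.const_mul 2) (i2.const_mul 2)]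
    refine integral_mono (integrable_norm_sq u) ((i1.const_mul 2).add (i2.const_mul 2)) fun p => ?_
    have : ‖v p‖ ^ 2 = κ.toFun p ^ 2 * ‖u p‖ ^ 2 := by
      rw [hv, Cutoff.mulCc_apply, norm_smul, mul_pow, Real.norm_eq_abs, sq_abs]
    simp only [this]
    nlinarith [mul_nonneg (sq_nonneg (2 * κ.toFun p - 1)) (sq_nonneg ‖u p‖)]
  have h2 : (∫ p, (1 - κ.toFun p) ^ 2 * ‖u p‖ ^ 2) * M ≤ (K + 4 * (n + 1)) * graphSq V u := by
    rw [← integral_mul_const]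
    have : ∫ p, (1 - κ.toFun p) ^ 2 * ‖u p‖ ^ 2 * M
        ≤ ∫ p, (Phi V p.1 ^ (1 / 3 : ℝ) * ‖u p‖ ^ 2 + 4 * dissip u p) := by
      refine integral_mono (i1.mul_const M) (i3.add i4) fun p => ?_
      have hd : ‖p.2‖ ^ 2 * ‖u p‖ ^ 2 ≤ 4 * dissip u p := by
        have : 0 ≤ ∑ j, ‖pd (0, e j) u p‖ ^ 2 := Finset.sum_nonneg fun _ _ => by positivity
        unfold dissip
        linarith
      have := mul_le_mul_of_nonneg_right (hκ p) (sq_nonneg ‖u p‖)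
      beta_reduce
      linarith
    rw [integral_add i3 i4, integral_const_mul] at this
    have h3 := hK u
    have h4 := integral_dissip_le hV u
    linarith
  have h3 : ∫ p, (1 - κ.toFun p) ^ 2 * ‖u p‖ ^ 2 ≤ ε / 6 * graphSq V u := by
    have : (∫ p, (1 - κ.toFun p) ^ 2 * ‖u p‖ ^ 2) * M ≤ (ε / 6 * graphSq V u) * M := by
      refine h2.trans_eq ?_
      rw [hMdef]
      field_simp
    exact le_of_mul_le_mul_right this hM
  have iF := integrable_norm_sq_schwartz (FT (schw v))
  have hmeas : MeasurableSet (Metric.closedBall (0 : R2n n) (L ^ 2)) :=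
    Metric.isClosed_closedBall.measurableSet
  have h4 : ∫ p, ‖v p‖ ^ 2 = (∫ p in Metric.closedBall 0 (L ^ 2), ‖FT (schw v) p‖ ^ 2)
      + ∫ p in (Metric.closedBall 0 (L ^ 2))ᶜ, ‖FT (schw v) p‖ ^ 2 := by
    rw [integral_add_compl hmeas iF, integral_norm_sq_FT]
    rfl
  have h5 : L * ∫ p in (Metric.closedBall 0 (L ^ 2))ᶜ, ‖FT (schw v) p‖ ^ 2 ≤ K' * graphSq V u := by
    refine le_trans ?_ hle
    rw [← integral_const_mul]
    refine (setIntegral_mono_on (iF.const_mul L).integrableOn hi.integrableOn hmeas.compl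
      fun p hp => ?_).trans (setIntegral_le_integral hi (Filter.Eventually.of_forall fun p => ?_))
    · exact mul_le_mul_of_nonneg_right (le_frequency_weight hL hp) (sq_nonneg _)
    · change 0 ≤ _
      positivity
  have h6 : ∫ p in (Metric.closedBall 0 (L ^ 2))ᶜ, ‖FT (schw v) p‖ ^ 2 ≤ ε / 6 * graphSq V u := by
    refine le_of_mul_le_mul_left (h5.trans ?_) hL0
    have : K' ≤ L * (ε / 6) := by
      rw [hLdef, add_mul]
      have : 6 * K' / ε * (ε / 6) = K' := by field_simp
      linarith
    rw [← mul_assoc]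
    exact mul_le_mul_of_nonneg_right this hG
  have h7 := hℓ u
  have h8 := mul_le_mul_of_nonneg_left (integral_norm_sq_le_graphSq hV u)
    (by positivity : (0 : ℝ) ≤ ε / 6)
  have h9 : ∀ i, ‖(((√2 : ℝ) : ℂ) • ℓ i) (embed (R2n n) u)‖ ^ 2
      = 2 * ‖ℓ i (embed (R2n n) u)‖ ^ 2 := fun i => by
    rw [smul_apply, norm_smul, mul_pow, Complex.norm_real, Real.norm_eq_abs, sq_abs,
      Real.sq_sqrt (by positivity)]
  simp only [h9, ← Finset.mul_sum]
  linarith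

end

section

variable {n : ℕ} {V : Rn n → ℝ}

/-- The square of a cutoff. -/
def Cutoff.sq (χ : Cutoff n) : Cutoff n where
  toFun p := χ.toFun p ^ 2
  smooth := χ.smooth.pow 2
  compact := HasCompactSupport.intro χ.compact fun p hp => by
    simp [image_eq_zero_of_notMem_tsupport hp]

theorem Cutoff.pd_sq (χ : Cutoff n) (v p : R2n n) :
    pd v χ.sq.toFun p = 2 * χ.toFun p * pd v χ.toFun p := by
  have d := χ.smooth.differentiable (by simp) p
  have : χ.sq.toFun = fun p => χ.toFun p * χ.toFun p := funext fun p => pow_two _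
  rw [this, pd_mul_apply d d]
  ring

/-- The energy identity for a localized solution of the adjoint equation. -/
theorem cutoff_energy_identity (hV : ContDiff ℝ 2 V) (χ : Cutoff n) {w : R2n n → ℂ}
    (hw : ContDiff ℝ ∞ w) :
    ∫ p, inner ℝ (w p) (fokkerPlanckExpr V (χ.sq.mulCc w hw) p)
      = ∫ p, (∑ j, ‖pd (0, e j) (χ.mulCc w hw) p‖ ^ 2
        + (‖p.2‖ ^ 2 / 4 - n / 2) * ‖χ.mulCc w hw p‖ ^ 2
        + ‖w p‖ ^ 2 * (χ.toFun p * transport V χ.toFun p - ∑ j, pd (0, e j) χ.toFun p ^ 2)) := by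
  obtain ⟨h, hh⟩ : ∃ h : Cc (R2n n), h = χ.sq.mulCc w hw := ⟨_, rfl⟩
  obtain ⟨m, hm⟩ : ∃ m : Cutoff n, m = χ.sq := ⟨_, rfl⟩
  have hw1 : ContDiff ℝ 1 w := hw.of_le (by simp)
  have hm1 : ContDiff ℝ 1 m.toFun := m.smooth.of_le (by simp)
  have hdh : ∀ v, ContDiff ℝ 1 (pd v (h : R2n n → ℂ)) := fun v =>
    (pd_smooth h.smooth v).of_le (by simp)
  obtain ⟨N, hNdef⟩ : ∃ N : R2n n → ℝ, N = fun p => inner ℝ (w p) (w p) := ⟨_, rfl⟩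
  have hN : ContDiff ℝ 1 N := by rw [hNdef]; exact hw1.inner ℝ hw1
  obtain ⟨ρ, hρdef⟩ : ∃ ρ : Fin n → R2n n → ℝ,
      ρ = fun j p => inner ℝ (w p) (pd (0, e j) h p) := ⟨_, rfl⟩
  have hρ : ∀ j, ContDiff ℝ 1 (ρ j) := fun j => by rw [hρdef]; exact hw1.inner ℝ (hdh _)
  have hρc : ∀ j, HasCompactSupport (ρ j) := fun j =>
    HasCompactSupport.intro h.hasCompactSupport fun p hp => by
      simp [hρdef, pd_eq_zero_of_notMem_tsupport hp]
  have hVp : ∀ j, ContDiff ℝ 1 (fun p : R2n n => pd (e j) V p.1) := fun j =>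
    (contDiff_pd_potential hV (e j)).comp contDiff_fst
  have hy : ∀ j, ContDiff ℝ 1 (fun p : R2n n => p.2 j) := fun j =>
    (contDiff_snd_apply j).of_le (by simp)
  have hmN : ContDiff ℝ 1 (fun p => m.toFun p * N p) := hm1.mul hN
  have hmNc : HasCompactSupport (fun p => m.toFun p * N p) := m.compact.mul_right
  obtain ⟨hdi, hd0⟩ := integral_divergence_eq_zero
    (fun j p => 1 / 2 * (p.2 j * (m.toFun p * N p)))
    (fun j p => -1 / 2 * (pd (e j) V p.1 * (m.toFun p * N p)) + -1 * ρ j p)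
    (fun j => contDiff_const.mul ((hy j).mul hmN))
    (fun j => (contDiff_const.mul ((hVp j).mul hmN)).add (contDiff_const.mul (hρ j)))
    (fun j => hmNc.mul_left.mul_left)
    (fun j => hmNc.mul_left.mul_left.add (hρc j).mul_left)
  rw [← hh]
  have hF1 : Integrable (fun p => inner ℝ (w p) (fokkerPlanckExpr V h p)) :=
    h.integrable_of_eq_zero (hw.continuous.inner
      ((isTestOperator_fokkerPlanckExpr hV).continuous h)) fun p hp => by
      simp [fokkerPlanckExpr_eq_zero hp]
  rw [← sub_zero (∫ p, inner ℝ (w p) (fokkerPlanckExpr V h p)), ← hd0, ← integral_sub hF1 hdi]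
  refine integral_congr_ae (Filter.Eventually.of_forall fun p => ?_)
  have dm := hm1.differentiable (by simp) p
  have dN := hN.differentiable (by simp) p
  have dmN := hmN.differentiable (by simp) p
  have dw := hw1.differentiable (by simp) p
  have hNp : ∀ v, pd v N p = 2 * inner ℝ (w p) (pd v w p) := fun v => by
    rw [hNdef, pd_inner_apply dw dw, real_inner_comm]; ring
  have hNv : N p = ‖w p‖ ^ 2 := by simp only [hNdef, real_inner_self_eq_norm_sq]
  have hmv : m.toFun p = χ.toFun p ^ 2 := by rw [hm]; rfl
  have hmp : ∀ v, pd v m.toFun p = 2 * χ.toFun p * pd v χ.toFun p := fun v => by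
    rw [hm, χ.pd_sq]
  have hhv : h p = χ.toFun p ^ 2 • w p := by rw [hh]; rfl
  have hhp : ∀ v, pd v h p = (2 * χ.toFun p * pd v χ.toFun p) • w p + χ.toFun p ^ 2 • pd v w p :=
    fun v => by
      rw [hh, ← χ.pd_sq]
      exact pd_real_smul_apply (χ.sq.smooth.differentiable (by simp) p) dw v
  have hgp : ∀ v, pd v (χ.mulCc w hw) p = pd v χ.toFun p • w p + χ.toFun p • pd v w p :=
    fun v => pd_real_smul_apply (χ.smooth.differentiable (by simp) p) dw v
  have hρp : ∀ j, pd (0, e j) (ρ j) p = inner ℝ (pd (0, e j) w p) (pd (0, e j) h p)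
      + inner ℝ (w p) (pd (0, e j) (pd (0, e j) h) p) := fun j => by
    rw [hρdef, pd_inner_apply dw ((hdh _).differentiable (by simp) p)]
  have hA : ∀ j, pd (e j, 0) (fun p : R2n n => 1 / 2 * (p.2 j * (m.toFun p * N p))) p
      = 1 / 2 * (p.2 j * (pd (e j, 0) m.toFun p * N p + m.toFun p * pd (e j, 0) N p)) :=
    fun j => by
    rw [pd_mul_apply (differentiableAt_const _) (((hy j).mul hmN).differentiable (by simp) p),
      pd_mul_apply ((hy j).differentiable (by simp) p) dmN, pd_mul_apply dm dN,
      pd_snd_apply_eq_zero]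
    simp [pd]
  have hB : ∀ j, pd (0, e j) (fun p => -1 / 2 * (pd (e j) V p.1 * (m.toFun p * N p))
        + -1 * ρ j p) p
      = -1 / 2 * (pd (e j) V p.1 * (pd (0, e j) m.toFun p * N p + m.toFun p * pd (0, e j) N p))
        - pd (0, e j) (ρ j) p := fun j => by
    have d1 := (contDiff_const (c := (-1 / 2 : ℝ)) |>.mul ((hVp j).mul hmN)).differentiable
      (by simp) p
    have d2 := (contDiff_const (c := (-1 : ℝ)) |>.mul (hρ j)).differentiable (by simp) p
    rw [pd_add_apply d1 d2, pd_mul_apply (differentiableAt_const _)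
        (((hVp j).mul hmN).differentiable (by simp) p),
      pd_mul_apply ((hVp j).differentiable (by simp) p) dmN, pd_mul_apply dm dN,
      pd_mul_apply (differentiableAt_const _) ((hρ j).differentiable (by simp) p),
      pd_fst_comp_eq_zero _ ((contDiff_pd_potential hV (e j)).differentiable (by simp))]
    simp [pd]
    ring
  have hsq : ∀ j, inner ℝ (pd (0, e j) w p) (pd (0, e j) h p)
      = ‖pd (0, e j) (χ.mulCc w hw) p‖ ^ 2 - pd (0, e j) χ.toFun p ^ 2 * ‖w p‖ ^ 2 := fun j => by
    rw [hgp, norm_add_sq_real, hhp, inner_add_right, inner_smul_right, inner_smul_right,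
      real_inner_self_eq_norm_sq, norm_smul, norm_smul, inner_smul_left, inner_smul_right,
      mul_pow, mul_pow, Real.norm_eq_abs, Real.norm_eq_abs, sq_abs, sq_abs,
      real_inner_comm (w p)]
    simp only [conj_trivial]
    ring
  have hwh : ∀ v, inner ℝ (w p) (pd v h p) = 2 * χ.toFun p * pd v χ.toFun p * ‖w p‖ ^ 2
      + χ.toFun p ^ 2 * inner ℝ (w p) (pd v w p) := fun v => by
    rw [hhp, inner_add_right, inner_smul_right, inner_smul_right, real_inner_self_eq_norm_sq]
  have hwhv : inner ℝ (w p) (h p) = ‖χ.mulCc w hw p‖ ^ 2 := by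
    rw [hhv, inner_smul_right, real_inner_self_eq_norm_sq, Cutoff.mulCc_apply, norm_smul, mul_pow,
      Real.norm_eq_abs, sq_abs]
  simp only [hA, hB, hNp, hρp, hsq]
  rw [inner_fokkerPlanckExpr, transport_eq_sum]
  simp only [hNv, hmv, hmp, hwh, hwhv, mul_add, mul_sub, Finset.mul_sum, Finset.sum_add_distrib,
    Finset.sum_sub_distrib]
  have e2 : ∀ j, p.2 j * (2 * χ.toFun p * pd (e j, 0) χ.toFun p * ‖w p‖ ^ 2)
      = 2 * (‖w p‖ ^ 2 * (χ.toFun p * (p.2 j * pd (e j, 0) χ.toFun p))) := fun j => by ring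
  have e3 : ∀ j, pd (e j) V p.1 * (2 * χ.toFun p * pd (0, e j) χ.toFun p * ‖w p‖ ^ 2)
      = 2 * (‖w p‖ ^ 2 * (χ.toFun p * (pd (e j) V p.1 * pd (0, e j) χ.toFun p))) :=
    fun j => by ring
  have e4 : ∀ j, 1 / 2 * (p.2 j * (χ.toFun p ^ 2 * (2 * inner ℝ (w p) (pd (e j, 0) w p))))
      = p.2 j * (χ.toFun p ^ 2 * inner ℝ (w p) (pd (e j, 0) w p)) := fun j => by ring
  have e6 : ∀ j, -1 / 2 * (pd (e j) V p.1 * (χ.toFun p ^ 2 * (2 * inner ℝ (w p) (pd (0, e j) w p))))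
      = -(pd (e j) V p.1 * (χ.toFun p ^ 2 * inner ℝ (w p) (pd (0, e j) w p))) := fun j => by ring
  have e7 : ∀ j, pd (0, e j) χ.toFun p ^ 2 * ‖w p‖ ^ 2 = ‖w p‖ ^ 2 * pd (0, e j) χ.toFun p ^ 2 :=
    fun j => by ring
  simp only [e2, e3, e4, e6, e7, Finset.sum_neg_distrib, ← Finset.mul_sum]
  ring

/-- A cutoff on `ℝⁿ` with small derivatives. -/
theorem exists_slow_bump (n : ℕ) (R : ℝ) {η : ℝ} (hη : 0 < η) :
    ∃ ψ : Rn n → ℝ, ContDiff ℝ ∞ ψ ∧ HasCompactSupport ψ ∧ (∀ x, 0 ≤ ψ x) ∧ (∀ x, ψ x ≤ 1) ∧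
      (∀ x, ‖x‖ ≤ R → ψ x = 1) ∧ ∀ j x, |pd (e j) ψ x| ≤ η := by
  let f : ContDiffBump (0 : Rn n) := ⟨1, 2, one_pos, one_lt_two⟩
  have hfc : ∀ j, Continuous (pd (e j) f) := fun j =>
    (pd_contDiff (m := 0) (f.contDiff (n := 1)) (by simp) _).continuous
  choose B hB using fun j : Fin n =>
    (hfc j).bounded_above_of_compact_support (f.hasCompactSupport.fderiv_apply ℝ (e j))
  have hB0 : ∀ j, 0 ≤ B j := fun j => (norm_nonneg _).trans (hB j 0)
  have hBs : 0 ≤ ∑ j, B j := Finset.sum_nonneg fun j _ => hB0 j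
  set k : ℝ := 1 + |R| + (∑ j, B j) / η with hk
  have hk1 : 0 < k := by positivity
  have hkR : |R| ≤ k := by have : 0 ≤ (∑ j, B j) / η := by positivity
                           linarith
  have hkB : (∑ j, B j) ≤ η * k := by
    have : η * ((∑ j, B j) / η) = ∑ j, B j := by field_simp
    nlinarith [abs_nonneg R]
  refine ⟨fun x => f (k⁻¹ • x), f.contDiff.comp (contDiff_const_smul _),
    f.hasCompactSupport.comp_smul (inv_ne_zero hk1.ne'), fun x => f.nonneg, fun x => f.le_one,
    fun x hx => f.one_of_mem_closedBall ?_, fun j x => ?_⟩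
  · rw [mem_closedBall_zero_iff, norm_smul, norm_inv, Real.norm_of_nonneg hk1.le,
      inv_mul_le_iff₀ hk1]
    change _ ≤ k * 1
    linarith [le_abs_self R]
  · have : pd (e j) (fun x => f (k⁻¹ • x)) x = k⁻¹ * pd (e j) f (k⁻¹ • x) := by
      have h1 : HasFDerivAt (fun x : Rn n => f (k⁻¹ • x))
          ((fderiv ℝ f (k⁻¹ • x)).comp (k⁻¹ • ContinuousLinearMap.id ℝ (Rn n))) x :=
        HasFDerivAt.comp (g := (f : Rn n → ℝ)) x
          ((f.contDiff (n := 1)).differentiable (by simp) _).hasFDerivAt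
          ((hasFDerivAt_id x).const_smul k⁻¹)
      simp [pd, h1.fderiv]
    rw [this, abs_mul, abs_of_pos (inv_pos.2 hk1), inv_mul_le_iff₀ hk1]
    have h2 := hB j (k⁻¹ • x)
    rw [Real.norm_eq_abs] at h2
    have h3 := Finset.single_le_sum (f := B) (fun j _ => hB0 j) (Finset.mem_univ j)
    linarith

theorem exists_slow_cutoff (hV : ContDiff ℝ 2 V) (R : ℝ) {η : ℝ} (hη : 0 < η) :
    ∃ χ : Cutoff n, (∀ p, 0 ≤ χ.toFun p) ∧ (∀ p, χ.toFun p ≤ 1) ∧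
      (∀ p, ‖p‖ ≤ R → χ.toFun p = 1) ∧ (∀ j p, |pd (e j, 0) χ.toFun p| ≤ η) ∧
      (∀ j p, |pd (0, e j) χ.toFun p| ≤ η) ∧
      ∀ j p, |χ.toFun p * (pd (e j) V p.1 * pd (0, e j) χ.toFun p)| ≤ η := by
  obtain ⟨a, ha, hac, ha0, ha1, haR, had⟩ := exists_slow_bump n R hη
  choose B hB using fun j : Fin n =>
    Continuous.bounded_above_of_compact_support (f := fun x => a x * pd (e j) V x)
      (ha.continuous.mul (contDiff_pd_potential hV (e j)).continuous) hac.mul_right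
  have hB0 : ∀ j, 0 ≤ B j := fun j => (norm_nonneg _).trans (hB j 0)
  have hBs : 0 ≤ ∑ j, B j := Finset.sum_nonneg fun j _ => hB0 j
  set η' : ℝ := η / (1 + ∑ j, B j) with hη'
  have hη'0 : 0 < η' := by positivity
  have hη'η : η' ≤ η := div_le_self hη.le (by linarith)
  obtain ⟨b, hb, hbc, hb0, hb1, hbR, hbd⟩ := exists_slow_bump n R hη'0
  have hac' : ContDiff ℝ ∞ fun p : R2n n => a p.1 := ha.comp contDiff_fst
  have hbc' : ContDiff ℝ ∞ fun p : R2n n => b p.2 := hb.comp contDiff_snd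
  have da : ∀ p : R2n n, HasFDerivAt (fun p : R2n n => a p.1) ((fderiv ℝ a p.1).comp
      (ContinuousLinearMap.fst ℝ (Rn n) (Rn n))) p := fun p =>
    (ha.differentiable (by simp) p.1).hasFDerivAt.comp p hasFDerivAt_fst
  have db : ∀ p : R2n n, HasFDerivAt (fun p : R2n n => b p.2) ((fderiv ℝ b p.2).comp
      (ContinuousLinearMap.snd ℝ (Rn n) (Rn n))) p := fun p =>
    (hb.differentiable (by simp) p.2).hasFDerivAt.comp p hasFDerivAt_snd
  let χ : Cutoff n := ⟨fun p => a p.1 * b p.2, hac'.mul hbc',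
    HasCompactSupport.intro (K := tsupport a ×ˢ tsupport b) (hac.isCompact.prod hbc.isCompact)
      fun p hp => by
        by_cases h : p.1 ∈ tsupport a
        · have : p.2 ∉ tsupport b := fun h' => hp ⟨h, h'⟩
          simp [image_eq_zero_of_notMem_tsupport this]
        · simp [image_eq_zero_of_notMem_tsupport h]⟩
  have hx : ∀ j p, pd (e j, 0) χ.toFun p = pd (e j) a p.1 * b p.2 := fun j p => by
    refine (pd_mul_apply (da p).differentiableAt (db p).differentiableAt _).trans ?_
    simp [pd, (da p).fderiv, (db p).fderiv]
  have hy : ∀ j p, pd (0, e j) χ.toFun p = a p.1 * pd (e j) b p.2 := fun j p => by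
    refine (pd_mul_apply (da p).differentiableAt (db p).differentiableAt _).trans ?_
    simp [pd, (da p).fderiv, (db p).fderiv]
  refine ⟨χ, fun p => mul_nonneg (ha0 _) (hb0 _),
    fun p => mul_le_one₀ (ha1 _) (hb0 _) (hb1 _), fun p hp => ?_, fun j p => ?_, fun j p => ?_,
    fun j p => ?_⟩
  · change a p.1 * b p.2 = 1
    rw [haR _ ((norm_fst_le p).trans hp), hbR _ ((norm_snd_le p).trans hp), one_mul]
  · rw [hx, abs_mul, abs_of_nonneg (hb0 _)]
    exact (mul_le_of_le_one_right (abs_nonneg _) (hb1 _)).trans (had _ _)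
  · rw [hy, abs_mul, abs_of_nonneg (ha0 _)]
    exact (mul_le_of_le_one_left (abs_nonneg _) (ha1 _)).trans ((hbd _ _).trans hη'η)
  · have h1 := hB j p.1
    rw [Real.norm_eq_abs] at h1
    have h3 := Finset.single_le_sum (f := B) (fun j _ => hB0 j) (Finset.mem_univ j)
    have hχ1 : |χ.toFun p| ≤ 1 := by
      change |a p.1 * b p.2| ≤ 1
      rw [abs_of_nonneg (mul_nonneg (ha0 _) (hb0 _))]
      exact mul_le_one₀ (ha1 _) (hb0 _) (hb1 _)
    have h4 : χ.toFun p * (pd (e j) V p.1 * pd (0, e j) χ.toFun p)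
        = χ.toFun p * ((a p.1 * pd (e j) V p.1) * pd (e j) b p.2) := by rw [hy]; ring
    rw [h4, abs_mul]
    calc _ ≤ 1 * (B j * η') := by
          refine mul_le_mul hχ1 ?_ (abs_nonneg _) zero_le_one
          rw [abs_mul]
          exact mul_le_mul h1 (hbd _ _) (abs_nonneg _) (hB0 j)
      _ ≤ (1 + ∑ j, B j) * η' := by rw [one_mul]; gcongr; linarith
      _ = η := by rw [hη']; field_simp

end

section

variable {n : ℕ} {V : Rn n → ℝ}

instance : (volume : Measure (R2n n)).IsNegInvariant :=
  Measure.IsAddHaarMeasure.isNegInvariant_of_regular _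

section mollification

open scoped Convolution ComplexConjugate
open ContinuousLinearMap (lsmul)

/-- The convolution of a real cutoff with a complex function. -/
def conv (ρ : Cutoff n) (h : R2n n → ℂ) (p : R2n n) : ℂ := ∫ q, ρ.toFun (p - q) • h q

theorem conv_eq (ρ : Cutoff n) (h : R2n n → ℂ) :
    conv ρ h = ρ.toFun ⋆[lsmul ℝ ℝ, volume] h :=
  funext fun _ => convolution_lsmul_swap.symm

theorem contDiff_conv (ρ : Cutoff n) {h : R2n n → ℂ} (hh : LocallyIntegrable h) :
    ContDiff ℝ ∞ (conv ρ h) := by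
  rw [conv_eq]
  exact ρ.compact.contDiff_convolution_left _ ρ.smooth hh

theorem hasCompactSupport_conv (ρ : Cutoff n) {h : R2n n → ℂ} (hh : HasCompactSupport h) :
    HasCompactSupport (conv ρ h) := by
  rw [conv_eq]
  exact HasCompactSupport.convolution _ ρ.compact hh

/-- The derivative of a cutoff. -/
def Cutoff.deriv (ρ : Cutoff n) (v : R2n n) : Cutoff n where
  toFun := pd v ρ.toFun
  smooth := pd_contDiff ρ.smooth (by simp) v
  compact := ρ.compact.fderiv_apply ℝ v

theorem pd_conv (ρ : Cutoff n) {h : R2n n → ℂ} (hh : ContDiff ℝ ∞ h) (hc : HasCompactSupport h)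
    (v : R2n n) : pd v (conv ρ h) = conv ρ (pd v h) := by
  funext p
  have hρ : LocallyIntegrable ρ.toFun := ρ.smooth.continuous.locallyIntegrable
  have h1 : ContDiff ℝ 1 h := hh.of_le (by simp)
  rw [conv_eq, conv_eq, pd, (hc.hasFDerivAt_convolution_right (lsmul ℝ ℝ) hρ h1 p).fderiv,
    convolution_precompR_apply _ hρ (hc.fderiv ℝ) (h1.continuous_fderiv (by simp))]
  rfl

theorem pd_conv_left (ρ : Cutoff n) {h : R2n n → ℂ} (hh : LocallyIntegrable h)
    (v : R2n n) : pd v (conv ρ h) = conv (ρ.deriv v) h := by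
  funext p
  have h1 : ContDiff ℝ 1 ρ.toFun := ρ.smooth.of_le (by simp)
  rw [conv_eq, conv_eq, pd, (ρ.compact.hasFDerivAt_convolution_left (lsmul ℝ ℝ) h1 hh p).fderiv]
  have h2 := (ρ.compact.fderiv ℝ).convolutionExists_left
    ((lsmul ℝ ℝ : ℝ →L[ℝ] ℂ →L[ℝ] ℂ).precompL (R2n n))
    (h1.continuous_fderiv (by simp)) hh p
  exact ContinuousLinearMap.integral_apply h2 v

/-- Schur-type bound for a kernel dominated by a convolution kernel. -/
theorem norm_integral_kernel_le {k : R2n n → ℝ} (hk : Continuous k) (hkc : HasCompactSupport k)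
    (f : L2 (R2n n)) {G : R2n n → ℂ} (hG : Continuous G) (hGc : HasCompactSupport G)
    {A : R2n n × R2n n → ℂ} (hA : AEStronglyMeasurable A (volume.prod volume))
    (hle : ∀ p q, ‖A (p, q)‖ ≤ |k (p - q)| * (‖f p‖ * ‖G q‖)) :
    Integrable A (volume.prod volume) ∧
      ‖∫ z, A z ∂(volume.prod volume)‖
        ≤ 1 / 2 * (∫ z, |k z|) * ((∫ p, ‖f p‖ ^ 2) + ∫ q, ‖G q‖ ^ 2) := by
  have hki : Integrable (fun z => |k z|) := (hk.integrable_of_hasCompactSupport hkc).abs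
  have hf2 : Integrable (fun p => ‖f p‖ ^ 2) := (Lp.memLp f).integrable_norm_pow two_ne_zero
  have hG2 : Integrable (fun q => ‖G q‖ ^ 2) :=
    (hG.memLp_of_hasCompactSupport hGc).integrable_norm_pow two_ne_zero
  have i1 : Integrable (fun z : R2n n × R2n n => |k (z.1 - z.2)| * ‖G z.2‖ ^ 2)
      (volume.prod volume) := by
    have := hG2.convolution_integrand (lsmul ℝ ℝ : ℝ →L[ℝ] ℝ →L[ℝ] ℝ) hki
    refine this.congr (Filter.Eventually.of_forall fun z => ?_)
    simp [mul_comm]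
  have i2 : Integrable (fun z : R2n n × R2n n => |k (z.1 - z.2)| * ‖f z.1‖ ^ 2)
      (volume.prod volume) := by
    have := (hf2.convolution_integrand (lsmul ℝ ℝ : ℝ →L[ℝ] ℝ →L[ℝ] ℝ) hki.comp_neg).swap
    refine this.congr (Filter.Eventually.of_forall fun z => ?_)
    simp [mul_comm]
  have hle' : ∀ z, ‖A z‖
      ≤ 1 / 2 * (|k (z.1 - z.2)| * ‖f z.1‖ ^ 2 + |k (z.1 - z.2)| * ‖G z.2‖ ^ 2) :=
    fun z => (hle z.1 z.2).trans (by
      nlinarith [mul_nonneg (abs_nonneg (k (z.1 - z.2))) (sq_nonneg (‖f z.1‖ - ‖G z.2‖))])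
  have i3 := (i2.add i1).const_mul (1 / 2)
  refine ⟨i3.mono' hA (Filter.Eventually.of_forall hle'), ?_⟩
  refine (norm_integral_le_of_norm_le i3 (Filter.Eventually.of_forall hle')).trans_eq ?_
  rw [integral_const_mul, mul_assoc]
  congr 1
  refine (integral_add i2 i1).trans ?_
  rw [integral_prod _ i2, integral_prod_symm _ i1, mul_add]
  congr 1
  · simp only [integral_mul_const, integral_sub_left_eq_self (fun z => |k z|) volume,
      integral_const_mul]
  · simp only [integral_mul_const, integral_sub_right_eq_self (fun z => |k z|),
      integral_const_mul]

theorem aestronglyMeasurable_conj_mul (f : L2 (R2n n)) {a : R2n n × R2n n → ℂ}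
    (ha : Continuous a) :
    AEStronglyMeasurable (fun z => conj (f z.1) * a z) (volume.prod volume) :=
  (Complex.continuous_conj.comp_aestronglyMeasurable
    (Lp.aestronglyMeasurable f).comp_fst).mul ha.aestronglyMeasurable

theorem norm_integral_conj_mul_kernel_le {k : R2n n → ℝ} (hk : Continuous k)
    (hkc : HasCompactSupport k) (f : L2 (R2n n)) {G : R2n n → ℂ} (hG : Continuous G)
    (hGc : HasCompactSupport G) {a : R2n n × R2n n → ℂ} (ha : Continuous a)
    (hle : ∀ p q, ‖a (p, q)‖ ≤ |k (p - q)| * ‖G q‖) :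
    Integrable (fun p => conj (f p) * ∫ q, a (p, q)) ∧
      ‖∫ p, conj (f p) * ∫ q, a (p, q)‖
        ≤ 1 / 2 * (∫ z, |k z|) * ((∫ p, ‖f p‖ ^ 2) + ∫ q, ‖G q‖ ^ 2) := by
  obtain ⟨h1, h2⟩ := norm_integral_kernel_le hk hkc f hG hGc
    (aestronglyMeasurable_conj_mul f ha) fun p q => by
      rw [norm_mul, RCLike.norm_conj, mul_left_comm]
      exact mul_le_mul_of_nonneg_left (hle p q) (norm_nonneg _)
  have h3 := h1.integral_prod_left
  rw [integral_prod _ h1] at h2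
  simp only [integral_const_mul] at h2 h3
  exact ⟨h3, h2⟩

/-- Convolution with an even kernel is symmetric. -/
theorem integral_conj_mul_conv {ρ : Cutoff n} (hρ : ∀ z, ρ.toFun (-z) = ρ.toFun z)
    (f : L2 (R2n n)) {G : R2n n → ℂ} (hG : Continuous G) (hGc : HasCompactSupport G) :
    ∫ p, conj (f p) * conv ρ G p = ∫ q, conj (conv ρ f q) * G q := by
  have hρc := ρ.smooth.continuous
  have ha : Continuous fun z : R2n n × R2n n => ρ.toFun (z.1 - z.2) • G z.2 := by fun_prop
  obtain ⟨h1, -⟩ := norm_integral_kernel_le hρc ρ.compact f hG hGc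
    (aestronglyMeasurable_conj_mul f ha) fun p q => by
      rw [norm_mul, RCLike.norm_conj, mul_left_comm, norm_smul, Real.norm_eq_abs]
  have h2 := integral_integral_swap (f := fun p q => conj (f p) * (ρ.toFun (p - q) • G q)) h1
  simp only [integral_const_mul] at h2
  refine h2.trans (integral_congr_ae (Filter.Eventually.of_forall fun q => ?_))
  simp only [conv]
  rw [← integral_conj, ← integral_mul_const]
  refine integral_congr_ae (Filter.Eventually.of_forall fun p => ?_)
  simp only [Complex.real_smul, map_mul, Complex.conj_ofReal]
  rw [← neg_sub q p, hρ]
  ring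

/-- An even probability density supported in the ball of radius `r`. -/
structure IsMollifier (ρ : Cutoff n) (r : ℝ) : Prop where
  nonneg : ∀ z, 0 ≤ ρ.toFun z
  even : ∀ z, ρ.toFun (-z) = ρ.toFun z
  integral_eq : ∫ z, ρ.toFun z = 1
  eq_zero : ∀ z, r ≤ ‖z‖ → ρ.toFun z = 0

theorem locallyIntegrable_L2 (f : L2 (R2n n)) : LocallyIntegrable f :=
  (Lp.memLp f).locallyIntegrable one_le_two

theorem integral_mul_norm_conv_sq_le {ρ : Cutoff n} {r : ℝ} (hρ : IsMollifier ρ r)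
    (f : L2 (R2n n)) {b : R2n n → ℝ} (hb : Continuous b) (hbc : HasCompactSupport b)
    (hb0 : ∀ p, 0 ≤ b p) {η : ℝ} (hη : 0 < η) (hb1 : ∀ p, b p ≤ η) :
    ∫ p, b p * ‖conv ρ f p‖ ^ 2 ≤ η * ∫ p, ‖f p‖ ^ 2 := by
  have hw := (contDiff_conv ρ (locallyIntegrable_L2 f)).continuous
  set G : R2n n → ℂ := fun p => (η⁻¹ * b p) • conv ρ f p with hG
  have hGc : Continuous G := by fun_prop
  have hGs : HasCompactSupport G := hbc.mul_left.smul_right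
  have hρc := ρ.smooth.continuous
  have h1 := (norm_integral_conj_mul_kernel_le hρc ρ.compact f hGc hGs
    (a := fun z => ρ.toFun (z.1 - z.2) • G z.2) (by fun_prop)
    fun p q => by rw [norm_smul, Real.norm_eq_abs]).2
  change ‖∫ p, conj (f p) * conv ρ G p‖ ≤ _ at h1
  rw [integral_conj_mul_conv hρ.even f hGc hGs] at h1
  simp only [abs_of_nonneg (hρ.nonneg _), hρ.integral_eq] at h1
  have h2 : ∫ q, conj (conv ρ f q) * G q = ((η⁻¹ * ∫ p, b p * ‖conv ρ f p‖ ^ 2 : ℝ) : ℂ) := by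
    rw [← integral_const_mul, ← integral_complex_ofReal]
    refine integral_congr_ae (Filter.Eventually.of_forall fun q => ?_)
    simp only [hG, Complex.real_smul]
    rw [mul_left_comm, Complex.conj_mul']
    push_cast
    ring
  have h3 : 0 ≤ ∫ p, b p * ‖conv ρ f p‖ ^ 2 := integral_nonneg fun p =>
    mul_nonneg (hb0 p) (sq_nonneg _)
  have hi : Integrable (fun p => b p * ‖conv ρ f p‖ ^ 2) :=
    Continuous.integrable_of_hasCompactSupport (by fun_prop) hbc.mul_right
  have h4 : ∫ q, ‖G q‖ ^ 2 ≤ η⁻¹ * ∫ p, b p * ‖conv ρ f p‖ ^ 2 := by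
    rw [← integral_const_mul]
    refine integral_mono_of_nonneg (Filter.Eventually.of_forall fun _ => sq_nonneg _)
      (hi.const_mul _) (Filter.Eventually.of_forall fun p => ?_)
    have h5 : 0 ≤ η⁻¹ * b p := mul_nonneg (by positivity) (hb0 p)
    have h6 : η⁻¹ * b p ≤ 1 := by rw [inv_mul_le_iff₀ hη]; linarith [hb1 p]
    simp only [hG]
    rw [norm_smul, mul_pow, Real.norm_eq_abs, sq_abs, ← mul_assoc]
    refine mul_le_mul_of_nonneg_right ?_ (sq_nonneg _)
    nlinarith
  rw [h2, Complex.norm_real, Real.norm_of_nonneg (by positivity)] at h1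
  rw [← inv_mul_le_iff₀ hη]
  linarith

/-- The cutoff `z ↦ z_y ρ(z)` for a velocity coordinate. -/
def Cutoff.mulSnd (ρ : Cutoff n) (j : Fin n) : Cutoff n where
  toFun z := ρ.toFun z * z.2 j
  smooth := ρ.smooth.mul (contDiff_snd_apply j)
  compact := ρ.compact.mul_right

theorem integral_add_add_add {a b c d : R2n n → ℂ} (ha : Integrable a) (hb : Integrable b)
    (hc : Integrable c) (hd : Integrable d) :
    (∫ q, a q) + (∫ q, b q) + (∫ q, c q) + ∫ q, d q = ∫ q, (a q + b q + c q + d q) := by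
  rw [integral_add (f := fun q => a q + b q + c q) ((ha.add hb).add hc) hd,
    integral_add (f := fun q => a q + b q) (ha.add hb) hc, integral_add ha hb]

theorem integral_sub_sub_add {a b c d : R2n n → ℂ} (ha : Integrable a) (hb : Integrable b)
    (hc : Integrable c) (hd : Integrable d) :
    (∫ q, a q) - (∫ q, b q) - (∫ q, c q) + ∫ q, d q = ∫ q, (a q - b q - c q + d q) := by
  rw [integral_add (f := fun q => a q - b q - c q) ((ha.sub hb).sub hc) hd,
    integral_sub (f := fun q => a q - b q) (ha.sub hb) hc, integral_sub ha hb]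

/-- The commutator of `P` with a mollification. -/
theorem fokkerPlanckExpr_conv (hV : ContDiff ℝ 2 V) (ρ : Cutoff n) (h : Cc (R2n n)) (p : R2n n) :
    fokkerPlanckExpr V (conv ρ h) p = conv ρ (fokkerPlanckExpr V h) p
      + ∑ j, conv ((ρ.mulSnd j).deriv (e j, 0)) h p
      + ∑ j, (∫ q, ρ.toFun (p - q) • ((pd (e j) V q.1 - pd (e j) V p.1) • pd (0, e j) h q))
      + ∫ q, ρ.toFun (p - q) • (((‖p.2‖ ^ 2 - ‖q.2‖ ^ 2) / 4) • h q) := by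
  have hρc := ρ.smooth.continuous
  have hh := h.continuous
  have hd : ∀ v, Continuous (pd v h) := fun v => (pd_smooth h.smooth v).continuous
  have hdd : ∀ v, Continuous (pd v (pd v h)) := fun v =>
    (pd_smooth (pd_smooth h.smooth v) v).continuous
  have hVc : ∀ j, Continuous (pd (e j) V) := fun j => (contDiff_pd_potential hV _).continuous
  have hInt : ∀ g : R2n n → ℂ, Continuous g → (∀ q ∉ tsupport h, g q = 0) →
      Integrable fun q => ρ.toFun (p - q) • g q := fun g hg h0 =>
    h.integrable_of_eq_zero (by fun_prop) fun q hq => by simp [h0 q hq]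
  have hcd : ∀ v, HasCompactSupport (pd v h) := fun v => pd_hasCompactSupport h.hasCompactSupport v
  have hk : ∀ j, conv ((ρ.mulSnd j).deriv (e j, 0)) h p
      = ∫ q, ρ.toFun (p - q) • ((p.2 j - q.2 j) • pd (e j, 0) h q) := fun j => by
    rw [← pd_conv_left _ h.continuous.locallyIntegrable, pd_conv _ h.smooth h.hasCompactSupport]
    refine integral_congr_ae (Filter.Eventually.of_forall fun q => ?_)
    simp only [Cutoff.mulSnd, mul_smul]
    rfl
  have hT := (isTestOperator_fokkerPlanckExpr hV).continuous h
  have i0 := hInt _ hT fun q hq => fokkerPlanckExpr_eq_zero hq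
  have i1 : ∀ j, Integrable fun q => ρ.toFun (p - q) • ((p.2 j - q.2 j) • pd (e j, 0) h q) :=
    fun j => hInt _ (by fun_prop) fun q hq => by simp [pd_eq_zero_of_notMem_tsupport hq]
  have i2 : ∀ j, Integrable fun q =>
      ρ.toFun (p - q) • ((pd (e j) V q.1 - pd (e j) V p.1) • pd (0, e j) h q) :=
    fun j => hInt _ (by fun_prop) fun q hq => by simp [pd_eq_zero_of_notMem_tsupport hq]
  have i3 : Integrable fun q => ρ.toFun (p - q) • (((‖p.2‖ ^ 2 - ‖q.2‖ ^ 2) / 4) • h q) :=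
    hInt _ (by fun_prop) fun q hq => by simp [image_eq_zero_of_notMem_tsupport hq]
  have k1 : ∀ j, Integrable fun q => ((p.2 j : ℝ) : ℂ) * (ρ.toFun (p - q) • pd (e j, 0) h q) :=
    fun j => (hInt _ (hd _) fun q hq => pd_eq_zero_of_notMem_tsupport hq _).const_mul _
  have k2 : ∀ j, Integrable fun q =>
      ((pd (e j) V p.1 : ℝ) : ℂ) * (ρ.toFun (p - q) • pd (0, e j) h q) :=
    fun j => (hInt _ (hd _) fun q hq => pd_eq_zero_of_notMem_tsupport hq _).const_mul _
  have k3 : ∀ j, Integrable fun q => ρ.toFun (p - q) • pd (0, e j) (pd (0, e j) h) q :=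
    fun j => hInt _ (hdd _) fun q hq =>
      pd_eq_zero_of_notMem_tsupport (notMem_tsupport_pd hq _) _
  have k4 : Integrable fun q =>
      ((‖p.2‖ ^ 2 / 4 - (n : ℝ) / 2 : ℝ) : ℂ) * (ρ.toFun (p - q) • h q) :=
    (hInt _ hh fun q hq => image_eq_zero_of_notMem_tsupport hq).const_mul _
  simp only [hk]
  simp only [fokkerPlanckExpr.eq_1 V (conv ρ h), pd_conv ρ h.smooth h.hasCompactSupport,
    pd_conv ρ (pd_smooth h.smooth _) (hcd _)]
  simp only [conv, ← integral_const_mul]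
  rw [← integral_finsetSum _ fun j _ => k1 j, ← integral_finsetSum _ fun j _ => k2 j,
    ← integral_finsetSum _ fun j _ => k3 j, ← integral_finsetSum _ fun j _ => i1 j,
    ← integral_finsetSum _ fun j _ => i2 j,
    integral_sub_sub_add (integrable_finsetSum _ fun j _ => k1 j)
      (integrable_finsetSum _ fun j _ => k2 j) (integrable_finsetSum _ fun j _ => k3 j) k4,
    integral_add_add_add i0 (integrable_finsetSum _ fun j _ => i1 j)
      (integrable_finsetSum _ fun j _ => i2 j) i3]
  refine integral_congr_ae (Filter.Eventually.of_forall fun q => ?_)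
  simp only [fokkerPlanckExpr, Complex.real_smul]
  push_cast
  simp only [mul_add, mul_sub, sub_mul, Finset.mul_sum, Finset.sum_sub_distrib]
  simp only [mul_left_comm ((ρ.toFun (p - q) : ℝ) : ℂ)]
  ring

end mollification

end

section

variable {n : ℕ} {V : Rn n → ℝ}

section weak_solution

open scoped ComplexConjugate

theorem conv_add_const_mul (ρ : Cutoff n) {g h : R2n n → ℂ} (hg : Continuous g)
    (hgc : HasCompactSupport g) (hh : Continuous h) (hhc : HasCompactSupport h) (c : ℂ)
    (p : R2n n) : conv ρ (fun q => g q + c * h q) p = conv ρ g p + c * conv ρ h p := by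
  have hρc := ρ.smooth.continuous
  simp only [conv, ← integral_const_mul]
  rw [← integral_add]
  · refine integral_congr_ae (Filter.Eventually.of_forall fun q => ?_)
    simp only [Complex.real_smul]
    ring
  · exact Continuous.integrable_of_hasCompactSupport (by fun_prop)
      (HasCompactSupport.intro hgc fun q hq => by simp [image_eq_zero_of_notMem_tsupport hq])
  · exact Continuous.integrable_of_hasCompactSupport (by fun_prop)
      (HasCompactSupport.intro hhc fun q hq => by simp [image_eq_zero_of_notMem_tsupport hq])

/-- A mollified weak solution of the adjoint equation is an approximate solution. -/
theorem norm_integral_conj_conv_le (hV : ContDiff ℝ 2 V) {c : ℝ} {f : L2 (R2n n)}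
    (hf : ∀ u : Cc (R2n n), ∫ p, conj (f p) * (fokkerPlanckExpr V u p + (c : ℂ) * u p) = 0)
    {ρ : Cutoff n} {r τ : ℝ} (hρ : IsMollifier ρ r) (hτ : 0 ≤ τ)
    (h1 : ∀ j, ∫ z, |((ρ.mulSnd j).deriv (e j, 0)).toFun z| ≤ τ) (h : Cc (R2n n))
    (h2 : ∀ p q, q ∈ tsupport h → ‖p - q‖ < r → ∀ j, |pd (e j) V q.1 - pd (e j) V p.1| ≤ τ)
    (h3 : ∀ p q, q ∈ tsupport h → ‖p - q‖ < r → |(‖p.2‖ ^ 2 - ‖q.2‖ ^ 2) / 4| ≤ τ) :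
    ‖∫ q, conj (conv ρ f q) * (fokkerPlanckExpr V h q + (c : ℂ) * h q)‖
      ≤ (n + 1) * τ * ((∫ p, ‖f p‖ ^ 2) + (∫ p, ‖h p‖ ^ 2)
        + ∑ j, ∫ p, ‖pd (0, e j) h p‖ ^ 2) := by
  have hρc := ρ.smooth.continuous
  have hhc := h.continuous
  have hdc : ∀ v, Continuous (pd v h) := fun v => (pd_smooth h.smooth v).continuous
  have hds : ∀ v, HasCompactSupport (pd v h) := fun v => pd_hasCompactSupport h.hasCompactSupport v
  have hVc : ∀ j, Continuous (pd (e j) V) := fun j => (contDiff_pd_potential hV _).continuous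
  have hT := (isTestOperator_fokkerPlanckExpr hV).continuous h
  have hTs := (isTestOperator_fokkerPlanckExpr hV).hasCompactSupport h
  set T : R2n n → ℂ := fun q => fokkerPlanckExpr V h q + (c : ℂ) * h q with hTdef
  have hTc : Continuous T := by fun_prop
  have hTcs : HasCompactSupport T := hTs.add h.hasCompactSupport.mul_left
  have hkτ : ∀ z, |τ * ρ.toFun z| = τ * ρ.toFun z := fun z =>
    abs_of_nonneg (mul_nonneg hτ (hρ.nonneg z))
  have hkτi : ∫ z, |τ * ρ.toFun z| = τ := by
    simp only [hkτ, integral_const_mul, hρ.integral_eq, mul_one]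
  have K0 := (norm_integral_conj_mul_kernel_le hρc ρ.compact f hTc hTcs
    (a := fun z => ρ.toFun (z.1 - z.2) • T z.2) (by fun_prop)
    fun p q => by rw [norm_smul, Real.norm_eq_abs]).1
  have K1 := fun j => norm_integral_conj_mul_kernel_le
    ((ρ.mulSnd j).deriv (e j, 0)).smooth.continuous ((ρ.mulSnd j).deriv (e j, 0)).compact f hhc
    h.hasCompactSupport (a := fun z => ((ρ.mulSnd j).deriv (e j, 0)).toFun (z.1 - z.2) • h z.2)
    ((((ρ.mulSnd j).deriv (e j, 0)).smooth.continuous.comp (by fun_prop)).smul (by fun_prop))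
    fun p q => by rw [norm_smul, Real.norm_eq_abs]
  have K2 := fun j => norm_integral_conj_mul_kernel_le (k := fun z => τ * ρ.toFun z)
    (by fun_prop) ρ.compact.mul_left f (hdc (0, e j)) (hds _)
    (a := fun z => ρ.toFun (z.1 - z.2) •
      ((pd (e j) V z.2.1 - pd (e j) V z.1.1) • pd (0, e j) h z.2)) (by fun_prop) fun p q => by
      rw [hkτ, norm_smul, norm_smul, Real.norm_of_nonneg (hρ.nonneg _), mul_comm τ, mul_assoc]
      by_cases hq : q ∈ tsupport h
      · rcases le_or_gt r ‖p - q‖ with hr | hr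
        · simp [hρ.eq_zero _ hr]
        · exact mul_le_mul_of_nonneg_left
            (mul_le_mul_of_nonneg_right (h2 p q hq hr j) (norm_nonneg _)) (hρ.nonneg _)
      · simp [pd_eq_zero_of_notMem_tsupport hq]
  have K3 := norm_integral_conj_mul_kernel_le (k := fun z => τ * ρ.toFun z)
    (by fun_prop) ρ.compact.mul_left f hhc h.hasCompactSupport
    (a := fun z => ρ.toFun (z.1 - z.2) • (((‖z.1.2‖ ^ 2 - ‖z.2.2‖ ^ 2) / 4) • h z.2))
    (by fun_prop) fun p q => by
      rw [hkτ, norm_smul, norm_smul, Real.norm_of_nonneg (hρ.nonneg _), mul_comm τ, mul_assoc]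
      by_cases hq : q ∈ tsupport h
      · rcases le_or_gt r ‖p - q‖ with hr | hr
        · simp [hρ.eq_zero _ hr]
        · exact mul_le_mul_of_nonneg_left
            (mul_le_mul_of_nonneg_right (h3 p q hq hr) (norm_nonneg _)) (hρ.nonneg _)
      · simp [image_eq_zero_of_notMem_tsupport hq]
  have hsum := hf (mkCc (conv ρ h) (contDiff_conv ρ hhc.locallyIntegrable)
    (hasCompactSupport_conv ρ h.hasCompactSupport))
  have hpt : ∀ p, conj (f p) * (fokkerPlanckExpr V (conv ρ h) p + (c : ℂ) * conv ρ h p)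
      = conj (f p) * (∫ q, ρ.toFun (p - q) • T q)
        + ∑ j, conj (f p) * (∫ q, ((ρ.mulSnd j).deriv (e j, 0)).toFun (p - q) • h q)
        + ∑ j, conj (f p) * (∫ q, ρ.toFun (p - q) •
          ((pd (e j) V q.1 - pd (e j) V p.1) • pd (0, e j) h q))
        + conj (f p) * ∫ q, ρ.toFun (p - q) • (((‖p.2‖ ^ 2 - ‖q.2‖ ^ 2) / 4) • h q) := fun p => by
    have hTi : ∫ q, ρ.toFun (p - q) • T q
        = conv ρ (fokkerPlanckExpr V h) p + (c : ℂ) * conv ρ h p :=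
      conv_add_const_mul ρ hT hTs hhc h.hasCompactSupport c p
    rw [fokkerPlanckExpr_conv hV, hTi, ← Finset.mul_sum, ← Finset.mul_sum]
    simp only [conv.eq_1 ((ρ.mulSnd _).deriv _)]
    ring
  have hs' : (∫ p, conj (f p) * (∫ q, ρ.toFun (p - q) • T q))
        + (∑ j, ∫ p, conj (f p) * (∫ q, ((ρ.mulSnd j).deriv (e j, 0)).toFun (p - q) • h q))
        + (∑ j, ∫ p, conj (f p) * (∫ q, ρ.toFun (p - q) •
          ((pd (e j) V q.1 - pd (e j) V p.1) • pd (0, e j) h q)))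
        + (∫ p, conj (f p) * ∫ q, ρ.toFun (p - q) • (((‖p.2‖ ^ 2 - ‖q.2‖ ^ 2) / 4) • h q)) = 0 := by
    rw [← integral_finsetSum _ fun j _ => (K1 j).1, ← integral_finsetSum _ fun j _ => (K2 j).1,
      integral_add_add_add K0 (integrable_finsetSum _ fun j _ => (K1 j).1)
        (integrable_finsetSum _ fun j _ => (K2 j).1) K3.1, ← hsum]
    exact integral_congr_ae (Filter.Eventually.of_forall fun p => (hpt p).symm)
  have hadj : (∫ p, conj (f p) * (∫ q, ρ.toFun (p - q) • T q)) = ∫ q, conj (conv ρ f q) * T q :=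
    integral_conj_mul_conv hρ.even f hTc hTcs
  rw [hadj] at hs'
  have hF : 0 ≤ ∫ p, ‖f p‖ ^ 2 := integral_nonneg fun _ => sq_nonneg _
  have hH : 0 ≤ ∫ p, ‖h p‖ ^ 2 := integral_nonneg fun _ => sq_nonneg _
  have hD : 0 ≤ ∑ j, ∫ p, ‖pd (0, e j) h p‖ ^ 2 :=
    Finset.sum_nonneg fun j _ => integral_nonneg fun _ => sq_nonneg _
  have B1 := fun j => (K1 j).2.trans (mul_le_mul_of_nonneg_right
    (mul_le_mul_of_nonneg_left (h1 j) (by norm_num)) (add_nonneg hF hH))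
  have B2 := fun j => (K2 j).2
  have B3 := K3.2
  simp only [hkτi] at B2 B3
  have S1 := (norm_sum_le _ _).trans (Finset.sum_le_sum fun j (_ : j ∈ Finset.univ) => B1 j)
  have S2 := (norm_sum_le _ _).trans (Finset.sum_le_sum fun j (_ : j ∈ Finset.univ) => B2 j)
  simp only [Finset.sum_const, Finset.card_univ, Fintype.card_fin, nsmul_eq_mul,
    ← Finset.mul_sum, Finset.sum_add_distrib] at S1 S2
  have hn : (0 : ℝ) ≤ n := n.cast_nonneg
  have hnorm : ∀ a b c d : ℂ, a + b + c + d = 0 → ‖a‖ ≤ ‖b‖ + ‖c‖ + ‖d‖ := fun a b c d h => by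
    have : a = -(b + c + d) := by linear_combination h
    rw [this, norm_neg]
    exact norm_add₃_le
  refine (hnorm _ _ _ _ hs').trans ((add_le_add (add_le_add S1 S2) B3).trans ?_)
  nlinarith [mul_nonneg hτ hF, mul_nonneg hτ hH, mul_nonneg hτ hD, mul_nonneg hn (mul_nonneg hτ hF),
    mul_nonneg hn (mul_nonneg hτ hH), mul_nonneg hn (mul_nonneg hτ hD)]

end weak_solution

end

section

variable {n : ℕ} {V : Rn n → ℝ}

section density

open scoped ComplexConjugate InnerProductSpace Uniformity

/-- Anisotropic mollifiers, much more concentrated in velocity than in position. -/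
theorem exists_mollifier (n : ℕ) {r τ : ℝ} (hr : 0 < r) (hτ : 0 < τ) :
    ∃ ρ : Cutoff n, IsMollifier ρ r ∧
      ∀ j, ∫ z, |((ρ.mulSnd j).deriv (e j, 0)).toFun z| ≤ τ := by
  let f : ContDiffBump (0 : Rn n) := ⟨r / 2, r, by positivity, by linarith⟩
  obtain ⟨a, ha⟩ : ∃ a : Rn n → ℝ, a = f.normed volume := ⟨_, rfl⟩
  have hac : ContDiff ℝ ∞ a := ha ▸ f.contDiff_normed
  have has : HasCompactSupport a := ha ▸ f.hasCompactSupport_normed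
  set D : ℝ := ∑ j, ∫ x, |pd (e j) a x| with hD
  have hD0 : ∀ j, 0 ≤ ∫ x, |pd (e j) a x| := fun j => integral_nonneg fun _ => abs_nonneg _
  have hDs : 0 ≤ D := Finset.sum_nonneg fun j _ => hD0 j
  set δ : ℝ := min r (τ / (1 + D)) with hδ
  have hδ0 : 0 < δ := lt_min hr (by positivity)
  let g : ContDiffBump (0 : Rn n) := ⟨δ / 2, δ, by positivity, by linarith⟩
  obtain ⟨b, hb⟩ : ∃ b : Rn n → ℝ, b = g.normed volume := ⟨_, rfl⟩
  have hbc : ContDiff ℝ ∞ b := hb ▸ g.contDiff_normed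
  have hbs : HasCompactSupport b := hb ▸ g.hasCompactSupport_normed
  have ha0 : ∀ x, 0 ≤ a x := fun x => ha ▸ f.nonneg_normed x
  have hb0 : ∀ x, 0 ≤ b x := fun x => hb ▸ g.nonneg_normed x
  have haz : ∀ x, r ≤ ‖x‖ → a x = 0 := fun x hx => by
    rw [← Function.notMem_support, ha, f.support_normed_eq]
    simpa using hx
  have hbz : ∀ x, δ ≤ ‖x‖ → b x = 0 := fun x hx => by
    rw [← Function.notMem_support, hb, g.support_normed_eq]
    simpa using hx
  have hai : ∫ x, a x = 1 := ha ▸ f.integral_normed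
  have hbi : ∫ x, b x = 1 := hb ▸ g.integral_normed
  have da : ∀ p : R2n n, HasFDerivAt (fun p : R2n n => a p.1) ((fderiv ℝ a p.1).comp
      (ContinuousLinearMap.fst ℝ (Rn n) (Rn n))) p := fun p =>
    (hac.differentiable (by simp) p.1).hasFDerivAt.comp p hasFDerivAt_fst
  have db : ∀ p : R2n n, HasFDerivAt (fun p : R2n n => b p.2) ((fderiv ℝ b p.2).comp
      (ContinuousLinearMap.snd ℝ (Rn n) (Rn n))) p := fun p =>
    (hbc.differentiable (by simp) p.2).hasFDerivAt.comp p hasFDerivAt_snd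
  let ρ : Cutoff n := ⟨fun p => a p.1 * b p.2, (hac.comp contDiff_fst).mul (hbc.comp contDiff_snd),
    HasCompactSupport.intro (K := tsupport a ×ˢ tsupport b) (has.isCompact.prod hbs.isCompact)
      fun p hp => by
        by_cases h : p.1 ∈ tsupport a
        · have : p.2 ∉ tsupport b := fun h' => hp ⟨h, h'⟩
          simp [image_eq_zero_of_notMem_tsupport this]
        · simp [image_eq_zero_of_notMem_tsupport h]⟩
  refine ⟨ρ, ⟨fun z => mul_nonneg (ha0 _) (hb0 _), fun z => ?_, ?_, fun z hz => ?_⟩, fun j => ?_⟩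
  · change a (-z.1) * b (-z.2) = a z.1 * b z.2
    rw [ha, hb, f.normed_neg, g.normed_neg]
  · refine (integral_prod_mul (μ := volume) (ν := volume) a b).trans ?_
    rw [hai, hbi, one_mul]
  · change a z.1 * b z.2 = 0
    rw [Prod.norm_def, le_max_iff] at hz
    rcases hz with hz | hz
    · rw [haz _ hz, zero_mul]
    · rw [hbz _ ((min_le_left _ _).trans hz), mul_zero]
  · have hpd : ∀ z, ((ρ.mulSnd j).deriv (e j, 0)).toFun z = pd (e j) a z.1 * (b z.2 * z.2 j) :=
      fun z => by
        have d1 := (da z).differentiableAt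
        have d2 := (db z).differentiableAt
        have d3 := (hasFDerivAt_snd_apply j z).differentiableAt
        refine (pd_mul_apply (d1.mul d2) d3 _).trans ?_
        rw [pd_snd_apply_eq_zero, mul_zero, add_zero]
        have := pd_mul_apply d1 d2 (e j, 0)
        have e1 : pd ((e j, 0) : R2n n) (fun p : R2n n => a p.1) z = pd (e j) a z.1 := by
          simp [pd, (da z).fderiv]
        have e2 : pd ((e j, 0) : R2n n) (fun p : R2n n => b p.2) z = 0 := by
          simp [pd, (db z).fderiv]
        rw [e1, e2] at this
        change pd ((e j, 0) : R2n n) (fun p : R2n n => a p.1 * b p.2) z * z.2 j = _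
        rw [this]
        ring
    have hle : ∀ z : R2n n, |pd (e j) a z.1 * (b z.2 * z.2 j)| ≤ |pd (e j) a z.1| * (δ * b z.2) :=
      fun z => by
        rw [abs_mul, abs_mul, abs_of_nonneg (hb0 _)]
        refine mul_le_mul_of_nonneg_left ?_ (abs_nonneg _)
        rcases le_or_gt δ ‖z.2‖ with h | h
        · simp [hbz _ h]
        · rw [mul_comm]
          exact mul_le_mul_of_nonneg_right ((abs_apply_le_norm _ _).trans h.le) (hb0 _)
    have hia : Integrable (fun x => |pd (e j) a x|) :=
      ((pd_contDiff (m := 0) hac (by simp) _).continuous.integrable_of_hasCompactSupport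
        (has.fderiv_apply ℝ (e j))).abs
    have hib : Integrable (fun x => δ * b x) :=
      (hbc.continuous.integrable_of_hasCompactSupport hbs).const_mul δ
    simp only [hpd]
    refine (integral_mono_of_nonneg (Filter.Eventually.of_forall fun _ => abs_nonneg _)
      (hia.mul_prod hib) (Filter.Eventually.of_forall hle)).trans ?_
    refine (integral_prod_mul (μ := volume) (ν := volume) (fun x => |pd (e j) a x|)
      (fun x => δ * b x)).trans_le ?_
    rw [integral_const_mul, hbi, mul_one]
    have h1 := Finset.single_le_sum (f := fun j => ∫ x, |pd (e j) a x|) (fun j _ => hD0 j)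
      (Finset.mem_univ j)
    calc _ ≤ (1 + D) * (τ / (1 + D)) := by
          refine mul_le_mul ?_ (min_le_right _ _) hδ0.le (by positivity)
          linarith
      _ = τ := by field_simp

theorem tsupport_mulCc_subset (χ : Cutoff n) (w : R2n n → ℂ) (hw : ContDiff ℝ ∞ w) :
    tsupport (χ.sq.mulCc w hw) ⊆ tsupport χ.toFun :=
  closure_mono fun p hp h => hp (by
    rw [Cutoff.mulCc_apply]
    simp [Cutoff.sq, h])

theorem re_conj_mul (z w : ℂ) : (conj z * w).re = inner ℝ z w := by
  rw [Complex.inner, mul_comm]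

/-- A localized bound for mollified weak solutions of the adjoint equation. -/
theorem integral_norm_cutoff_conv_sq_le (hV : ContDiff ℝ 2 V) {f : L2 (R2n n)}
    (hf : ∀ u : Cc (R2n n),
      ∫ p, conj (f p) * (fokkerPlanckExpr V u p + ((n / 2 + 1 : ℝ) : ℂ) * u p) = 0)
    {ρ : Cutoff n} {r τ η : ℝ} (hρ : IsMollifier ρ r) (hτ : 0 ≤ τ) (hτ1 : 2 * (n + 1) * τ ≤ 1)
    (h1 : ∀ j, ∫ z, |((ρ.mulSnd j).deriv (e j, 0)).toFun z| ≤ τ) {χ : Cutoff n}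
    (h2 : ∀ p q, q ∈ tsupport χ.toFun → ‖p - q‖ < r →
      ∀ j, |pd (e j) V q.1 - pd (e j) V p.1| ≤ τ)
    (h3 : ∀ p q, q ∈ tsupport χ.toFun → ‖p - q‖ < r → |(‖p.2‖ ^ 2 - ‖q.2‖ ^ 2) / 4| ≤ τ)
    (hη : 0 < η) (hη1 : η ≤ 1) (hχ0 : ∀ p, 0 ≤ χ.toFun p) (hχ1 : ∀ p, χ.toFun p ≤ 1)
    (hχx : ∀ j p, |pd (e j, 0) χ.toFun p| ≤ η) (hχy : ∀ j p, |pd (0, e j) χ.toFun p| ≤ η)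
    (hχV : ∀ j p, |χ.toFun p * (pd (e j) V p.1 * pd (0, e j) χ.toFun p)| ≤ η) :
    ∫ p, χ.toFun p ^ 2 * ‖conv ρ f p‖ ^ 2
      ≤ ((3 * n + 1) * η + 2 * (n + 1) ^ 2 * τ) * ∫ p, ‖f p‖ ^ 2 := by
  obtain ⟨w, hwdef⟩ : ∃ w : R2n n → ℂ, w = conv ρ f := ⟨_, rfl⟩
  have hw : ContDiff ℝ ∞ w := hwdef ▸ contDiff_conv ρ (locallyIntegrable_L2 f)
  obtain ⟨g, hg⟩ : ∃ g : Cc (R2n n), g = χ.mulCc w hw := ⟨_, rfl⟩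
  obtain ⟨h, hh⟩ : ∃ h : Cc (R2n n), h = χ.sq.mulCc w hw := ⟨_, rfl⟩
  set F : ℝ := ∫ p, ‖f p‖ ^ 2 with hFdef
  have hF : 0 ≤ F := integral_nonneg fun _ => sq_nonneg _
  have hn : (0 : ℝ) ≤ n := n.cast_nonneg
  have hwc := hw.continuous
  have hχc := χ.smooth.continuous
  have hdχ : ∀ v, Continuous (pd v χ.toFun) := fun v =>
    (pd_contDiff (m := 0) χ.smooth (by simp) v).continuous
  have hVc : ∀ j, Continuous (pd (e j) V) := fun j => (contDiff_pd_potential hV _).continuous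
  have hsub := tsupport_mulCc_subset χ w hw
  rw [← hh] at hsub
  have hM := norm_integral_conj_conv_le hV hf hρ hτ h1 h (fun p q hq => h2 p q (hsub hq))
    fun p q hq => h3 p q (hsub hq)
  rw [← hwdef] at hM
  have hgv : ∀ p, ‖g p‖ ^ 2 = χ.toFun p ^ 2 * ‖w p‖ ^ 2 := fun p => by
    rw [hg, Cutoff.mulCc_apply, norm_smul, mul_pow, Real.norm_eq_abs, sq_abs]
  have hhg : ∀ p, h p = χ.toFun p • g p := fun p => by
    rw [hh, hg, Cutoff.mulCc_apply, Cutoff.mulCc_apply, smul_smul, ← pow_two]; rfl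
  have hχ2 : ∀ p, χ.toFun p ^ 2 ≤ 1 := fun p => pow_le_one₀ (hχ0 p) (hχ1 p)
  -- norms of the test function
  have hhle : ∀ p, ‖h p‖ ^ 2 ≤ ‖g p‖ ^ 2 := fun p => by
    rw [hhg, norm_smul, mul_pow, Real.norm_eq_abs, sq_abs]
    exact mul_le_of_le_one_left (sq_nonneg _) (hχ2 p)
  have hdle : ∀ j p, ‖pd (0, e j) h p‖ ^ 2 ≤ 2 * (‖g p‖ ^ 2 + ‖pd (0, e j) g p‖ ^ 2) :=
    fun j p => by
      have : (h : R2n n → ℂ) = fun p => χ.toFun p • g p := funext hhg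
      rw [this, pd_real_smul_apply (χ.smooth.differentiable (by simp) p)
        (g.smooth.differentiable (by simp) p)]
      refine (norm_add_sq_le_two _ _).trans ?_
      have a1 := norm_real_smul_sq_le ((hχy j p).trans hη1) (g p)
      have a2 := norm_real_smul_sq_le ((abs_of_nonneg (hχ0 p)).le.trans (hχ1 p)) (pd (0, e j) g p)
      linarith
  have iu : ∀ u : Cc (R2n n), ∀ j, Integrable (fun p => ‖pd (0, e j) u p‖ ^ 2) := fun u j => by
    have := (pd_smooth u.smooth (0, e j)).continuous
    exact u.integrable_of_eq_zero (by fun_prop) fun p hp => by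
      simp [pd_eq_zero_of_notMem_tsupport hp]
  have ig := integrable_norm_sq g
  set Q : ℝ := ∑ j, ∫ p, ‖pd (0, e j) g p‖ ^ 2 with hQ
  set S : ℝ := ∫ p, ‖g p‖ ^ 2 with hS
  have hQ0 : 0 ≤ Q := Finset.sum_nonneg fun j _ => integral_nonneg fun _ => sq_nonneg _
  have hH : ∫ p, ‖h p‖ ^ 2 ≤ S := integral_mono (integrable_norm_sq h) ig hhle
  have hD : ∑ j, ∫ p, ‖pd (0, e j) h p‖ ^ 2 ≤ 2 * n * S + 2 * Q := by
    calc _ ≤ ∑ j, (2 * S + 2 * ∫ p, ‖pd (0, e j) g p‖ ^ 2) := by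
          refine Finset.sum_le_sum fun j _ => ?_
          refine (integral_mono (iu h j) ((ig.add (iu g j)).const_mul 2) (hdle j)).trans_eq ?_
          rw [integral_const_mul, ← mul_add]
          exact congrArg _ (integral_add ig (iu g j))
      _ = _ := by
          simp only [Finset.sum_add_distrib, ← Finset.mul_sum, Finset.sum_const, Finset.card_univ,
            Fintype.card_fin, nsmul_eq_mul]
          ring
  have hSF : S ≤ F := by
    have := integral_mul_norm_conv_sq_le hρ f (b := fun p => χ.toFun p ^ 2) (by fun_prop)
      χ.sq.compact (fun p => sq_nonneg _) one_pos hχ2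
    rw [one_mul, ← hwdef] at this
    simpa only [hS, hgv] using this
  -- the energy identity
  have hTc := (isTestOperator_fokkerPlanckExpr hV).continuous h
  have iT : Integrable (fun p => inner ℝ (w p) (fokkerPlanckExpr V h p)) :=
    h.integrable_of_eq_zero (by fun_prop) fun p hp => by simp [fokkerPlanckExpr_eq_zero hp]
  have hre : (∫ q, conj (w q) * (fokkerPlanckExpr V h q + ((n / 2 + 1 : ℝ) : ℂ) * h q)).re
      = (∫ p, inner ℝ (w p) (fokkerPlanckExpr V h p)) + (n / 2 + 1) * S := by
    have hc : Continuous h := h.continuous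
    have iw : Integrable
        (fun q => conj (w q) * (fokkerPlanckExpr V h q + ((n / 2 + 1 : ℝ) : ℂ) * h q)) :=
      h.integrable_of_eq_zero (by fun_prop) fun p hp => by
        simp [fokkerPlanckExpr_eq_zero hp, image_eq_zero_of_notMem_tsupport hp]
    rw [← integral_const_mul, ← integral_add iT (ig.const_mul _)]
    refine (integral_re iw).symm.trans (integral_congr_ae (Filter.Eventually.of_forall fun p => ?_))
    change (conj (w p) * _).re
      = inner ℝ (w p) (fokkerPlanckExpr V h p) + (n / 2 + 1) * ‖g p‖ ^ 2
    rw [re_conj_mul, inner_add_right, ← Complex.real_smul, inner_smul_right, hhg, inner_smul_right,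
      hgv, hg, Cutoff.mulCc_apply, inner_smul_right, real_inner_self_eq_norm_sq]
    ring
  have hEn := cutoff_energy_identity hV χ hw
  rw [← hh, ← hg] at hEn
  set β : R2n n → ℝ := fun p => ∑ j, pd (0, e j) χ.toFun p ^ 2 + ∑ j, pd (e j, 0) χ.toFun p ^ 2
    + ∑ j, |χ.toFun p * (pd (e j) V p.1 * pd (0, e j) χ.toFun p)| with hβ
  have hβc : Continuous β := by fun_prop
  have hβs : HasCompactSupport β := HasCompactSupport.intro χ.compact fun p hp => by
    simp [hβ, pd_eq_zero_of_notMem_tsupport hp]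
  have hβ0 : ∀ p, 0 ≤ β p := fun p => by positivity
  have hβ1 : ∀ p, β p ≤ (3 * n + 1) * η := fun p => by
    have hsq : ∀ x : ℝ, |x| ≤ η → x ^ 2 ≤ η := fun x hx => by
      rw [← sq_abs]
      nlinarith [abs_nonneg x]
    have c1 := Finset.sum_le_sum fun j (_ : j ∈ Finset.univ) => hsq _ (hχy j p)
    have c2 := Finset.sum_le_sum fun j (_ : j ∈ Finset.univ) => hsq _ (hχx j p)
    have c3 := Finset.sum_le_sum fun j (_ : j ∈ Finset.univ) => hχV j p
    simp only [Finset.sum_const, Finset.card_univ, Fintype.card_fin, nsmul_eq_mul] at c1 c2 c3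
    simp only [hβ]
    linarith
  have hβF := integral_mul_norm_conv_sq_le hρ f hβc hβs hβ0 (by positivity) hβ1
  rw [← hwdef] at hβF
  have iβ : Integrable (fun p => β p * ‖w p‖ ^ 2) :=
    Continuous.integrable_of_hasCompactSupport (by fun_prop) hβs.mul_right
  have hlow : Q + S - (∫ p, β p * ‖w p‖ ^ 2)
      ≤ (∫ p, inner ℝ (w p) (fokkerPlanckExpr V h p)) + (n / 2 + 1) * S := by
    rw [hEn, hQ, ← integral_finsetSum _ fun j _ => iu g j]
    have iE : Integrable (fun p => ∑ j, ‖pd (0, e j) g p‖ ^ 2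
        + (‖p.2‖ ^ 2 / 4 - n / 2) * ‖g p‖ ^ 2
        + ‖w p‖ ^ 2 * (χ.toFun p * transport V χ.toFun p - ∑ j, pd (0, e j) χ.toFun p ^ 2)) := by
      have hgc := g.continuous
      refine ((integrable_finsetSum _ fun j _ => iu g j).add
        (g.integrable_of_eq_zero (by fun_prop) fun p hp => by
          simp [image_eq_zero_of_notMem_tsupport hp])).add
        (Continuous.integrable_of_hasCompactSupport ?_ (HasCompactSupport.intro χ.compact
          fun p hp => by
            simp [image_eq_zero_of_notMem_tsupport hp, pd_eq_zero_of_notMem_tsupport hp]))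
      simp only [transport_eq_sum]
      fun_prop
    rw [← integral_const_mul, ← integral_add iE (ig.const_mul _),
      ← integral_add (integrable_finsetSum _ fun j _ => iu g j) ig,
      ← integral_sub (f := fun p => ∑ j, ‖pd (0, e j) g p‖ ^ 2 + ‖g p‖ ^ 2)
        ((integrable_finsetSum _ fun j _ => iu g j).add ig) iβ]
    refine integral_mono (((integrable_finsetSum _ fun j _ => iu g j).add ig).sub iβ)
      (iE.add (ig.const_mul _)) fun p => ?_
    beta_reduce
    have hx : 0 ≤ ∑ j, (p.2 j * χ.toFun p / 2 + pd (e j, 0) χ.toFun p) ^ 2 :=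
      Finset.sum_nonneg fun _ _ => sq_nonneg _
    have hx' : ∑ j, (p.2 j * χ.toFun p / 2 + pd (e j, 0) χ.toFun p) ^ 2
        = ‖p.2‖ ^ 2 / 4 * χ.toFun p ^ 2 + χ.toFun p * ∑ j, p.2 j * pd (e j, 0) χ.toFun p
          + ∑ j, pd (e j, 0) χ.toFun p ^ 2 := by
      rw [norm_sq_eq_sum, Finset.sum_div, Finset.sum_mul, Finset.mul_sum, ← Finset.sum_add_distrib,
        ← Finset.sum_add_distrib]
      exact Finset.sum_congr rfl fun j _ => by ring
    have hv : χ.toFun p * ∑ j, pd (e j) V p.1 * pd (0, e j) χ.toFun p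
        ≤ ∑ j, |χ.toFun p * (pd (e j) V p.1 * pd (0, e j) χ.toFun p)| := by
      rw [Finset.mul_sum]
      exact Finset.sum_le_sum fun j _ => le_abs_self _
    rw [transport_eq_sum, hgv]
    simp only [hβ]
    rw [hx'] at hx
    nlinarith [mul_nonneg (sq_nonneg ‖w p‖) hx, mul_le_mul_of_nonneg_left hv (sq_nonneg ‖w p‖)]
  have hfin := (Complex.re_le_norm _).trans hM
  rw [hre] at hfin
  have hS' : ∫ p, χ.toFun p ^ 2 * ‖conv ρ f p‖ ^ 2 = S := by
    rw [← hwdef]; simp only [hS, hgv]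
  rw [hS']
  have hbound : (n + 1) * τ * (F + (∫ p, ‖h p‖ ^ 2) + ∑ j, ∫ p, ‖pd (0, e j) h p‖ ^ 2)
      ≤ (n + 1) * τ * (2 * (n + 1) * F + 2 * Q) := by
    refine mul_le_mul_of_nonneg_left ?_ (by positivity)
    nlinarith
  have hQτ := mul_le_mul_of_nonneg_right hτ1 hQ0
  linarith

theorem dense_range_embed (n : ℕ) :
    Dense (LinearMap.range (embed (R2n n)) : Set (L2 (R2n n))) := by
  refine (Lp.dense_hasCompactSupport_contDiff (p := 2) (by simp)).mono ?_
  rintro f ⟨g, hfg, hg, hg'⟩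
  refine ⟨mkCc g hg' hg, Lp.ext ?_⟩
  exact ((isTestOperator_id.memLp (mkCc g hg' hg)).coeFn_toLp).trans hfg.symm

theorem exists_radius_dist_le {E : Type} [NormedAddCommGroup E] {K : Set (R2n n)}
    (hK : IsCompact K) {g : R2n n → E} (hg : Continuous g) {τ : ℝ} (hτ : 0 < τ) :
    ∃ r > 0, ∀ p q, q ∈ K → ‖p - q‖ < r → ‖g q - g p‖ ≤ τ := by
  obtain ⟨r, hr, h⟩ := Metric.mem_uniformity_dist.1
    (hK.uniformContinuousAt_of_continuousAt g (fun a _ => hg.continuousAt)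
      (Metric.dist_mem_uniformity hτ))
  refine ⟨r, hr, fun p q hq hpq => ?_⟩
  rw [← dist_eq_norm, dist_comm] at hpq
  rw [← dist_eq_norm]
  exact (h hpq hq).le

/-- The adjoint equation `(P* + n/2 + 1) f = 0` has no non-zero weak solution in `L²`. -/
theorem eq_zero_of_weak_solution (hV : ContDiff ℝ 2 V) {f : L2 (R2n n)}
    (hf : ∀ u : Cc (R2n n),
      ∫ p, conj (f p) * (fokkerPlanckExpr V u p + ((n / 2 + 1 : ℝ) : ℂ) * u p) = 0) : f = 0 := by
  suffices h : ∀ φ : Cc (R2n n), ∫ p, conj (f p) * φ p = 0 by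
    refine (dense_range_embed n).eq_zero_of_inner_left ℂ ?_
    rintro _ ⟨φ, rfl⟩
    exact (inner_toLp_right f (isTestOperator_id.memLp φ)).trans (h φ)
  intro φ
  set F : ℝ := ∫ p, ‖f p‖ ^ 2 with hFdef
  have hF : 0 ≤ F := integral_nonneg fun _ => sq_nonneg _
  set S : ℝ := ∫ p, ‖φ p‖ ^ 2 with hSdef
  have hS : 0 ≤ S := integral_nonneg fun _ => sq_nonneg _
  have hφc := φ.continuous
  obtain ⟨R, hR⟩ := φ.hasCompactSupport.isCompact.isBounded.exists_norm_le
  obtain ⟨θ, -, -, hθ1, -⟩ := exists_slow_cutoff hV (R + 1) one_pos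
  have hθc := θ.smooth.continuous
  set Θ : ℝ := ∫ p, ‖(θ.toFun p : ℂ)‖ ^ 2 with hΘdef
  have hΘ : 0 ≤ Θ := integral_nonneg fun _ => sq_nonneg _
  suffices h : ∀ s : ℝ, 0 < s → ‖∫ p, conj (f p) * φ p‖ ≤ s * (2 * F + S + Θ) by
    rw [← norm_le_zero_iff]
    refine le_of_forall_pos_le_add fun ε hε => ?_
    refine (h (ε / (2 * F + S + Θ + 1)) (by positivity)).trans ?_
    rw [zero_add, div_mul_eq_mul_div, div_le_iff₀ (by positivity)]
    nlinarith
  intro s hs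
  have hn : (0 : ℝ) ≤ n := n.cast_nonneg
  set η : ℝ := min 1 (s ^ 2 / (2 * (3 * n + 1))) with hηdef
  have hη : 0 < η := lt_min one_pos (by positivity)
  obtain ⟨χ, hχ0, hχ1, hχR, hχx, hχy, hχV⟩ := exists_slow_cutoff hV R hη
  set τ : ℝ := min (1 / (2 * (n + 1))) (s ^ 2 / (4 * (n + 1) ^ 2)) with hτdef
  have hτ : 0 < τ := lt_min (by positivity) (by positivity)
  have hgradc : Continuous (grad V) := by
    have : ∀ j, Continuous (pd (e j) V) := fun j => (contDiff_pd_potential hV _).continuous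
    unfold grad
    fun_prop
  obtain ⟨r₁, hr₁, h₁⟩ := exists_radius_dist_le χ.compact.isCompact
    (g := fun p : R2n n => grad V p.1) (by fun_prop) hτ
  obtain ⟨r₂, hr₂, h₂⟩ := exists_radius_dist_le χ.compact.isCompact
    (g := fun p : R2n n => ‖p.2‖ ^ 2 / 4) (by fun_prop) hτ
  obtain ⟨r₃, hr₃, h₃⟩ := Metric.uniformContinuous_iff.1
    (φ.hasCompactSupport.uniformContinuous_of_continuous hφc) s hs
  set r : ℝ := min (min r₁ r₂) (min r₃ 1) with hrdef
  have hr : 0 < r := lt_min (lt_min hr₁ hr₂) (lt_min hr₃ one_pos)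
  obtain ⟨ρ, hρ, hρτ⟩ := exists_mollifier n hr hτ
  have hρc := ρ.smooth.continuous
  have hmain := integral_norm_cutoff_conv_sq_le hV hf hρ hτ.le (by
      calc 2 * (n + 1) * τ ≤ 2 * (n + 1) * (1 / (2 * (n + 1))) := by
            gcongr; exact min_le_left _ _
        _ = 1 := by field_simp) hρτ
    (fun p q hq hpq j => (abs_apply_le_norm (grad V q.1 - grad V p.1) j).trans (h₁ p q hq
      (hpq.trans_le ((min_le_left _ _).trans (min_le_left _ _)))))
    (fun p q hq hpq => by
      have := h₂ p q hq (hpq.trans_le ((min_le_left _ _).trans (min_le_right _ _)))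
      rw [Real.norm_eq_abs, abs_sub_comm, ← sub_div] at this
      exact this) hη (min_le_left _ _) hχ0 hχ1 hχx hχy hχV
  have hmain' : ∫ p, χ.toFun p ^ 2 * ‖conv ρ f p‖ ^ 2 ≤ s ^ 2 * F := by
    refine hmain.trans (mul_le_mul_of_nonneg_right ?_ hF)
    have a1 : (3 * n + 1) * η ≤ s ^ 2 / 2 := by
      calc (3 * n + 1) * η ≤ (3 * n + 1) * (s ^ 2 / (2 * (3 * n + 1))) := by
            gcongr; exact min_le_right _ _
        _ = s ^ 2 / 2 := by field_simp
    have a2 : 2 * (n + 1) ^ 2 * τ ≤ s ^ 2 / 2 := by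
      calc 2 * (n + 1) ^ 2 * τ ≤ 2 * (n + 1) ^ 2 * (s ^ 2 / (4 * (n + 1) ^ 2)) := by
            gcongr; exact min_le_right _ _
        _ = s ^ 2 / 2 := by field_simp; norm_num
    linarith
  have hw := (contDiff_conv ρ (locallyIntegrable_L2 f)).continuous
  -- the mollified function is small on the support of `φ`
  have hA : ‖∫ q, conj (conv ρ f q) * φ q‖ ≤ s * (F + S) := by
    have i1 : Integrable (fun p => χ.toFun p ^ 2 * ‖conv ρ f p‖ ^ 2) := by
      have hχc := χ.smooth.continuous
      exact Continuous.integrable_of_hasCompactSupport (by fun_prop) χ.sq.compact.mul_right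
    have i2 := integrable_norm_sq φ
    refine (norm_integral_le_of_norm_le ((i1.const_mul s⁻¹).add (i2.const_mul s))
      (Filter.Eventually.of_forall fun p => ?_)).trans ?_
    · change _ ≤ s⁻¹ * (χ.toFun p ^ 2 * ‖conv ρ f p‖ ^ 2) + s * ‖φ p‖ ^ 2
      rw [norm_mul, RCLike.norm_conj]
      by_cases hp : p ∈ tsupport φ
      · rw [hχR p (hR p hp), one_pow, one_mul]
        set x := ‖conv ρ f p‖
        set y := ‖φ p‖
        have hx : s⁻¹ * x ^ 2 + s * y ^ 2 - x * y
            = s⁻¹ * ((x - s * y / 2) ^ 2 + 3 / 4 * (s * y) ^ 2) := by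
          field_simp
          ring
        have : 0 ≤ s⁻¹ * ((x - s * y / 2) ^ 2 + 3 / 4 * (s * y) ^ 2) := by positivity
        linarith
      · rw [image_eq_zero_of_notMem_tsupport hp, norm_zero, mul_zero]
        positivity
    · refine (integral_add (i1.const_mul s⁻¹) (i2.const_mul s)).trans_le ?_
      rw [integral_const_mul, integral_const_mul, mul_add]
      refine add_le_add ?_ le_rfl
      rw [inv_mul_le_iff₀ hs]
      linarith
  -- mollification moves `φ` only a little
  have hφi : ∀ p, ∫ q, ρ.toFun (p - q) • (φ q - φ p) = conv ρ φ p - φ p := fun p => by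
    have j1 : Integrable fun q => ρ.toFun (p - q) • φ q :=
      φ.integrable_of_eq_zero (by fun_prop) fun q hq => by
        simp [image_eq_zero_of_notMem_tsupport hq]
    have j2 : Integrable fun q => ρ.toFun (p - q) • φ p :=
      ((hρc.integrable_of_hasCompactSupport ρ.compact).comp_sub_left p).smul_const _
    simp only [smul_sub]
    rw [integral_sub j1 j2, integral_smul_const, integral_sub_left_eq_self ρ.toFun volume p,
      hρ.integral_eq, one_smul]
    rfl
  have hB := norm_integral_conj_mul_kernel_le (k := fun z => s * ρ.toFun z) (by fun_prop)
    ρ.compact.mul_left f (G := fun q => (θ.toFun q : ℂ)) (by fun_prop)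
    (θ.compact.comp_left Complex.ofReal_zero)
    (a := fun z => ρ.toFun (z.1 - z.2) • (φ z.2 - φ z.1)) (by fun_prop) fun p q => by
      rw [abs_mul, abs_of_pos hs, norm_smul, Real.norm_eq_abs, mul_comm s, mul_assoc]
      rcases le_or_gt r ‖p - q‖ with hpq | hpq
      · simp [hρ.eq_zero _ hpq]
      refine mul_le_mul_of_nonneg_left ?_ (abs_nonneg _)
      rcases le_or_gt ‖q‖ (R + 1) with hq | hq
      · rw [hθ1 q hq, Complex.ofReal_one, norm_one, mul_one, ← dist_eq_norm]
        refine (h₃ ?_).le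
        rw [dist_comm, dist_eq_norm]
        exact hpq.trans_le ((min_le_right _ _).trans (min_le_left _ _))
      · have hpq1 : ‖p - q‖ < 1 := hpq.trans_le ((min_le_right _ _).trans (min_le_right _ _))
        have hq0 : φ q = 0 := by
          refine image_eq_zero_of_notMem_tsupport fun h => ?_
          linarith [hR q h]
        have hp0 : φ p = 0 := by
          refine image_eq_zero_of_notMem_tsupport fun h => ?_
          have := norm_le_norm_add_norm_sub' q p
          rw [norm_sub_rev] at this
          linarith [hR p h]
        rw [hq0, hp0, sub_zero, norm_zero]
        positivity
  have hB1 := hB.1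
  have hB2 := hB.2
  simp only [hφi] at hB1 hB2
  have hki : ∫ z, |s * ρ.toFun z| = s := by
    simp only [abs_of_nonneg (mul_nonneg hs.le (hρ.nonneg _)), integral_const_mul, hρ.integral_eq,
      mul_one]
  rw [hki] at hB2
  have hfφ : Integrable fun p => conj (f p) * φ p :=
    MemLp.integrable_mul (Lp.memLp f).star (isTestOperator_id.memLp φ)
  have hsplit : ∫ p, conj (f p) * φ p
      = (∫ q, conj (conv ρ f q) * φ q) - ∫ p, conj (f p) * (conv ρ φ p - φ p) := by
    rw [← integral_conj_mul_conv hρ.even f hφc φ.hasCompactSupport, eq_sub_iff_add_eq,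
      ← integral_add hfφ hB1]
    refine integral_congr_ae (Filter.Eventually.of_forall fun p => ?_)
    ring
  rw [hsplit]
  refine (norm_sub_le _ _).trans ((add_le_add hA hB2).trans ?_)
  nlinarith [mul_nonneg hs.le hΘ, mul_nonneg hs.le hF]

end density

end

section

variable {n : ℕ} {V : Rn n → ℝ}

open scoped ComplexConjugate InnerProductSpace

/-- If `|∂ₓV|` tends to infinity and the Hessian of `V` is controlled, then the Fokker–Planck
operator has compact resolvent. -/
theorem hasCompactResolvent_fokkerPlanckOperator (hV : ContDiff ℝ 2 V) {C : ℝ}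
    (hC : HessBound V C) (hb : ∀ M, Bornology.IsBounded {x | Phi V x ≤ M}) :
    HasCompactResolvent (fokkerPlanckOperator hV) := by
  set D := isTestOperator_fokkerPlanckExpr hV
  have hDu : ∀ u : (minimalOperator D).domain, ∃ φ : Cc (R2n n),
      (u : L2 (R2n n)) = embed (R2n n) φ ∧ minimalOperator D u = D.toL2 φ := by
    rintro ⟨_, φ, rfl⟩
    exact ⟨φ, rfl, minimalOperator_apply D φ⟩
  refine hasCompactResolvent_closure (minimalOperator D) (dense_range_embed n) (n / 2)
    (by positivity) (fun u => ?_) (fun f hf => ?_) (fun ε hε => ?_)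
  · obtain ⟨φ, h1, h2⟩ := hDu u
    rw [h1, h2, norm_embed_sq]
    have h3 : (⟪embed (R2n n) φ, D.toL2 φ⟫_ℂ).re
        = ∫ p, inner ℝ (φ p) (fokkerPlanckExpr V φ p) := by
      have h4 : ⟪embed (R2n n) φ, D.toL2 φ⟫_ℂ = ∫ p, conj (φ p) * fokkerPlanckExpr V φ p :=
        inner_toLp_toLp (isTestOperator_id.memLp φ) (D.memLp φ)
      have hi : Integrable fun p => conj (φ p) * fokkerPlanckExpr V φ p :=
        MemLp.integrable_mul (isTestOperator_id.memLp φ).star (D.memLp φ)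
      rw [h4]
      exact (integral_re hi).symm.trans (integral_congr_ae (Filter.Eventually.of_forall fun p =>
        re_conj_mul _ _))
    rw [h3, integral_inner_fokkerPlanck hV]
    have : 0 ≤ ∫ p, dissip φ p := integral_nonneg fun p => dissip_nonneg _ p
    linarith
  · refine eq_zero_of_weak_solution hV fun u => ?_
    have h1 := hf ⟨embed (R2n n) u, LinearMap.mem_range_self _ u⟩
    rw [minimalOperator_apply, inner_add_right, inner_smul_right] at h1
    have h2 : ⟪f, D.toL2 u⟫_ℂ = ∫ p, conj (f p) * fokkerPlanckExpr V u p :=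
      inner_toLp_right f (D.memLp u)
    have h3 : ⟪f, embed (R2n n) u⟫_ℂ = ∫ p, conj (f p) * u p :=
      inner_toLp_right f (isTestOperator_id.memLp u)
    have i2 : Integrable fun p => conj (f p) * fokkerPlanckExpr V u p :=
      MemLp.integrable_mul (Lp.memLp f).star (D.memLp u)
    have i3 : Integrable fun p => conj (f p) * u p :=
      MemLp.integrable_mul (Lp.memLp f).star (isTestOperator_id.memLp u)
    rw [h2, h3, ← integral_const_mul, ← integral_add i2 (i3.const_mul _)] at h1
    rw [← h1]
    exact integral_congr_ae (Filter.Eventually.of_forall fun p => by ring)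
  · obtain ⟨N, ℓ, h⟩ := exists_compactness_estimate hV hC hb hε
    refine ⟨N, ℓ, fun u => ?_⟩
    obtain ⟨φ, h1, h2⟩ := hDu u
    rw [h1, h2, norm_toL2_sq]
    refine (norm_embed_sq φ).trans_le ((h φ).trans_eq ?_)
    congr 2
    rw [norm_embed_sq]
    refine integral_add ?_ (integrable_norm_sq φ)
    exact (D.memLp φ).integrable_norm_pow two_ne_zero

end

end FokkerPlanck

end


open FokkerPlanck in
theorem corollary1p4 (n : ℕ) (V : Rn n → ℝ) (hV : ContDiff ℝ 2 V) (s : ℝ) (hs : s < 4 / 3)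
    (hVs : ∀ i j : Fin n, ∃ C : ℝ, 0 < C ∧
      ∀ x : Rn n, |pd (e i) (pd (e j) V) x| ≤ C * (1 + gradSq V x) ^ (s / 2))
    (hW : HasCompactResolvent (wittenLaplacian hV)) :
    HasCompactResolvent (fokkerPlanckOperator hV) := by
  obtain ⟨C, hC⟩ := exists_hessBound hs hVs
  exact hasCompactResolvent_fokkerPlanckOperator hV hC fun M => isBounded_Phi_le hV hC hW M
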